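/- Let $\Xi$ be a compact connected Riemann surface of genus $g\ge 0$ with complex structure $j$, and let $\mathcal N:\Xi\to\Xi$ be an involution with $d\mathcal N\circ j=-j\circ d\mathcal N$ (i.e. $\mathcal N$ is antiholomorphic) whose fixed point set $\mathcal L$ is non-empty and such that $\Xi\setminus\mathcal L$ has exactly two connected components. Let $s^+,s^-,t^+,t^-\ge 0$ be integers and let $$u_1,\dots,u_{s^+};\ u'_1,\dots,u'_{s^-};\ v_1,\dots,v_{t^+},w_1,\dots,w_{t^+};\ v'_1,\dots,v'_{t^-},w'_1,\dots,w'_{t^-}$$ be pairwise distinct points of $\Xi$ with $\mathcal N(u_i)=u_i$, $\mathcal N(u'_i)=u'_i$, $\mathcal N(v_k)=w_k$ and $\mathcal N(v'_k)=w'_k$. Let $\Theta=\Theta_{g,s^++s^-,t^++t^-}$ be the complement of these points in $\Xi$, and let $\mathrm{Aut}(\Theta)$ be the group of biholomorphic maps $h:\Theta\to\Theta$ with $h\circ\mathcal N=\mathcal N\circ h$, with the compact-open topology. Assume that there is at least one puncture if $g=1$. Then $\mathrm{Aut}(\Theta)$ is a manifold whose real dimension is - $0$ if $3g+s^++s^-+2t^++2t^--3>0$;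 - $3-3g-s^+-s^--2t^+-2t^-$ if $3g+s^++s^-+2t^++2t^--3\le 0$. The same holds for the subgroup of those $h\in\mathrm{Aut}(\Theta)$ whose extension to $\Xi$ fixes every puncture. -/

import Mathlib

open Set Filter Topology TopologicalSpace
open scoped Manifold ContDiff ComplexConjugate

noncomputable section

namespace Brake

/-! ### The first cohomology of the structure sheaf, and the genus -/

section Genus

variable (X : Type*) [TopologicalSpace X] [ChartedSpace ℂ X]

/-- `U` is an open covering of `X` indexed by the points of `X`, with `x ∈ U x`. Every open covering
has a refinement of this form (choose for each point a member containing it), so these coverings,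
ordered by pointwise inclusion, are cofinal among all open coverings. -/
def IsPointCover {X : Type*} [TopologicalSpace X] (U : X → Set X) : Prop :=
  ∀ x, IsOpen (U x) ∧ x ∈ U x

/-- `c` is a Čech 1-cocycle of the covering `U` with values in holomorphic functions: `c x y` is
holomorphic on `U x ∩ U y` and `c x y + c y z = c x z` on `U x ∩ U y ∩ U z`. The values of `c x y`
outside `U x ∩ U y` play no role. -/
def IsCocycleOn {X : Type*} [TopologicalSpace X] [ChartedSpace ℂ X]
    (U : X → Set X) (c : X → X → X → ℂ) : Prop :=
  (∀ x y, MDifferentiableOn 𝓘(ℂ) 𝓘(ℂ) (c x y) (U x ∩ U y)) ∧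
  ∀ x y z, ∀ p ∈ U x ∩ U y ∩ U z, c x y p + c y z p = c x z p

/-- `c` is the coboundary on the covering `U` of a 0-cochain of holomorphic functions `b x` on
`U x`. -/
def IsCoboundaryOn {X : Type*} [TopologicalSpace X] [ChartedSpace ℂ X]
    (U : X → Set X) (c : X → X → X → ℂ) : Prop :=
  ∃ b : X → X → ℂ, (∀ x, MDifferentiableOn 𝓘(ℂ) 𝓘(ℂ) (b x) (U x)) ∧
    ∀ x y, ∀ p ∈ U x ∩ U y, c x y p = b y p - b x p

/-- The families that are 1-cocycles on some covering. -/
def cocycles : Submodule ℂ (X → X → X → ℂ) where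
  carrier := {c | ∃ U, IsPointCover U ∧ IsCocycleOn U c}
  zero_mem' := ⟨fun _ => univ, fun _ => ⟨isOpen_univ, mem_univ _⟩,
    fun _ _ => mdifferentiableOn_const, fun _ _ _ _ _ => by simp⟩
  add_mem' := by
    rintro c d ⟨U, hU, hc, hc'⟩ ⟨V, hV, hd, hd'⟩
    refine ⟨fun x => U x ∩ V x, fun x => ⟨(hU x).1.inter (hV x).1, (hU x).2, (hV x).2⟩,
      fun x y => ?_, fun x y z p hp => ?_⟩
    · exact ((hc x y).mono fun p hp => ⟨hp.1.1, hp.2.1⟩).add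
        ((hd x y).mono fun p hp => ⟨hp.1.2, hp.2.2⟩)
    · have h1 := hc' x y z p ⟨⟨hp.1.1.1, hp.1.2.1⟩, hp.2.1⟩
      have h2 := hd' x y z p ⟨⟨hp.1.1.2, hp.1.2.2⟩, hp.2.2⟩
      simp only [Pi.add_apply, ← h1, ← h2]
      ring
  smul_mem' := by
    rintro a c ⟨U, hU, hc, hc'⟩
    refine ⟨U, hU, fun x y => (hc x y).const_smul a, fun x y z p hp => ?_⟩
    simp only [Pi.smul_apply, ← hc' x y z p hp, smul_add]

/-- The families that are coboundaries on some covering. -/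
def coboundaries : Submodule ℂ (X → X → X → ℂ) where
  carrier := {c | ∃ U, IsPointCover U ∧ IsCoboundaryOn U c}
  zero_mem' := ⟨fun _ => univ, fun _ => ⟨isOpen_univ, mem_univ _⟩, fun _ _ => 0,
    fun _ => mdifferentiableOn_const, fun _ _ _ _ => by simp⟩
  add_mem' := by
    rintro c d ⟨U, hU, b, hb, hc⟩ ⟨V, hV, e, he, hd⟩
    refine ⟨fun x => U x ∩ V x, fun x => ⟨(hU x).1.inter (hV x).1, (hU x).2, (hV x).2⟩,
      fun x => b x + e x, fun x => ?_, fun x y p hp => ?_⟩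
    · exact ((hb x).mono fun p hp => hp.1).add ((he x).mono fun p hp => hp.2)
    · have h1 := hc x y p ⟨hp.1.1, hp.2.1⟩
      have h2 := hd x y p ⟨hp.1.2, hp.2.2⟩
      simp only [Pi.add_apply, h1, h2]
      ring
  smul_mem' := by
    rintro a c ⟨U, hU, b, hb, hc⟩
    refine ⟨U, hU, fun x => a • b x, fun x => (hb x).const_smul a, fun x y p hp => ?_⟩
    simp only [Pi.smul_apply, hc x y p hp, smul_sub]

/-- The Čech cohomology group `H¹(X, 𝒪)`: the direct limit over all open coverings `U` of
(cocycles on `U`) / (coboundaries on `U`). For the point-indexed coverings a refinement map sends a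
family `c` to itself, so the direct limit is the quotient of the union of the cocycle spaces by
the union of the coboundary spaces. -/
abbrev H1 : Type _ := cocycles X ⧸ (coboundaries X).comap (cocycles X).subtype

/-- The compact Riemann surface `X` has genus `g`: `dim_ℂ H¹(X, 𝒪) = g`. -/
def HasGenus (g : ℕ) : Prop := Module.rank ℂ (H1 X) = g

end Genus

/-! ### Brake-symmetric Riemann surfaces with punctures -/

variable {X : Type*} [TopologicalSpace X] [ChartedSpace ℂ X]

/-- `f` is antiholomorphic: it is continuous and, in charts, the complex conjugate of `f` is
complex differentiable at every point. -/
def IsAntiholomorphic (f : X → X) : Prop :=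
  Continuous f ∧ ∀ x, DifferentiableAt ℂ
    (fun z => conj (writtenInExtChartAt 𝓘(ℂ) 𝓘(ℂ) x f z)) (extChartAt 𝓘(ℂ) x x)

/-- The complex structure `j` of `X` and the involution `N` satisfy `N j = - j N`, the fixed
point set of `N` is not empty, and its complement has exactly two connected components. -/
structure IsBrakeInvolution (N : X → X) : Prop where
  involutive : Function.Involutive N
  antiholomorphic : IsAntiholomorphic N
  fixed_nonempty : (Function.fixedPoints N).Nonempty
  two_components : Nat.card (ConnectedComponents ↥((Function.fixedPoints N)ᶜ)) = 2

/-- Punctures on `X`: `sp + sm` fixed points `u i`, `u' i` of `N` and `tp + tm` pairs `(v k, w k)`,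
`(v' k, w' k)` of points exchanged by `N`, all of these points being distinct. -/
structure Punctures (N : X → X) (sp sm tp tm : ℕ) where
  u : Fin sp → X
  u' : Fin sm → X
  v : Fin tp → X
  w : Fin tp → X
  v' : Fin tm → X
  w' : Fin tm → X
  map_u : ∀ i, N (u i) = u i
  map_u' : ∀ i, N (u' i) = u' i
  map_v : ∀ k, N (v k) = w k
  map_v' : ∀ k, N (v' k) = w' k
  distinct : Function.Injective
    (Sum.elim (Sum.elim u u') (Sum.elim (Sum.elim v w) (Sum.elim v' w')))

namespace Punctures

variable {N : X → X} {sp sm tp tm : ℕ} (P : Punctures N sp sm tp tm)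

/-- The set of all punctures. -/
def points : Set X :=
  range P.u ∪ range P.u' ∪ (range P.v ∪ range P.w) ∪ (range P.v' ∪ range P.w')

theorem finite_points : P.points.Finite :=
  (((finite_range _).union (finite_range _)).union
    ((finite_range _).union (finite_range _))).union ((finite_range _).union (finite_range _))

theorem map_mem_points (hN : Function.Involutive N) {x : X} (hx : x ∈ P.points) :
    N x ∈ P.points := by
  rcases hx with ((⟨i, rfl⟩ | ⟨i, rfl⟩) | (⟨i, rfl⟩ | ⟨i, rfl⟩)) | (⟨i, rfl⟩ | ⟨i, rfl⟩)
  · exact .inl (.inl (.inl ⟨i, (P.map_u i).symm⟩))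
  · exact .inl (.inl (.inr ⟨i, (P.map_u' i).symm⟩))
  · exact .inl (.inr (.inr ⟨i, (P.map_v i).symm⟩))
  · exact .inl (.inr (.inl ⟨i, by rw [← P.map_v i, hN]⟩))
  · exact .inr (.inr ⟨i, (P.map_v' i).symm⟩)
  · exact .inr (.inl ⟨i, by rw [← P.map_v' i, hN]⟩)

variable [T2Space X]

/-- The punctured Riemann surface `Θ`, an open subset of `X`. -/
def theta : Opens X := ⟨P.pointsᶜ, P.finite_points.isClosed.isOpen_compl⟩

/-- The involution of `Θ` induced by `N`. -/
def invol (hN : Function.Involutive N) (x : P.theta) : P.theta :=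
  ⟨N x, fun h => x.2 (by simpa only [hN (x : X)] using P.map_mem_points hN h)⟩

/-- The automorphism group of `Θ`: all biholomorphic maps of `Θ` onto itself that commute with the
involution. -/
def aut (hN : Function.Involutive N) : Subgroup (P.theta ≃ₜ P.theta) where
  carrier := {h | MDifferentiable 𝓘(ℂ) 𝓘(ℂ) h ∧ MDifferentiable 𝓘(ℂ) 𝓘(ℂ) h.symm ∧
    ∀ x, h (P.invol hN x) = P.invol hN (h x)}
  one_mem' := ⟨mdifferentiable_id, mdifferentiable_id, fun _ => rfl⟩
  mul_mem' := by
    rintro h k ⟨h1, h2, h3⟩ ⟨k1, k2, k3⟩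
    exact ⟨h1.comp k1, k2.comp h2, fun x => (congrArg h (k3 x)).trans (h3 (k x))⟩
  inv_mem' := by
    rintro h ⟨h1, h2, h3⟩
    refine ⟨h2, h1, fun x => h.injective ?_⟩
    change h (h.symm _) = h (P.invol hN (h.symm x))
    rw [h3, h.apply_symm_apply, h.apply_symm_apply]

/-- The subgroup of those automorphisms of `Θ` that keep every puncture fixed, that is, whose
continuous extension to `X`, and that of the inverse, fix every puncture. -/
def pureAut (hN : Function.Involutive N) : Subgroup (P.theta ≃ₜ P.theta) where
  carrier := {h | h ∈ P.aut hN ∧ ∀ p ∈ P.points,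
    Tendsto h (comap ((↑) : P.theta → X) (𝓝 p)) (comap ((↑) : P.theta → X) (𝓝 p)) ∧
    Tendsto h.symm (comap ((↑) : P.theta → X) (𝓝 p)) (comap ((↑) : P.theta → X) (𝓝 p))}
  one_mem' := ⟨one_mem _, fun _ _ => ⟨tendsto_id, tendsto_id⟩⟩
  mul_mem' := by
    rintro h k ⟨h1, h2⟩ ⟨k1, k2⟩
    exact ⟨mul_mem h1 k1, fun p hp =>
      ⟨(h2 p hp).1.comp (k2 p hp).1, (k2 p hp).2.comp (h2 p hp).2⟩⟩
  inv_mem' := by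
    rintro h ⟨h1, h2⟩
    exact ⟨inv_mem h1, fun p hp => ⟨(h2 p hp).2, (h2 p hp).1⟩⟩

end Punctures

/-- The group `G` of homeomorphisms of `Y`, with the compact-open topology (uniform convergence
on compact sets), is a topological manifold of real dimension `d`: it is covered by open sets
that are homeomorphic to open subsets of `ℝ^d`. -/
def HasRealDim {Y : Type*} [TopologicalSpace Y] (G : Subgroup (Y ≃ₜ Y)) (d : ℕ) : Prop :=
  letI : TopologicalSpace G :=
    TopologicalSpace.induced (fun h => ((h : Y ≃ₜ Y) : C(Y, Y))) inferInstance
  Nonempty (ChartedSpace (EuclideanSpace ℝ (Fin d)) G)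

end Brake

end

open Set Filter Topology TopologicalSpace
open scoped Manifold ContDiff ComplexConjugate

noncomputable section

set_option linter.unusedSectionVars false

/-! An automorphism of the punctured surface that is close to the identity on a compact set can
neither move one puncture to another nor push points out of their small punctured discs. It
therefore fixes every puncture and extends to a biholomorphic map of the compact surface
(`eventually_mem_pureAut`, `exists_extension`). Near the identity the two groups of the theorem thus
coincide, and since left translations are homeomorphisms only a neighbourhood of the identity
matters.

Positive genus, with a puncture when the genus is one. The biholomorphic maps in question satisfy `k
^ E = 1` for one fixed `E` (`exists_exponent`). If such a `k` and its iterates are close to the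
identity in a chart, the average `Φ` of the iterates is injective and satisfies `Φ ∘ k = Φ`, so `k =
1`. The group is discrete.

The exponent comes from two facts. First, for genus at least two, the map induced on the dual of the
first cohomology has an eigenvector. A functional plays the part of a holomorphic differential, with
zeros defined through its values on simple poles. The zeros of an eigenvector are carried to zeros
by `h⁻¹`; there is at least one (`genus_le_one_of_no_zeros`), and there are fewer than `2 g`
(`not_injective_of_isZeroOf`), so some point has period at most `2 g`. Second, at a fixed point
there are functions `f`, `F` with poles of consecutive orders `n`, `n + 1` and no other pole. If the
derivative `a` of the automorphism is not a root of unity of small order, both may be taken to be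
eigenfunctions. Comparing `F ^ n` with `f ^ (n + 1)` then yields either a relation `a ^ j = 1` or a
function with one simple pole, which forces genus zero. An automorphism with derivative one at a
fixed point is the identity, by its action on functions whose only pole is that point.

Genus zero. A function with a simple pole at a fixed point of the involution can be made real with
respect to the involution. It identifies the surface with the sphere carrying complex conjugation,
and real invertible matrices act by Möbius transformations. At most two punctures leave a
`d`-parameter family of these, and the images of `d` real points are coordinates on the group. With
three or more punctures nothing but the identity fixes them all.

All function theory is drawn from the definition of the genus by linear algebra: families of germs
modulo global meromorphic functions compute the first cohomology (`adeleClass_eq_zero_iff`,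
`adeleClass_surjective`), so any `g + 1` prescribed principal parts have a nontrivial combination
that is realised by a function. -/

namespace Brake

/-! ### Meromorphic functions on a Riemann surface -/

section Local

variable {X : Type*} [TopologicalSpace X] [ChartedSpace ℂ X]

/-- `f` is meromorphic at `x`, read in the preferred chart at `x`. -/
def MerAt (f : X → ℂ) (x : X) : Prop :=
  MeromorphicAt (f ∘ (chartAt ℂ x).symm) (chartAt ℂ x x)

/-- `f` is holomorphic near `x`, read in the preferred chart at `x`. -/
def HolAt (f : X → ℂ) (x : X) : Prop :=
  AnalyticAt ℂ (f ∘ (chartAt ℂ x).symm) (chartAt ℂ x x)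

/-- The order of `f` at `x`, read in the preferred chart at `x`. -/
def ordAt (f : X → ℂ) (x : X) : WithTop ℤ :=
  meromorphicOrderAt (f ∘ (chartAt ℂ x).symm) (chartAt ℂ x x)

/-- `f` is meromorphic on the whole surface. -/
def Mer (f : X → ℂ) : Prop := ∀ x, MerAt f x

/-- Every statement about germs at `x` is moved between the chart and the surface through this
identity of filters. -/
theorem map_chart_symm_nhdsNE (x : X) :
    map (chartAt ℂ x).symm (𝓝[≠] (chartAt ℂ x x)) = 𝓝[≠] x := by
  have hx := mem_chart_source ℂ x
  ext s
  rw [mem_map, mem_nhdsWithin_iff_eventually, mem_nhdsWithin_iff_eventually,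
    ← (chartAt ℂ x).eventually_nhds' _ hx]
  have h : ∀ᶠ z in 𝓝 (chartAt ℂ x x), z ∈ (chartAt ℂ x).target :=
    (chartAt ℂ x).open_target.mem_nhds ((chartAt ℂ x).map_source hx)
  refine eventually_congr (h.mono fun z hz => ?_)
  have : z ≠ chartAt ℂ x x ↔ (chartAt ℂ x).symm z ≠ x := by
    rw [not_iff_not]
    constructor
    · rintro rfl; exact (chartAt ℂ x).left_inv hx
    · intro h; rw [← (chartAt ℂ x).right_inv hz, h]
  simp only [mem_compl_iff, mem_singleton_iff, mem_preimage]
  exact imp_congr this Iff.rfl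

theorem eventually_chart_symm {x : X} {p : X → Prop} :
    (∀ᶠ z in 𝓝[≠] (chartAt ℂ x x), p ((chartAt ℂ x).symm z)) ↔ ∀ᶠ y in 𝓝[≠] x, p y := by
  rw [← map_chart_symm_nhdsNE x, eventually_map]

theorem tendsto_comp_chart_symm {x : X} {f : X → ℂ} {l : Filter ℂ} :
    Tendsto (f ∘ (chartAt ℂ x).symm) (𝓝[≠] (chartAt ℂ x x)) l ↔ Tendsto f (𝓝[≠] x) l := by
  rw [← map_chart_symm_nhdsNE x, tendsto_map'_iff]

instance nhdsNE_neBot_of_chart (x : X) : (𝓝[≠] x).NeBot := by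
  rw [← map_chart_symm_nhdsNE x]; infer_instance

variable {f g : X → ℂ} {x : X}

theorem HolAt.merAt (hf : HolAt f x) : MerAt f x := AnalyticAt.meromorphicAt hf

theorem HolAt.continuousAt (hf : HolAt f x) : ContinuousAt f x := by
  have h1 := ContinuousAt.comp_of_eq (AnalyticAt.continuousAt hf)
    ((chartAt ℂ x).continuousAt (mem_chart_source ℂ x)) rfl
  refine h1.congr ?_
  filter_upwards [(chartAt ℂ x).eventually_left_inverse (mem_chart_source ℂ x)] with y hy
  simp [hy]

theorem MerAt.congr (hf : MerAt f x) (h : f =ᶠ[𝓝[≠] x] g) : MerAt g x :=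
  MeromorphicAt.congr hf (eventually_chart_symm.2 h)

theorem ordAt_congr (h : f =ᶠ[𝓝[≠] x] g) : ordAt f x = ordAt g x :=
  meromorphicOrderAt_congr (eventually_chart_symm.2 h)

theorem HolAt.congr (hf : HolAt f x) (h : f =ᶠ[𝓝 x] g) : HolAt g x :=
  AnalyticAt.congr hf (((chartAt ℂ x).eventually_nhds' (fun y => f y = g y)
    (mem_chart_source ℂ x)).2 h)

theorem merAt_const (c : ℂ) : MerAt (fun _ : X => c) x := MeromorphicAt.const c _
theorem holAt_const (c : ℂ) : HolAt (fun _ : X => c) x :=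
  (analyticAt_const : AnalyticAt ℂ (fun _ : ℂ => c) _)
theorem MerAt.add (hf : MerAt f x) (hg : MerAt g x) : MerAt (f + g) x := MeromorphicAt.add hf hg
theorem MerAt.sub (hf : MerAt f x) (hg : MerAt g x) : MerAt (f - g) x := MeromorphicAt.sub hf hg
theorem MerAt.neg (hf : MerAt f x) : MerAt (-f) x := MeromorphicAt.neg hf
theorem MerAt.mul (hf : MerAt f x) (hg : MerAt g x) : MerAt (f * g) x := MeromorphicAt.mul hf hg
theorem MerAt.div (hf : MerAt f x) (hg : MerAt g x) : MerAt (f / g) x := MeromorphicAt.div hf hg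
theorem MerAt.inv (hf : MerAt f x) : MerAt f⁻¹ x := MeromorphicAt.inv hf
theorem MerAt.pow (hf : MerAt f x) (n : ℕ) : MerAt (f ^ n) x := MeromorphicAt.pow hf n
theorem MerAt.zpow (hf : MerAt f x) (n : ℤ) : MerAt (f ^ n) x := MeromorphicAt.zpow hf n
theorem MerAt.smul (hf : MerAt f x) (c : ℂ) : MerAt (c • f) x := MeromorphicAt.const_smul hf c
theorem HolAt.add (hf : HolAt f x) (hg : HolAt g x) : HolAt (f + g) x := AnalyticAt.add hf hg
theorem HolAt.sub (hf : HolAt f x) (hg : HolAt g x) : HolAt (f - g) x := AnalyticAt.sub hf hg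
theorem HolAt.mul (hf : HolAt f x) (hg : HolAt g x) : HolAt (f * g) x := AnalyticAt.mul hf hg
theorem HolAt.smul (hf : HolAt f x) (c : ℂ) : HolAt (c • f) x := AnalyticAt.const_smul hf
theorem HolAt.inv (hf : HolAt f x) (h : f x ≠ 0) : HolAt f⁻¹ x :=
  AnalyticAt.inv hf (by simpa [(chartAt ℂ x).left_inv (mem_chart_source ℂ x)] using h)

theorem ordAt_mul (hf : MerAt f x) (hg : MerAt g x) : ordAt (f * g) x = ordAt f x + ordAt g x :=
  meromorphicOrderAt_mul hf hg
theorem ordAt_inv : ordAt f⁻¹ x = - ordAt f x := meromorphicOrderAt_inv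
theorem ordAt_div (hf : MerAt f x) (hg : MerAt g x) : ordAt (f / g) x = ordAt f x - ordAt g x :=
  meromorphicOrderAt_div hf hg
theorem ordAt_pow (hf : MerAt f x) (n : ℕ) : ordAt (f ^ n) x = n * ordAt f x :=
  meromorphicOrderAt_pow hf
theorem ordAt_zpow (hf : MerAt f x) (n : ℤ) : ordAt (f ^ n) x = n * ordAt f x :=
  meromorphicOrderAt_zpow hf
theorem ordAt_neg : ordAt (-f) x = ordAt f x := meromorphicOrderAt_neg.symm
theorem min_le_ordAt_add (hf : MerAt f x) (hg : MerAt g x) :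
    min (ordAt f x) (ordAt g x) ≤ ordAt (f + g) x := meromorphicOrderAt_add hf hg
theorem le_ordAt_add {n : WithTop ℤ} (hf : MerAt f x) (hg : MerAt g x) (h1 : n ≤ ordAt f x)
    (h2 : n ≤ ordAt g x) : n ≤ ordAt (f + g) x := (le_min h1 h2).trans (min_le_ordAt_add hf hg)
theorem le_ordAt_sub {n : WithTop ℤ} (hf : MerAt f x) (hg : MerAt g x) (h1 : n ≤ ordAt f x)
    (h2 : n ≤ ordAt g x) : n ≤ ordAt (f - g) x := by
  rw [sub_eq_add_neg]; exact le_ordAt_add hf hg.neg h1 (by rwa [ordAt_neg])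
theorem ordAt_add_eq_left (hg : MerAt g x) (h : ordAt f x < ordAt g x) :
    ordAt (f + g) x = ordAt f x := meromorphicOrderAt_add_eq_left_of_lt hg h
theorem ordAt_eq_top_iff : ordAt f x = ⊤ ↔ ∀ᶠ y in 𝓝[≠] x, f y = 0 :=
  meromorphicOrderAt_eq_top_iff.trans (eventually_chart_symm (p := fun y => f y = 0))
theorem HolAt.ordAt_nonneg (hf : HolAt f x) : 0 ≤ ordAt f x :=
  AnalyticAt.meromorphicOrderAt_nonneg hf
theorem ordAt_const {c : ℂ} (hc : c ≠ 0) : ordAt (fun _ : X => c) x = 0 := by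
  have := meromorphicOrderAt_const (chartAt ℂ x x) c
  rw [if_neg hc] at this
  exact this
theorem ordAt_smul {c : ℂ} (hc : c ≠ 0) (hf : MerAt f x) : ordAt (c • f) x = ordAt f x := by
  have : c • f = (fun _ => c) * f := by ext; simp
  rw [this, ordAt_mul (merAt_const c) hf, ordAt_const hc, zero_add]
theorem le_ordAt_smul {n : WithTop ℤ} {c : ℂ} (hf : MerAt f x) (h : n ≤ ordAt f x) :
    n ≤ ordAt (c • f) x := by
  rcases eq_or_ne c 0 with rfl | hc
  · rw [(ordAt_eq_top_iff (f := (0 : ℂ) • f)).2 (by simp)]; exact le_top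
  · rwa [ordAt_smul hc hf]
theorem ordAt_ne_top_iff (hf : MerAt f x) : ordAt f x ≠ ⊤ ↔ ∀ᶠ y in 𝓝[≠] x, f y ≠ 0 :=
  (meromorphicOrderAt_ne_top_iff_eventually_ne_zero hf).trans
    (eventually_chart_symm (p := fun y => f y ≠ 0))
theorem tendsto_zero_iff_ordAt_pos (hf : MerAt f x) :
    Tendsto f (𝓝[≠] x) (𝓝 0) ↔ 0 < ordAt f x :=
  tendsto_comp_chart_symm.symm.trans (tendsto_zero_iff_meromorphicOrderAt_pos hf)
theorem tendsto_nhds_iff_ordAt_nonneg (hf : MerAt f x) :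
    (∃ c, Tendsto f (𝓝[≠] x) (𝓝 c)) ↔ 0 ≤ ordAt f x :=
  (exists_congr fun _ => tendsto_comp_chart_symm.symm).trans
    (tendsto_nhds_iff_meromorphicOrderAt_nonneg hf)
theorem tendsto_ne_zero_iff_ordAt_eq_zero (hf : MerAt f x) :
    (∃ c, c ≠ 0 ∧ Tendsto f (𝓝[≠] x) (𝓝 c)) ↔ ordAt f x = 0 :=
  (exists_congr fun _ => and_congr Iff.rfl tendsto_comp_chart_symm.symm).trans
    (tendsto_ne_zero_iff_meromorphicOrderAt_eq_zero hf)
theorem tendsto_cobounded_iff_ordAt_neg (hf : MerAt f x) :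
    Tendsto f (𝓝[≠] x) (Bornology.cobounded ℂ) ↔ ordAt f x < 0 :=
  tendsto_comp_chart_symm.symm.trans (tendsto_cobounded_iff_meromorphicOrderAt_neg hf)
theorem MerAt.holAt (hf : MerAt f x) (h : ContinuousAt f x) : HolAt f x := by
  refine MeromorphicAt.analyticAt hf (ContinuousAt.comp ?_ ?_)
  · rwa [(chartAt ℂ x).left_inv (mem_chart_source ℂ x)]
  · exact (chartAt ℂ x).continuousAt_symm ((chartAt ℂ x).map_source (mem_chart_source ℂ x))

/-- The local coordinate at `q` that vanishes at `q`. -/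
def coord (q : X) : X → ℂ := fun y => chartAt ℂ q y - chartAt ℂ q q

theorem coord_comp_symm (q : X) :
    coord q ∘ (chartAt ℂ q).symm =ᶠ[𝓝 (chartAt ℂ q q)] (· - chartAt ℂ q q) := by
  filter_upwards [(chartAt ℂ q).open_target.mem_nhds
    ((chartAt ℂ q).map_source (mem_chart_source ℂ q))] with z hz
  simp [coord, (chartAt ℂ q).right_inv hz]

theorem holAt_coord (q : X) : HolAt (coord q) q :=
  (by fun_prop : AnalyticAt ℂ (· - chartAt ℂ q q) _).congr (coord_comp_symm q).symm

theorem merAt_coord (q : X) : MerAt (coord q) q := (holAt_coord q).merAt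

theorem ordAt_coord (q : X) : ordAt (coord q) q = 1 := by
  rw [ordAt, meromorphicOrderAt_congr ((coord_comp_symm q).filter_mono nhdsWithin_le_nhds)]
  exact meromorphicOrderAt_id_sub_const

theorem ordAt_coord_zpow (q : X) (n : ℤ) : ordAt (coord q ^ n) q = n := by
  rw [ordAt_zpow (merAt_coord q), ordAt_coord, mul_one]

/-! ### Chart-free holomorphy and composition with holomorphic maps -/

section Manifold

variable [IsManifold 𝓘(ℂ) ω X]

theorem isManifold_one : IsManifold 𝓘(ℂ) 1 X := IsManifold.of_le (n := ω) le_top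

theorem mdifferentiableAt_iff_chart {x y : X} (hy : y ∈ (chartAt ℂ x).source) :
    MDifferentiableAt 𝓘(ℂ) 𝓘(ℂ) f y ↔
      DifferentiableAt ℂ (f ∘ (chartAt ℂ x).symm) (chartAt ℂ x y) := by
  have := isManifold_one (X := X)
  rw [mdifferentiableAt_iff_source_of_mem_source (x := x) hy]
  simp [mdifferentiableWithinAt_univ, mdifferentiableAt_iff_differentiableAt]

/-- In one complex variable, differentiability on a neighbourhood is analyticity. The right-hand
side mentions no chart, which is what allows `HolAt` at nearby points, each read in its own chart,
to be compared. -/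
theorem holAt_iff : HolAt f x ↔ ∀ᶠ y in 𝓝 x, MDifferentiableAt 𝓘(ℂ) 𝓘(ℂ) f y := by
  have hx := mem_chart_source ℂ x
  rw [HolAt, Complex.analyticAt_iff_eventually_differentiableAt,
    ← (chartAt ℂ x).eventually_nhds' _ hx]
  refine eventually_congr ?_
  filter_upwards [(chartAt ℂ x).open_target.mem_nhds ((chartAt ℂ x).map_source hx)] with z hz
  rw [mdifferentiableAt_iff_chart ((chartAt ℂ x).map_target hz), (chartAt ℂ x).right_inv hz]

theorem HolAt.mdifferentiableAt (hf : HolAt f x) : MDifferentiableAt 𝓘(ℂ) 𝓘(ℂ) f x :=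
  (holAt_iff.1 hf).self_of_nhds

variable [T2Space X]

/-- Singularities are isolated in the chart at `x`. The detour through `MDifferentiableAt` is needed
because `HolAt f y` refers to the chart at `y`. -/
theorem MerAt.eventually_holAt (hf : MerAt f x) : ∀ᶠ y in 𝓝[≠] x, HolAt f y := by
  have hx := mem_chart_source ℂ x
  have h1 : ∀ᶠ y in 𝓝[≠] x, MDifferentiableAt 𝓘(ℂ) 𝓘(ℂ) f y := by
    rw [← eventually_chart_symm]
    filter_upwards [MeromorphicAt.eventually_analyticAt hf,
      mem_nhdsWithin_of_mem_nhds ((chartAt ℂ x).open_target.mem_nhds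
        ((chartAt ℂ x).map_source hx))] with z hz hz'
    rw [mdifferentiableAt_iff_chart ((chartAt ℂ x).map_target hz'), (chartAt ℂ x).right_inv hz']
    exact hz.differentiableAt
  rw [← eventually_eventually_nhdsWithin] at h1
  filter_upwards [h1, self_mem_nhdsWithin] with y hy hyx
  rw [holAt_iff]
  rwa [(isOpen_compl_singleton (x := x)).nhdsWithin_eq hyx] at hy

/-- The map `h`, read in the charts at `x` and `h x`. -/
theorem analyticAt_chart_comp {h : X → X} (hh : ∀ᶠ y in 𝓝 x, MDifferentiableAt 𝓘(ℂ) 𝓘(ℂ) h y) :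
    AnalyticAt ℂ (chartAt ℂ (h x) ∘ h ∘ (chartAt ℂ x).symm) (chartAt ℂ x x) := by
  have := isManifold_one (X := X)
  have hc : ContinuousAt h x := hh.self_of_nhds.continuousAt
  refine (holAt_iff (f := chartAt ℂ (h x) ∘ h)).2 ?_
  filter_upwards [hh, hc.preimage_mem_nhds ((chartAt ℂ (h x)).open_source.mem_nhds
    (mem_chart_source ℂ (h x)))] with y hy hy'
  exact MDifferentiableAt.comp y ((mdifferentiable_chart (h x)).mdifferentiableAt hy') hy

theorem MerAt.comp {h : X → X} (hf : MerAt f (h x))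
    (hh : ∀ᶠ y in 𝓝 x, MDifferentiableAt 𝓘(ℂ) 𝓘(ℂ) h y) : MerAt (f ∘ h) x := by
  have hc : ContinuousAt h x := hh.self_of_nhds.continuousAt
  have hx := mem_chart_source ℂ x
  have key := MeromorphicAt.comp_analyticAt (g := chartAt ℂ (h x) ∘ h ∘ (chartAt ℂ x).symm)
    (x := chartAt ℂ x x) (f := f ∘ (chartAt ℂ (h x)).symm)
    (by simp only [Function.comp_apply, (chartAt ℂ x).left_inv hx]; exact hf)
    (analyticAt_chart_comp hh)
  refine key.congr (eventually_nhdsWithin_of_eventually_nhds ?_)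
  have h2 := hc.preimage_mem_nhds ((chartAt ℂ (h x)).open_source.mem_nhds
    (mem_chart_source ℂ (h x)))
  filter_upwards [((chartAt ℂ x).eventually_nhds' (fun y => h y ∈ (chartAt ℂ (h x)).source)
    hx).2 h2] with z hz
  simp [(chartAt ℂ (h x)).left_inv hz]

/-- The left inverse `k` makes the derivative of `h` nonzero by the chain rule, and substitution of
a map with nonzero derivative preserves orders. -/
theorem ordAt_comp {h k : X → X} (hh : MDifferentiable 𝓘(ℂ) 𝓘(ℂ) h)
    (hk : MDifferentiable 𝓘(ℂ) 𝓘(ℂ) k) (hkh : ∀ y, k (h y) = y) :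
    ordAt (f ∘ h) x = ordAt f (h x) := by
  have hx := mem_chart_source ℂ x
  have hhx := mem_chart_source ℂ (h x)
  have ha := analyticAt_chart_comp (x := x) (h := h) (.of_forall hh)
  have hb := analyticAt_chart_comp (x := h x) (h := k) (.of_forall hk)
  have hev : ∀ᶠ z in 𝓝 (chartAt ℂ x x), h ((chartAt ℂ x).symm z) ∈ (chartAt ℂ (h x)).source :=
    ((chartAt ℂ x).eventually_nhds' (fun y => h y ∈ (chartAt ℂ (h x)).source) hx).2
      ((hh x).continuousAt.preimage_mem_nhds ((chartAt ℂ (h x)).open_source.mem_nhds hhx))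
  have hev' := (chartAt ℂ x).open_target.mem_nhds ((chartAt ℂ x).map_source hx)
  have hval : (chartAt ℂ (h x) ∘ h ∘ (chartAt ℂ x).symm) (chartAt ℂ x x) =
      chartAt ℂ (h x) (h x) := by
    simp [(chartAt ℂ x).left_inv hx]
  have hder : deriv (chartAt ℂ (h x) ∘ h ∘ (chartAt ℂ x).symm) (chartAt ℂ x x) ≠ 0 := by
    have hcomp : (chartAt ℂ (k (h x)) ∘ k ∘ (chartAt ℂ (h x)).symm) ∘
        (chartAt ℂ (h x) ∘ h ∘ (chartAt ℂ x).symm) =ᶠ[𝓝 (chartAt ℂ x x)] id := by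
      filter_upwards [hev, hev'] with z hz hz'
      simp [(chartAt ℂ (h x)).left_inv hz, hkh, (chartAt ℂ x).right_inv hz']
    have h1 := (hb.differentiableAt.hasDerivAt).comp_of_eq (chartAt ℂ x x)
      ha.differentiableAt.hasDerivAt hval.symm
    have h2 := h1.congr_of_eventuallyEq hcomp.symm
    have h3 := h2.unique (hasDerivAt_id _)
    exact right_ne_zero_of_mul (h3.trans_ne one_ne_zero)
  have := meromorphicOrderAt_comp_of_deriv_ne_zero (f := f ∘ (chartAt ℂ (h x)).symm) ha hder
  rw [hval] at this
  rw [ordAt, ordAt, ← this]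
  refine meromorphicOrderAt_congr (eventually_nhdsWithin_of_eventually_nhds ?_)
  filter_upwards [hev] with z hz
  simp [(chartAt ℂ (h x)).left_inv hz]

end Manifold

end Local

/-! ### Global function theory -/

section Global

variable {X : Type*} [TopologicalSpace X] [T2Space X] [ChartedSpace ℂ X] [IsManifold 𝓘(ℂ) ω X]
variable {f g : X → ℂ} {x : X}

theorem Mer.add (hf : Mer f) (hg : Mer g) : Mer (f + g) := fun x => (hf x).add (hg x)
theorem Mer.sub (hf : Mer f) (hg : Mer g) : Mer (f - g) := fun x => (hf x).sub (hg x)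
theorem Mer.mul (hf : Mer f) (hg : Mer g) : Mer (f * g) := fun x => (hf x).mul (hg x)
theorem Mer.div (hf : Mer f) (hg : Mer g) : Mer (f / g) := fun x => (hf x).div (hg x)
theorem Mer.inv (hf : Mer f) : Mer f⁻¹ := fun x => (hf x).inv
theorem Mer.pow (hf : Mer f) (n : ℕ) : Mer (f ^ n) := fun x => (hf x).pow n
theorem Mer.smul (hf : Mer f) (c : ℂ) : Mer (c • f) := fun x => (hf x).smul c
theorem mer_const (c : ℂ) : Mer (fun _ : X => c) := fun _ => merAt_const c

theorem MerAt.sum {ι : Type*} {F : ι → X → ℂ} (s : Finset ι) (h : ∀ i ∈ s, MerAt (F i) x) :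
    MerAt (∑ i ∈ s, F i) x := by
  classical
  induction s using Finset.induction_on with
  | empty => exact merAt_const 0
  | insert a s ha ih =>
    rw [Finset.sum_insert ha]
    exact (h a (Finset.mem_insert_self a s)).add (ih fun i hi => h i (Finset.mem_insert_of_mem hi))

theorem le_ordAt_sum {ι : Type*} {F : ι → X → ℂ} {n : WithTop ℤ} (s : Finset ι)
    (h : ∀ i ∈ s, MerAt (F i) x) (hn : ∀ i ∈ s, n ≤ ordAt (F i) x) :
    n ≤ ordAt (∑ i ∈ s, F i) x := by
  classical
  induction s using Finset.induction_on with
  | empty =>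
    rw [Finset.sum_empty, (ordAt_eq_top_iff (f := (0 : X → ℂ))).2 (by simp)]
    exact le_top
  | insert a s ha ih =>
    rw [Finset.sum_insert ha]
    exact le_ordAt_add (h a (Finset.mem_insert_self a s))
      (MerAt.sum s fun i hi => h i (Finset.mem_insert_of_mem hi))
      (hn a (Finset.mem_insert_self a s))
      (ih (fun i hi => h i (Finset.mem_insert_of_mem hi))
        fun i hi => hn i (Finset.mem_insert_of_mem hi))

theorem Mer.sum {ι : Type*} {F : ι → X → ℂ} (s : Finset ι) (h : ∀ i ∈ s, Mer (F i)) :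
    Mer (∑ i ∈ s, F i) := fun x => MerAt.sum s fun i hi => h i hi x

/-- A combination of functions of distinct finite orders has the least of the orders involved. -/
theorem exists_ordAt_sum_smul {ι : Type*} [Fintype ι] {F : ι → X → ℂ} {γ : ι → ℤ}
    (hγ : Function.Injective γ) (hF : ∀ i, MerAt (F i) x) (ho : ∀ i, ordAt (F i) x = γ i)
    {a : ι → ℂ} (ha : a ≠ 0) : ∃ i, a i ≠ 0 ∧ ordAt (∑ i, a i • F i) x = γ i := by
  classical
  obtain ⟨j, hj⟩ := Function.ne_iff.1 ha
  obtain ⟨i, hi, him⟩ := (Finset.univ.filter fun i => a i ≠ 0).exists_min_image γ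
    ⟨j, by simpa using hj⟩
  have hi : a i ≠ 0 := by simpa using hi
  refine ⟨i, hi, ?_⟩
  rw [← Finset.add_sum_erase _ _ (Finset.mem_univ i)]
  have h1 : ordAt (a i • F i) x = γ i := by rw [ordAt_smul hi (hF i), ho]
  rw [ordAt_add_eq_left (MerAt.sum _ fun k _ => (hF k).smul _), h1]
  rw [h1]
  refine lt_of_lt_of_le ?_ (le_ordAt_sum (n := ((γ i + 1 : ℤ) : WithTop ℤ)) _
    (fun k _ => (hF k).smul _) fun k hk => ?_)
  · exact_mod_cast lt_add_one _
  · by_cases hak : a k = 0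
    · rw [hak, (ordAt_eq_top_iff (f := (0 : ℂ) • F k)).2 (by simp)]; exact le_top
    · rw [ordAt_smul hak (hF k), ho]
      have h2 := him k (by simpa using hak)
      have h3 : γ i ≠ γ k := fun h => (Finset.ne_of_mem_erase hk) (hγ h).symm
      exact_mod_cast (lt_of_le_of_ne h2 h3)

/-- Two functions of the same finite order have, up to a constant, the same leading term. -/
theorem exists_ordAt_sub_smul_lt (hf : MerAt f x) (hg : MerAt g x) (h : ordAt f x = ordAt g x)
    (ht : ordAt g x ≠ ⊤) : ∃ c : ℂ, c ≠ 0 ∧ Tendsto (f / g) (𝓝[≠] x) (𝓝 c) ∧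
      ordAt g x < ordAt (f - c • g) x := by
  have hfg : ordAt (f / g) x = 0 := by
    rw [ordAt_div hf hg, h]
    lift ordAt g x to ℤ using ht with n
    exact_mod_cast sub_self n
  obtain ⟨c, hc, hlim⟩ := (tendsto_ne_zero_iff_ordAt_eq_zero (hf.div hg)).2 hfg
  refine ⟨c, hc, hlim, ?_⟩
  have h1 : f - c • g =ᶠ[𝓝[≠] x] g * (f / g - fun _ => c) := by
    filter_upwards [(ordAt_ne_top_iff hg).1 ht] with y hy
    simp only [Pi.sub_apply, Pi.smul_apply, Pi.mul_apply, Pi.div_apply, smul_eq_mul]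
    field_simp
  have hm : MerAt (f / g - fun _ => c) x := (hf.div hg).sub (merAt_const c)
  have h2 : 0 < ordAt (f / g - fun _ => c) x := by
    rw [← tendsto_zero_iff_ordAt_pos hm, ← sub_self c]
    exact hlim.sub tendsto_const_nhds
  rw [ordAt_congr h1, ordAt_mul hg hm]
  lift ordAt g x to ℤ using ht with n
  cases hord : ordAt (f / g - fun _ => c) x with
  | top => simp
  | coe m =>
    rw [hord] at h2
    have h2 : 0 < m := by exact_mod_cast h2
    exact_mod_cast lt_add_of_pos_right n h2

theorem ordAt_sub_const_pos {c : ℂ} (hf : MerAt f x) (h : Tendsto f (𝓝[≠] x) (𝓝 c)) :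
    0 < ordAt (f - fun _ => c) x := by
  rw [← tendsto_zero_iff_ordAt_pos (hf.sub (merAt_const c)), ← sub_self c]
  exact h.sub tendsto_const_nhds

/-- In a finite cover by neighbourhoods where only the centre may be exceptional, only the finitely
many centres can be exceptional. -/
theorem finite_of_eventually_nhdsNE [CompactSpace X] {p : X → Prop}
    (h : ∀ x, ∀ᶠ y in 𝓝[≠] x, p y) : {x | ¬ p x}.Finite := by
  choose U hU hU' using fun x => mem_nhdsWithin_iff_exists_mem_nhds_inter.1 (h x)
  obtain ⟨t, ht⟩ := CompactSpace.elim_nhds_subcover U hU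
  refine t.finite_toSet.subset fun y hy => ?_
  have : y ∈ ⋃ x ∈ t, U x := by rw [ht]; trivial
  obtain ⟨x, hx, hyx⟩ := mem_iUnion₂.1 this
  by_contra hne
  exact hy (hU' x ⟨hyx, fun h => hne (by rw [mem_singleton_iff.1 h]; exact hx)⟩)

theorem eventually_nhdsNE_nhds {p : X → Prop} (h : ∀ᶠ y in 𝓝[≠] x, p y) :
    ∀ᶠ y in 𝓝[≠] x, ∀ᶠ z in 𝓝 y, p z := by
  rw [← eventually_eventually_nhdsWithin] at h
  filter_upwards [h, self_mem_nhdsWithin] with y hy hyx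
  rwa [(isOpen_compl_singleton (x := x)).nhdsWithin_eq hyx] at hy

/-- Identity theorem: near any point the function either vanishes on a punctured neighbourhood or
has no zero there, so infinite order is both an open and a closed condition. -/
theorem Mer.ordAt_eq_top [PreconnectedSpace X] (hf : Mer f) (h : ordAt f x = ⊤) (y : X) :
    ordAt f y = ⊤ := by
  have hclopen : IsClopen {z | ordAt f z = ⊤} := by
    constructor
    · rw [← isOpen_compl_iff, isOpen_iff_mem_nhds]
      intro z hz
      have h1 := eventually_nhdsNE_nhds ((ordAt_ne_top_iff (hf z)).1 hz)
      have h2 : ∀ᶠ y in 𝓝[≠] z, ordAt f y ≠ ⊤ := by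
        filter_upwards [h1] with y hy
        exact (ordAt_ne_top_iff (hf y)).2 (hy.filter_mono nhdsWithin_le_nhds)
      filter_upwards [eventually_nhdsWithin_iff.1 h2] with y hy
      by_cases hyz : y = z
      · rw [hyz]; exact hz
      · exact hy hyz
    · rw [isOpen_iff_mem_nhds]
      intro z hz
      have h1 := eventually_nhdsNE_nhds (ordAt_eq_top_iff.1 hz)
      have h2 : ∀ᶠ y in 𝓝[≠] z, ordAt f y = ⊤ := by
        filter_upwards [h1] with y hy
        exact ordAt_eq_top_iff.2 (hy.filter_mono nhdsWithin_le_nhds)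
      filter_upwards [eventually_nhdsWithin_iff.1 h2] with y hy
      by_cases hyz : y = z
      · rw [hyz]; exact hz
      · exact hy hyz
  have : {z | ordAt f z = ⊤} = univ := hclopen.eq_univ ⟨x, h⟩
  exact (this ▸ mem_univ y : y ∈ {z | ordAt f z = ⊤})

theorem Mer.ordAt_ne_top [PreconnectedSpace X] (hf : Mer f) (h : ordAt f x ≠ ⊤) (y : X) :
    ordAt f y ≠ ⊤ := fun h' => h (hf.ordAt_eq_top h' x)

/-- Replacing values by limits gives a holomorphic function on a compact connected surface, hence a
constant. The conclusion is on punctured neighbourhoods because the values of a meromorphic function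
at isolated points are not constrained. -/
theorem exists_eventuallyEq_const_of_ordAt_nonneg [CompactSpace X] [ConnectedSpace X] (hf : Mer f)
    (h : ∀ x, 0 ≤ ordAt f x) : ∃ c : ℂ, ∀ x, f =ᶠ[𝓝[≠] x] fun _ => c := by
  choose L hL using fun x => (tendsto_nhds_iff_ordAt_nonneg (hf x)).2 (h x)
  have hLf : ∀ x, HolAt f x → L x = f x := fun x hx =>
    tendsto_nhds_unique (hL x) (hx.continuousAt.continuousWithinAt)
  have hev : ∀ x, f =ᶠ[𝓝[≠] x] L := fun x =>
    (hf x).eventually_holAt.mono fun y hy => (hLf y hy).symm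
  have hLhol : ∀ x, HolAt L x := fun x => by
    refine ((hf x).congr (hev x)).holAt ?_
    rw [continuousAt_iff_punctured_nhds]
    exact (hL x).congr' (hev x)
  have hd : MDifferentiable 𝓘(ℂ) 𝓘(ℂ) L := fun x => (hLhol x).mdifferentiableAt
  obtain ⟨c, hc⟩ := hd.exists_eq_const_of_compactSpace
  exact ⟨c, fun x => (hev x).trans (by rw [hc]; rfl)⟩

end Global

/-! ### Adeles and the first cohomology -/

section Adele

variable (X : Type*) [TopologicalSpace X] [ChartedSpace ℂ X]

/-- Families of germs of meromorphic functions `r x` at the points `x`, all but finitely many of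
them holomorphic. -/
def adele : Submodule ℂ (X → X → ℂ) where
  carrier := {r | (∀ x, MerAt (r x) x) ∧ {x | ¬ HolAt (r x) x}.Finite}
  zero_mem' := ⟨fun _ => merAt_const 0, finite_empty.subset fun _ hx => hx (holAt_const 0)⟩
  add_mem' := by
    rintro r s ⟨h1, h2⟩ ⟨h3, h4⟩
    refine ⟨fun x => (h1 x).add (h3 x), (h2.union h4).subset fun x hx => ?_⟩
    by_contra hcon
    simp only [mem_union, mem_ofPred_eq, not_or, not_not] at hcon
    exact hx (hcon.1.add hcon.2)
  smul_mem' := by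
    rintro c r ⟨h1, h2⟩
    exact ⟨fun x => (h1 x).smul c, h2.subset fun x hx h => hx (HolAt.smul h c)⟩

variable {X}

theorem exists_pointCover {p : X → X → Prop} (h : ∀ x, ∀ᶠ y in 𝓝[≠] x, p x y) :
    ∃ U : X → Set X, IsPointCover U ∧ ∀ x, ∀ y ∈ U x, y ≠ x → p x y := by
  choose U hU using fun x => mem_nhds_iff.1 (eventually_nhdsWithin_iff.1 (h x))
  exact ⟨U, fun x => ⟨(hU x).2.1, (hU x).2.2⟩, fun x y hy hyx => (hU x).1 hy hyx⟩

variable [T2Space X] [IsManifold 𝓘(ℂ) ω X]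

theorem eventually_nhdsNE_of_finite {p : X → Prop} (h : {x | ¬ p x}.Finite) (x : X) :
    ∀ᶠ y in 𝓝[≠] x, p y := by
  have h1 : ({y | ¬ p y} \ {x})ᶜ ∈ 𝓝 x :=
    (h.subset sdiff_subset).isClosed.isOpen_compl.mem_nhds (by simp)
  filter_upwards [mem_nhdsWithin_of_mem_nhds h1, self_mem_nhdsWithin] with y hy hyx
  by_contra hp
  exact hy ⟨hp, hyx⟩

/-- The covering is chosen so that a bad point of any germ in play lies only in the set indexed by
that point. Such a point is never in the intersection of two sets with distinct indices, and on the
diagonal the cocycle is zero. -/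
theorem adele_cocycle_mem (r : adele X) : (fun x y => r.1 y - r.1 x) ∈ cocycles X := by
  obtain ⟨U, hU, hU'⟩ := exists_pointCover (p := fun x y => HolAt (r.1 x) y ∧ HolAt (r.1 y) y)
    fun x => (r.2.1 x).eventually_holAt.and (eventually_nhdsNE_of_finite r.2.2 x)
  have key : ∀ x y, x ≠ y → ∀ p ∈ U x ∩ U y, HolAt (r.1 x) p := by
    intro x y hxy p hp
    by_cases hpx : p = x
    · subst hpx; exact (hU' y p hp.2 hxy).2
    · exact (hU' x p hp.1 hpx).1
  refine ⟨U, hU, fun x y p hp => ?_, fun x y z p _ => by simp⟩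
  by_cases hxy : x = y
  · subst hxy; simp only [sub_self]; exact mdifferentiableWithinAt_const
  · exact (((key y x (Ne.symm hxy) p hp.symm).sub
      (key x y hxy p hp)).mdifferentiableAt).mdifferentiableWithinAt

/-- The class in `H¹(X, 𝒪)` of an adele. -/
def adeleClass : adele X →ₗ[ℂ] H1 X :=
  (Submodule.mkQ _).comp
    ({  toFun := fun r => ⟨fun x y => r.1 y - r.1 x, adele_cocycle_mem r⟩
        map_add' := fun r s => by ext; simp; ring
        map_smul' := fun c r => by ext; simp [mul_sub] } : adele X →ₗ[ℂ] cocycles X)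

/-- The class is the obstruction to the Mittag-Leffler problem: it vanishes exactly when one global
function has all the prescribed principal parts. -/
theorem adeleClass_eq_zero_iff {r : adele X} :
    adeleClass r = 0 ↔ ∃ f, Mer f ∧ ∀ x, 0 ≤ ordAt (r.1 x - f) x := by
  rw [adeleClass, LinearMap.comp_apply, Submodule.mkQ_apply, Submodule.Quotient.mk_eq_zero]
  constructor
  · rintro ⟨U, hU, b, hb, hc⟩
    -- On overlaps `r y - b y = r x - b x`, so the local differences glue to one function; its value
    -- at `p` is read off with index `p`.
    have key : ∀ x, (fun p => r.1 p p - b p p) =ᶠ[𝓝 x] r.1 x - b x := fun x => by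
      filter_upwards [(hU x).1.mem_nhds (hU x).2] with p hp
      have := hc x p p ⟨hp, (hU p).2⟩
      simp only [Submodule.subtype_apply, LinearMap.coe_mk, AddHom.coe_mk, Pi.sub_apply] at this ⊢
      linear_combination this
    have hb' : ∀ x, HolAt (b x) x := fun x => holAt_iff.2 <| by
      filter_upwards [(hU x).1.mem_nhds (hU x).2] with p hp
      exact (hb x).mdifferentiableAt ((hU x).1.mem_nhds hp)
    refine ⟨fun p => r.1 p p - b p p, fun x => ?_, fun x => ?_⟩
    · exact ((r.2.1 x).sub (hb' x).merAt).congr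
        ((key x).symm.filter_mono nhdsWithin_le_nhds)
    · rw [ordAt_congr (g := b x)]
      · exact (hb' x).ordAt_nonneg
      · filter_upwards [(key x).filter_mono nhdsWithin_le_nhds] with p hp
        simp only [Pi.sub_apply] at hp ⊢
        rw [hp]; ring
  · rintro ⟨f, hf, hord⟩
    have hm : ∀ x, MerAt (r.1 x - f) x := fun x => (r.2.1 x).sub (hf x)
    choose L hL using fun x => (tendsto_nhds_iff_ordAt_nonneg (hm x)).2 (hord x)
    classical
    let b : X → X → ℂ := fun x => Function.update (r.1 x - f) x (L x)
    obtain ⟨U, hU, hU'⟩ := exists_pointCover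
      (p := fun x y => HolAt (r.1 x - f) y ∧ HolAt (r.1 y) y ∧ HolAt f y)
      fun x => (hm x).eventually_holAt.and
        ((eventually_nhdsNE_of_finite r.2.2 x).and (hf x).eventually_holAt)
    have hbx : ∀ x, HolAt (b x) x := fun x => by
      have h1 : (r.1 x - f) =ᶠ[𝓝[≠] x] b x := by
        filter_upwards [self_mem_nhdsWithin] with y hy
        exact (Function.update_of_ne hy _ _).symm
      refine ((hm x).congr h1).holAt ?_
      rw [continuousAt_iff_punctured_nhds]
      simpa [b] using (hL x).congr' h1
    have hbU : ∀ x, ∀ p ∈ U x, HolAt (b x) p := fun x p hp => by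
      by_cases hpx : p = x
      · rw [hpx]; exact hbx x
      · refine (hU' x p hp hpx).1.congr ?_
        filter_upwards [isOpen_ne.mem_nhds hpx] with y hy
        exact (Function.update_of_ne hy _ _).symm
    -- The value filled in at the index point is the true value of the difference there as soon as
    -- the point lies in another set of the covering, since `r.1 p` and `f` are then holomorphic at
    -- it.
    have hval : ∀ x y, x ≠ y → ∀ p ∈ U x ∩ U y, b x p = r.1 x p - f p := by
      intro x y hxy p hp
      by_cases hpx : p = x
      · subst hpx
        have h1 := hU' y p hp.2 hxy
        have h2 := tendsto_nhds_unique (hL p)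
          ((h1.2.1.sub h1.2.2).continuousAt.continuousWithinAt)
        simp [b, h2]
      · simp [b, Function.update_of_ne hpx]
    refine ⟨U, hU, b, fun x p hp => (hbU x p hp).mdifferentiableAt.mdifferentiableWithinAt,
      fun x y p hp => ?_⟩
    by_cases hxy : x = y
    · subst hxy; simp
    · rw [hval x y hxy p hp, hval y x (Ne.symm hxy) p hp.symm]
      simp

theorem IsCocycleOn.self_eq_zero {U : X → Set X} {c : X → X → X → ℂ} (hc : IsCocycleOn U c)
    {x p : X} (hp : p ∈ U x) : c x x p = 0 := by
  have := hc.2 x x x p ⟨⟨hp, hp⟩, hp⟩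
  simpa using this

/-- After shrinking, `F` can have a pole in a member of the covering only at its index point. No
such pole survives in an intersection with distinct indices, and diagonal terms of a cocycle vanish.
-/
theorem Mer.mul_mem_cocycles {F : X → ℂ} (hF : Mer F) {c : X → X → X → ℂ} (hc : c ∈ cocycles X) :
    (fun x y => F * c x y) ∈ cocycles X := by
  obtain ⟨U, hU, hc⟩ := hc
  obtain ⟨V, hV, hV'⟩ := exists_pointCover (p := fun _ y => HolAt F y)
    fun x => (hF x).eventually_holAt
  refine ⟨fun x => U x ∩ V x, fun x => ⟨(hU x).1.inter (hV x).1, (hU x).2, (hV x).2⟩,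
    fun x y p hp => ?_, fun x y z p hp => ?_⟩
  · by_cases hxy : x = y
    · subst hxy
      refine (mdifferentiableWithinAt_const (c := (0 : ℂ))).congr (fun q hq => ?_) ?_
      · simp [hc.self_eq_zero hq.1.1]
      · simp [hc.self_eq_zero hp.1.1]
    · have hFp : HolAt F p := by
        by_cases hpx : p = x
        · exact hV' y p hp.2.2 (hpx ▸ hxy)
        · exact hV' x p hp.1.2 hpx
      have hcp : MDifferentiableAt 𝓘(ℂ) 𝓘(ℂ) (c x y) p :=
        (hc.1 x y).mdifferentiableAt (((hU x).1.inter (hU y).1).mem_nhds ⟨hp.1.1, hp.2.1⟩)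
      exact (hFp.mdifferentiableAt.mul hcp).mdifferentiableWithinAt
  · have := hc.2 x y z p ⟨⟨hp.1.1.1, hp.1.2.1⟩, hp.2.1⟩
    simp only [Pi.mul_apply, ← this]; ring

/-- If `F * c` is the coboundary of `b`, then `c` is formally the coboundary of `b / F`, whose
components are meromorphic germs with finitely many poles. -/
theorem exists_adeleClass_eq [ConnectedSpace X] [CompactSpace X] {F : X → ℂ} (hF : Mer F)
    {x₀ : X} (h0 : ordAt F x₀ ≠ ⊤) (c : cocycles X)
    (h : (fun x y => F * c.1 x y) ∈ coboundaries X) :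
    ∃ r : adele X, adeleClass r = Submodule.Quotient.mk c := by
  obtain ⟨U, hU, b, hb, hbc⟩ := h
  obtain ⟨W, hW, hc⟩ := c.2
  have hne : ∀ x, ∀ᶠ y in 𝓝[≠] x, HolAt F y ∧ F y ≠ 0 := fun x =>
    (hF x).eventually_holAt.and ((ordAt_ne_top_iff (hF x)).1 (hF.ordAt_ne_top h0 x))
  have hb' : ∀ x, HolAt (b x) x := fun x => holAt_iff.2 <| by
    filter_upwards [(hU x).1.mem_nhds (hU x).2] with p hp
    exact (hb x).mdifferentiableAt ((hU x).1.mem_nhds hp)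
  let r : adele X := ⟨fun x => b x * F⁻¹, fun x => (hb' x).merAt.mul (hF x).inv,
    (finite_of_eventually_nhdsNE hne).subset fun x hx h => hx ((hb' x).mul (h.1.inv h.2))⟩
  refine ⟨r, ?_⟩
  rw [adeleClass, LinearMap.comp_apply, Submodule.mkQ_apply, Submodule.Quotient.eq]
  obtain ⟨V, hV, hV'⟩ := exists_pointCover (p := fun _ y => F y ≠ 0)
    fun x => (hne x).mono fun y hy => hy.2
  refine ⟨fun x => U x ∩ V x ∩ W x, fun x => ⟨((hU x).1.inter (hV x).1).inter (hW x).1,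
    ⟨(hU x).2, (hV x).2⟩, (hW x).2⟩, fun _ _ => 0, fun _ => mdifferentiableOn_const,
    fun x y p hp => ?_⟩
  by_cases hxy : x = y
  · subst hxy
    simp [hc.self_eq_zero hp.1.2]
  · have hFp : F p ≠ 0 := by
      by_cases hpx : p = x
      · exact hV' y p hp.2.1.2 (hpx ▸ hxy)
      · exact hV' x p hp.1.1.2 hpx
    have := hbc x y p ⟨hp.1.1.1, hp.2.1.1⟩
    simp only [Pi.mul_apply] at this
    simp only [r, Submodule.subtype_apply, AddSubgroupClass.coe_sub, LinearMap.coe_mk,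
      AddHom.coe_mk, Pi.sub_apply, Pi.mul_apply, Pi.inv_apply, sub_zero]
    field_simp
    linear_combination -this

end Adele

/-! ### Functions with a single pole -/

section Poles

variable {X : Type*} [TopologicalSpace X] [T2Space X] [CompactSpace X] [ConnectedSpace X]
  [ChartedSpace ℂ X] [IsManifold 𝓘(ℂ) ω X] {g : ℕ}

theorem HasGenus.module_finite (hg : HasGenus X g) : Module.Finite ℂ (H1 X) :=
  Module.finite_of_rank_eq_nat hg

theorem HasGenus.finrank_eq (hg : HasGenus X g) : Module.finrank ℂ (H1 X) = g :=
  Module.finrank_eq_of_rank_eq hg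

/-- More than `g` classes in a space of dimension `g` are linearly dependent; the relation is a
solvable Mittag-Leffler problem. This replaces the Riemann inequality. -/
theorem exists_mer_of_lt_card (hg : HasGenus X g) {ι : Type*} [Fintype ι] (v : ι → adele X)
    (h : g < Fintype.card ι) :
    ∃ a : ι → ℂ, a ≠ 0 ∧ ∃ f, Mer f ∧ ∀ x, 0 ≤ ordAt ((∑ i, a i • (v i).1 x) - f) x := by
  have := hg.module_finite
  obtain ⟨a, ha, ha0⟩ := (Submodule.ne_bot_iff _).1 (LinearMap.ker_ne_bot_of_finrank_lt
    (f := adeleClass.comp (Fintype.linearCombination ℂ v))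
    (by rw [hg.finrank_eq, Module.finrank_fintype_fun_eq_card]; exact h))
  rw [LinearMap.mem_ker, LinearMap.comp_apply, adeleClass_eq_zero_iff] at ha
  refine ⟨a, ha0, ?_⟩
  obtain ⟨f, hf, hord⟩ := ha
  refine ⟨f, hf, fun x => ?_⟩
  have := hord x
  rw [Fintype.linearCombination_apply] at this
  simpa [AddSubmonoidClass.coe_finsetSum] using this

open Classical in
/-- The adele with the single component `u` at `q`. -/
def single (q : X) (u : X → ℂ) (hu : MerAt u q) : adele X :=
  ⟨fun x => if x = q then u else 0, fun x => by
    by_cases h : x = q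
    · subst h; simpa using hu
    · simp only [h, if_false]; exact merAt_const 0, (finite_singleton q).subset fun x hx => by
    by_contra hne
    refine hx ?_
    simp only [if_neg (show x ≠ q from hne)]
    exact holAt_const 0⟩

theorem single_self {q : X} {u : X → ℂ} (hu : MerAt u q) : (single q u hu).1 q = u := by
  simp [single]

theorem single_of_ne {q x : X} {u : X → ℂ} (hu : MerAt u q) (h : x ≠ q) :
    (single q u hu).1 x = 0 := by
  simp [single, h]

/-- `f` is meromorphic with a pole of order `n` at `p` and no other poles. -/
structure HasPole (f : X → ℂ) (p : X) (n : ℕ) : Prop where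
  mer : Mer f
  nonneg : ∀ x, x ≠ p → 0 ≤ ordAt f x
  ord_eq : ordAt f p = (-(n : ℤ) : ℤ)

/-- There are at most `g` Weierstrass gaps at `p`. A dependency between the principal parts `coord p
^ (-γ i)` gives a function whose leading term at `p` is that of the combination, so its pole order
is one of the `γ i`. -/
theorem exists_hasPole (hg : HasGenus X g) (p : X) {γ : Fin (g + 1) → ℕ}
    (hγ : Function.Injective γ) (h1 : ∀ i, 1 ≤ γ i) : ∃ i f, HasPole f p (γ i) := by
  have hm : ∀ i, MerAt (coord p ^ (-(γ i : ℤ))) p := fun i => (merAt_coord p).zpow _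
  obtain ⟨a, ha, f, hf, hord⟩ := exists_mer_of_lt_card hg
    (fun i : Fin (g + 1) => single p (coord p ^ (-(γ i : ℤ))) (hm i)) (by simp)
  obtain ⟨i, -, hi⟩ := exists_ordAt_sum_smul (x := p) (F := fun i => coord p ^ (-(γ i : ℤ)))
    (γ := fun i => -(γ i : ℤ)) (fun i j hij => hγ (by simpa using hij)) hm
    (fun i => ordAt_coord_zpow p _) ha
  refine ⟨i, f, hf, fun x hx => ?_, ?_⟩
  · have := hord x
    simp only [single_of_ne (hm _) hx, smul_zero, Finset.sum_const_zero, zero_sub,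
      ordAt_neg] at this
    exact this
  · have h2 := hord p
    simp only [single_self (hm _)] at h2
    set s := ∑ i, a i • coord p ^ (-(γ i : ℤ)) with hs
    have hsm : MerAt s p := MerAt.sum _ fun i _ => (hm i).smul _
    have h3 : f = s + -(s - f) := by ring
    rw [h3, ordAt_add_eq_left ((hsm.sub (hf p)).neg), hi]
    rw [ordAt_neg, hi]
    refine lt_of_lt_of_le ?_ h2
    have := h1 i
    exact_mod_cast (by omega : -(γ i : ℤ) < 0)

/-- If each of the `g + 1` pairs `{2 i + 1, 2 i + 2}` contained a gap, there would be `g + 1` gaps.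
-/
theorem exists_consecutive_hasPole (hg : HasGenus X g) (p : X) : ∃ n, 1 ≤ n ∧ n ≤ 2 * g + 1 ∧
    (∃ f, HasPole f p n) ∧ ∃ f, HasPole f p (n + 1) := by
  by_contra hcon
  have hgap : ∀ i : Fin (g + 1), ∃ m : ℕ, (m = 2 * i + 1 ∨ m = 2 * i + 2) ∧
      ¬ ∃ f, HasPole f p m := by
    intro i
    by_contra h
    push Not at h
    exact hcon ⟨2 * i + 1, by omega, by have := i.2; omega, h _ (.inl rfl), h _ (.inr rfl)⟩
  choose γ h1 h2 using hgap
  obtain ⟨i, f, hf⟩ := exists_hasPole hg p (γ := γ)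
    (fun i j hij => Fin.ext (by have := h1 i; have := h1 j; omega))
    (fun i => by have := h1 i; omega)
  exact h2 i ⟨f, hf⟩

theorem exists_hasPole_pos (hg : HasGenus X g) (p : X) : ∃ n f, 1 ≤ n ∧ HasPole f p n := by
  obtain ⟨n, h1, -, ⟨f, hf⟩, -⟩ := exists_consecutive_hasPole hg p
  exact ⟨n, f, h1, hf⟩

theorem HasPole.ordAt_pow {f : X → ℂ} {p : X} {n : ℕ} (hf : HasPole f p n) (i : ℕ) :
    ordAt (f ^ i) p = (-((i * n : ℕ) : ℤ) : ℤ) := by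
  rw [Brake.ordAt_pow (hf.mer p), hf.ord_eq]
  rw [← WithTop.coe_natCast, ← WithTop.coe_mul]
  congr 1
  push_cast
  ring

theorem ordAt_pow_nonneg {f : X → ℂ} {x : X} (hf : MerAt f x) (h : 0 ≤ ordAt f x) (n : ℕ) :
    0 ≤ ordAt (f ^ n) x := by
  induction n with
  | zero => rw [pow_zero]; exact (holAt_const (1 : ℂ)).ordAt_nonneg
  | succ n ih => rw [pow_succ, ordAt_mul (hf.pow n) hf]; exact add_nonneg ih h

/-- For a cocycle `c` and a function `f` with a pole, the `g + 1` classes of `f ^ i * c` are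
dependent. Thus `F * c` is a coboundary for a nonzero polynomial `F` in `f`, and dividing by `F`
represents `c` by an adele. -/
theorem adeleClass_surjective (hg : HasGenus X g) :
    Function.Surjective (adeleClass (X := X)) := by
  intro c
  obtain ⟨c, rfl⟩ := Submodule.Quotient.mk_surjective _ c
  obtain ⟨p⟩ := (inferInstance : Nonempty X)
  obtain ⟨n, f, hn, hf⟩ := exists_hasPole_pos hg p
  let F : (Fin (g + 1) → ℂ) → X → ℂ := fun a => ∑ i, a i • f ^ (i : ℕ)
  have hF : ∀ a, Mer (F a) := fun a => Mer.sum _ fun i _ => (hf.mer.pow _).smul _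
  let ψ : (Fin (g + 1) → ℂ) →ₗ[ℂ] cocycles X :=
    { toFun := fun a => ⟨fun x y => F a * c.1 x y, (hF a).mul_mem_cocycles c.2⟩
      map_add' := fun a b => by
        ext x y p
        simp [F, Finset.sum_add_distrib, add_mul]
      map_smul' := fun t a => by
        ext x y p
        simp [F, Finset.mul_sum, Finset.sum_mul, mul_assoc] }
  have := hg.module_finite
  obtain ⟨a, ha, ha0⟩ := (Submodule.ne_bot_iff _).1 (LinearMap.ker_ne_bot_of_finrank_lt
    (f := ((Submodule.mkQ _).comp ψ : (Fin (g + 1) → ℂ) →ₗ[ℂ] H1 X))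
    (by rw [hg.finrank_eq]; simp))
  rw [LinearMap.mem_ker, LinearMap.comp_apply, Submodule.mkQ_apply,
    Submodule.Quotient.mk_eq_zero] at ha
  obtain ⟨i, -, hi⟩ := exists_ordAt_sum_smul (x := p) (F := fun i : Fin (g + 1) => f ^ (i : ℕ))
    (γ := fun i => -((i * n : ℕ) : ℤ)) (fun i j hij => Fin.ext (by
      simp only [neg_inj, Nat.cast_inj] at hij
      exact Nat.eq_of_mul_eq_mul_right (by omega) hij)) (fun i => (hf.mer.pow _) p)
    (fun i => hf.ordAt_pow i) ha0
  exact exists_adeleClass_eq (hF a) (x₀ := p) (by simp only [F, hi]; exact WithTop.coe_ne_top) c ha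

/-- A meromorphic function may be changed on a discrete set so as to become holomorphic away from
its pole. -/
theorem Mer.exists_holAt {f : X → ℂ} {p : X} (hf : Mer f) (h0 : ∀ x, x ≠ p → 0 ≤ ordAt f x) :
    ∃ F, (∀ x, x ≠ p → HolAt F x) ∧ ∀ x, f =ᶠ[𝓝[≠] x] F := by
  have h : ∀ x, ∃ c, x ≠ p → Tendsto f (𝓝[≠] x) (𝓝 c) := fun x => by
    by_cases hx : x = p
    · exact ⟨0, fun h => absurd hx h⟩
    · obtain ⟨c, hc⟩ := (tendsto_nhds_iff_ordAt_nonneg (hf x)).2 (h0 x hx)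
      exact ⟨c, fun _ => hc⟩
  choose L hL using h
  have hev : ∀ x, f =ᶠ[𝓝[≠] x] L := fun x => by
    have hp : ∀ᶠ y in 𝓝[≠] x, y ≠ p :=
      eventually_nhdsNE_of_finite (p := fun y => y ≠ p) (by simp) x
    filter_upwards [(hf x).eventually_holAt, hp] with y hy hyp
    exact (tendsto_nhds_unique (hL y hyp) (hy.continuousAt.continuousWithinAt)).symm
  refine ⟨L, fun x hx => ((hf x).congr (hev x)).holAt ?_, hev⟩
  rw [continuousAt_iff_punctured_nhds]
  exact (hL x hx).congr' (hev x)

theorem HasPole.congr {f F : X → ℂ} {p : X} {n : ℕ} (hf : HasPole f p n)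
    (h : ∀ x, f =ᶠ[𝓝[≠] x] F) : HasPole F p n :=
  ⟨fun x => (hf.mer x).congr (h x), fun x hx => by rw [← ordAt_congr (h x)]; exact hf.nonneg x hx,
    by rw [← ordAt_congr (h p)]; exact hf.ord_eq⟩

theorem HasPole.exists_holAt {f : X → ℂ} {p : X} {n : ℕ} (hf : HasPole f p n) :
    ∃ F, HasPole F p n ∧ ∀ x, x ≠ p → HolAt F x := by
  obtain ⟨F, hF, h⟩ := hf.mer.exists_holAt hf.nonneg
  exact ⟨F, hf.congr h, hF⟩

/-- Powers of `f` realise every pole order at `p`; subtracting leading terms one by one ends in a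
function without poles, which is constant. -/
theorem exists_polynomial {f : X → ℂ} {p : X} (hf : HasPole f p 1) (n : ℕ) :
    ∀ w, Mer w → (∀ x, x ≠ p → 0 ≤ ordAt w x) → ((-(n : ℤ) : ℤ) : WithTop ℤ) ≤ ordAt w p →
      ∃ P : Polynomial ℂ, ∀ x, w =ᶠ[𝓝[≠] x] fun y => P.eval (f y) := by
  induction n with
  | zero =>
    intro w hw h1 h2
    obtain ⟨c, hc⟩ := exists_eventuallyEq_const_of_ordAt_nonneg hw fun x => by
      by_cases hx : x = p
      · rw [hx]; simpa using h2
      · exact h1 x hx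
    exact ⟨Polynomial.C c, fun x => by simpa using hc x⟩
  | succ n ih =>
    intro w hw h1 h2
    by_cases h3 : ((-(n : ℤ) : ℤ) : WithTop ℤ) ≤ ordAt w p
    · exact ih w hw h1 h3
    have h4 : ordAt w p = ((-((n + 1 : ℕ) : ℤ) : ℤ) : WithTop ℤ) := by
      refine le_antisymm ?_ h2
      lift ordAt w p to ℤ using (fun h => h3 (h ▸ le_top)) with m
      norm_cast at h3 ⊢
      omega
    have hpw := hf.ordAt_pow (n + 1)
    rw [mul_one] at hpw
    obtain ⟨c, -, -, hlt⟩ := exists_ordAt_sub_smul_lt (hw p) ((hf.mer.pow (n + 1)) p)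
      (h4.trans hpw.symm) (by rw [hpw]; exact WithTop.coe_ne_top)
    obtain ⟨P, hP⟩ := ih (w - c • f ^ (n + 1)) (hw.sub ((hf.mer.pow _).smul _)) (fun x hx => by
      refine le_ordAt_sub (hw x) (((hf.mer.pow _).smul _) x) (h1 x hx)
        (le_ordAt_smul ((hf.mer.pow _) x) (ordAt_pow_nonneg (hf.mer x) (hf.nonneg x hx) _))) (by
      rw [hpw] at hlt
      cases h5 : ordAt (w - c • f ^ (n + 1)) p with
      | top => exact le_top
      | coe m =>
        rw [h5] at hlt
        norm_cast at hlt ⊢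
        omega)
    refine ⟨P + Polynomial.C c * Polynomial.X ^ (n + 1), fun x => ?_⟩
    filter_upwards [hP x] with y hy
    simp only [Pi.sub_apply, Pi.smul_apply, Pi.pow_apply, smul_eq_mul] at hy
    simp only [Polynomial.eval_add, Polynomial.eval_mul, Polynomial.eval_C, Polynomial.eval_pow,
      Polynomial.eval_X, ← hy]
    ring

theorem mer_eval {f : X → ℂ} (hf : Mer f) (P : Polynomial ℂ) : Mer fun y => P.eval (f y) := by
  induction P using Polynomial.induction_on' with
  | add P Q hP hQ => simp only [Polynomial.eval_add]; exact hP.add hQ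
  | monomial n a =>
    convert (hf.pow n).smul a using 2 with y
    simp

/-- At a point where `f` has the finite value `c`, the order of a polynomial in `f` is a multiple
of the multiplicity with which `f` takes this value. -/
theorem ordAt_eval {f : X → ℂ} (hf : Mer f) {q : X} {c : ℂ} (hc : Tendsto f (𝓝[≠] q) (𝓝 c))
    {P : Polynomial ℂ} (hP : P ≠ 0) :
    ordAt (fun y => P.eval (f y)) q = P.rootMultiplicity c * ordAt (f - fun _ => c) q := by
  obtain ⟨Q, hQ, hnd⟩ := Polynomial.exists_eq_pow_rootMultiplicity_mul_and_not_dvd P hP c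
  have hQc : Q.eval c ≠ 0 := fun h => hnd (Polynomial.dvd_iff_isRoot.2 h)
  set k := P.rootMultiplicity c
  have h1 : (fun y => P.eval (f y)) = (f - fun _ => c) ^ k * fun y => Q.eval (f y) := by
    ext y
    conv_lhs => rw [hQ]
    simp
  have hm : Mer (f - fun _ => c) := hf.sub (mer_const c)
  have h2 : ordAt (fun y => Q.eval (f y)) q = 0 :=
    (tendsto_ne_zero_iff_ordAt_eq_zero (mer_eval hf Q q)).1
      ⟨_, hQc, (Q.continuous.tendsto c).comp hc⟩
  rw [h1, ordAt_mul ((hm.pow k) q) (mer_eval hf Q q), h2, add_zero, ordAt_pow (hm q)]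

end Poles

/-! ### Functions with a single simple pole -/

section SimplePole

variable {X : Type*} [TopologicalSpace X] [T2Space X] [CompactSpace X] [ConnectedSpace X]
  [ChartedSpace ℂ X] [IsManifold 𝓘(ℂ) ω X] {g : ℕ} {f : X → ℂ} {p : X}

theorem HasPole.ordAt_sub_const {n : ℕ} (hf : HasPole f p n) (hn : 1 ≤ n) (c : ℂ) :
    ordAt (f - fun _ => c) p = (-(n : ℤ) : ℤ) := by
  rw [sub_eq_add_neg, ordAt_add_eq_left (merAt_const c).neg, hf.ord_eq]
  rw [hf.ord_eq]
  refine lt_of_lt_of_le ?_ (HolAt.ordAt_nonneg (f := -fun _ : X => c) ?_)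
  · exact_mod_cast (by omega : -(n : ℤ) < 0)
  · exact holAt_const (-c)

theorem HasPole.exists_ordAt_sub_eq {n : ℕ} (hf : HasPole f p n) (hn : 1 ≤ n) {q : X} {c : ℂ}
    (hc : Tendsto f (𝓝[≠] q) (𝓝 c)) :
    ∃ m : ℕ, 1 ≤ m ∧ ordAt (f - fun _ => c) q = (m : ℤ) := by
  have h1 := ordAt_sub_const_pos (hf.mer q) hc
  have h2 : ordAt (f - fun _ => c) q ≠ ⊤ := (hf.mer.sub (mer_const c)).ordAt_ne_top (x := p)
    (by rw [hf.ordAt_sub_const hn]; exact WithTop.coe_ne_top) q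
  lift ordAt (f - fun _ => c) q to ℤ using h2 with m
  have h1 : 0 < m := by exact_mod_cast h1
  exact ⟨m.toNat, by omega, by rw [Int.toNat_of_nonneg h1.le]⟩

theorem HolAt.tendsto (hf : HolAt f p) : Tendsto f (𝓝[≠] p) (𝓝 (f p)) :=
  hf.continuousAt.continuousWithinAt

/-- Multiplication by `(f - f q) ^ n` cancels the pole of `F` at `q` and leaves a polynomial `P` in
`f`. The order of `P (f)` at a point of the fibre is the multiplicity of the root `f q` times that
of the point, so one factor `k` serves the whole fibre. -/
theorem exists_ordAt_eq_mul (hf : HasPole f p 1) (hhol : ∀ x, x ≠ p → HolAt f x)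
    {q : X} (hq : q ≠ p) {F : X → ℂ} {n : ℕ} (hF : HasPole F q n) :
    ∃ k : ℤ, ∀ x, x ≠ p → f x = f q → ∀ m : ℤ, ordAt (f - fun _ => f q) x = m →
      ordAt F x = ((k * m : ℤ) : WithTop ℤ) := by
  have hfm : Mer (f - fun _ => f q) := hf.mer.sub (mer_const _)
  have hw : Mer ((f - fun _ => f q) ^ n * F) := (hfm.pow n).mul hF.mer
  have hnn : ∀ x, x ≠ p → 0 ≤ ordAt (f - fun _ => f q) x := fun x hx =>
    ((hhol x hx).sub (holAt_const _)).ordAt_nonneg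
  have hpn : ordAt ((f - fun _ => f q) ^ n) p = (-(n : ℤ) : ℤ) := by
    rw [ordAt_pow (hfm p), hf.ordAt_sub_const le_rfl, ← WithTop.coe_natCast, ← WithTop.coe_mul]
    simp
  obtain ⟨P, hP⟩ := exists_polynomial hf n _ hw (fun x hx => by
    rw [ordAt_mul ((hfm.pow n) x) (hF.mer x)]
    by_cases hxq : x = q
    · subst hxq
      obtain ⟨m, hm, hm'⟩ := hf.exists_ordAt_sub_eq le_rfl (hhol x hq).tendsto
      rw [ordAt_pow (hfm x), hm', hF.ord_eq, ← WithTop.coe_natCast, ← WithTop.coe_mul]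
      have : (0 : ℤ) ≤ n * m + -n := by nlinarith
      exact_mod_cast this
    · exact add_nonneg (ordAt_pow_nonneg (hfm x) (hnn x hx) n) (hF.nonneg x hxq)) (by
    rw [ordAt_mul ((hfm.pow n) p) (hF.mer p), hpn]
    exact le_add_of_nonneg_right (hF.nonneg p (Ne.symm hq)))
  have hP0 : P ≠ 0 := by
    rintro rfl
    have h1 : ordAt ((f - fun _ => f q) ^ n * F) p = ⊤ :=
      ordAt_eq_top_iff.2 ((hP p).mono fun y hy => by simpa using hy)
    have h2 : ordAt F p ≠ ⊤ :=
      hF.mer.ordAt_ne_top (x := q) (by rw [hF.ord_eq]; exact WithTop.coe_ne_top) p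
    rw [ordAt_mul ((hfm.pow n) p) (hF.mer p), hpn, WithTop.add_eq_top] at h1
    exact h1.elim WithTop.coe_ne_top h2
  refine ⟨(P.rootMultiplicity (f q) : ℤ) - n, fun x hx hxq m hm => ?_⟩
  have h1 := ordAt_eval hf.mer (hxq ▸ (hhol x hx).tendsto) hP0
  rw [← ordAt_congr (hP x), ordAt_mul ((hfm.pow n) x) (hF.mer x), ordAt_pow (hfm x), hm,
    ← WithTop.coe_natCast, ← WithTop.coe_natCast, ← WithTop.coe_mul, ← WithTop.coe_mul] at h1
  cases h2 : ordAt F x with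
  | top => rw [h2, WithTop.add_top] at h1; exact absurd h1 WithTop.top_ne_coe
  | coe l =>
    rw [h2, ← WithTop.coe_add] at h1
    have h1 := WithTop.coe_injective h1
    congr 1
    linarith

/-- A function whose only pole is `q₁` has negative order at `q₁`, so the factor `k` common to the
fibre is negative, and the function would also have a pole at `q₂`. -/
theorem simplePole_injective (hf : HasPole f p 1) (hhol : ∀ x, x ≠ p → HolAt f x)
    (hg : HasGenus X g) {q₁ q₂ : X} (h1 : q₁ ≠ p) (h2 : q₂ ≠ p)
    (h : f q₁ = f q₂) : q₁ = q₂ := by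
  by_contra hne
  obtain ⟨n, F, hn, hF⟩ := exists_hasPole_pos hg q₁
  obtain ⟨k, hk⟩ := exists_ordAt_eq_mul hf hhol h1 hF
  obtain ⟨m₁, hm₁, hm₁'⟩ := hf.exists_ordAt_sub_eq le_rfl (hhol q₁ h1).tendsto
  obtain ⟨m₂, hm₂, hm₂'⟩ := hf.exists_ordAt_sub_eq le_rfl (h ▸ (hhol q₂ h2).tendsto)
  have e1 := hk q₁ h1 rfl m₁ hm₁'
  have e2 := hk q₂ h2 h.symm m₂ hm₂'
  have e3 := hF.nonneg q₂ (Ne.symm hne)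
  rw [hF.ord_eq] at e1
  have e1 := WithTop.coe_injective e1
  rw [e2] at e3
  have e3 : 0 ≤ k * m₂ := by exact_mod_cast e3
  have hk0 : k < 0 := by
    by_contra hcon
    have : 0 ≤ k * m₁ := mul_nonneg (by omega) (by omega)
    omega
  nlinarith

/-- The multiplicity of `q` divides the order of every function whose only pole is `q`, hence two
consecutive integers. -/
theorem simplePole_ordAt (hf : HasPole f p 1) (hhol : ∀ x, x ≠ p → HolAt f x)
    (hg : HasGenus X g) {q : X} (hq : q ≠ p) :
    ordAt (f - fun _ => f q) q = 1 := by
  obtain ⟨n, hn, -, ⟨F, hF⟩, ⟨G, hG⟩⟩ := exists_consecutive_hasPole hg q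
  obtain ⟨k, hk⟩ := exists_ordAt_eq_mul hf hhol hq hF
  obtain ⟨l, hl⟩ := exists_ordAt_eq_mul hf hhol hq hG
  obtain ⟨m, hm, hm'⟩ := hf.exists_ordAt_sub_eq le_rfl (hhol q hq).tendsto
  have e1 := hk q hq rfl m hm'
  have e2 := hl q hq rfl m hm'
  rw [hF.ord_eq] at e1
  rw [hG.ord_eq] at e2
  have e1 := WithTop.coe_injective e1
  have e2 := WithTop.coe_injective e2
  have h3 : (m : ℤ) ∣ 1 := ⟨k - l, by push_cast at e2; linarith⟩
  have h4 : (m : ℤ) = 1 := Int.eq_one_of_dvd_one (by omega) h3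
  rw [hm', h4]; rfl

/-- If `c` were omitted, `(f - c)⁻¹` would have no pole, hence be constant, although it has a simple
zero at `p`. -/
theorem simplePole_surjective (hf : HasPole f p 1) (hhol : ∀ x, x ≠ p → HolAt f x)
    (c : ℂ) : ∃ q, q ≠ p ∧ f q = c := by
  by_contra hcon
  push Not at hcon
  have hm : Mer (f - fun _ => c)⁻¹ := (hf.mer.sub (mer_const c)).inv
  have hp : ordAt (f - fun _ => c)⁻¹ p = 1 := by
    rw [ordAt_inv, hf.ordAt_sub_const le_rfl]
    rfl
  obtain ⟨a, ha⟩ := exists_eventuallyEq_const_of_ordAt_nonneg hm fun x => by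
    by_cases hx : x = p
    · rw [hx, hp]; exact zero_le_one
    · exact (((hhol x hx).sub (holAt_const c)).inv (sub_ne_zero.2 (hcon x hx))).ordAt_nonneg
  rw [ordAt_congr (ha p)] at hp
  rcases eq_or_ne a 0 with rfl | h0
  · rw [(ordAt_eq_top_iff (f := fun _ : X => (0 : ℂ))).2 (by simp)] at hp
    exact absurd hp (by simp)
  · rw [ordAt_const h0] at hp
    exact absurd hp (by simp)

/-- Away from `p` the function `(f - f q)⁻¹` has a simple pole at `q` and no other, by injectivity
and multiplicity one; its powers do the rest. -/
theorem exists_hasPole_of_simplePole (hf : HasPole f p 1) (hhol : ∀ x, x ≠ p → HolAt f x)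
    (hg : HasGenus X g) (q : X) (n : ℕ) : ∃ F, HasPole F q n := by
  by_cases hq : q = p
  · subst hq
    refine ⟨f ^ n, hf.mer.pow n, fun x hx => ordAt_pow_nonneg (hf.mer x) (hf.nonneg x hx) n, ?_⟩
    simpa using hf.ordAt_pow n
  · have hm : Mer (f - fun _ => f q) := hf.mer.sub (mer_const _)
    have hm' := hm.inv
    refine ⟨(f - fun _ => f q)⁻¹ ^ n, hm'.pow n, fun x hx => ordAt_pow_nonneg (hm' x) ?_ n, ?_⟩
    · by_cases hxp : x = p
      · rw [hxp, ordAt_inv, hf.ordAt_sub_const le_rfl]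
        exact_mod_cast (by norm_num : (0 : ℤ) ≤ - -((1 : ℕ) : ℤ))
      · exact (((hhol x hxp).sub (holAt_const _)).inv (sub_ne_zero.2 fun h =>
          hx (simplePole_injective hf hhol hg hxp hq h))).ordAt_nonneg
    · rw [ordAt_pow (hm' q), ordAt_inv, simplePole_ordAt hf hhol hg hq, ← WithTop.coe_natCast,
        show -(1 : WithTop ℤ) = ((-1 : ℤ) : WithTop ℤ) from rfl, ← WithTop.coe_mul]
      simp

/-- Every pole order at `q` is available, so the principal part of `w` is removed one leading term
at a time. -/
theorem exists_principal_part_of_simplePole (hf : HasPole f p 1) (hhol : ∀ x, x ≠ p → HolAt f x)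
    (hg : HasGenus X g) (q : X) {w : X → ℂ}
    (hw : MerAt w q) :
    ∃ F, Mer F ∧ (∀ x, x ≠ q → 0 ≤ ordAt F x) ∧ 0 ≤ ordAt (w - F) q := by
  suffices h : ∀ n : ℕ, ∀ w : X → ℂ, MerAt w q → ((-(n : ℤ) : ℤ) : WithTop ℤ) ≤ ordAt w q →
      ∃ F, Mer F ∧ (∀ x, x ≠ q → 0 ≤ ordAt F x) ∧ 0 ≤ ordAt (w - F) q by
    cases h1 : ordAt w q with
    | top => exact h 0 w hw (by rw [h1]; exact le_top)
    | coe m => exact h m.natAbs w hw (by rw [h1]; exact WithTop.coe_le_coe.2 (by omega))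
  intro n
  induction n with
  | zero =>
    intro w hw h
    exact ⟨fun _ => 0, mer_const 0, fun x _ => (holAt_const 0).ordAt_nonneg,
      le_ordAt_sub hw (merAt_const 0) (by simpa using h) (holAt_const 0).ordAt_nonneg⟩
  | succ n ih =>
    intro w hw h2
    by_cases h3 : ((-(n : ℤ) : ℤ) : WithTop ℤ) ≤ ordAt w q
    · exact ih w hw h3
    have h4 : ordAt w q = ((-((n + 1 : ℕ) : ℤ) : ℤ) : WithTop ℤ) := by
      refine le_antisymm ?_ h2
      lift ordAt w q to ℤ using (fun h => h3 (h ▸ le_top)) with m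
      norm_cast at h3 ⊢
      omega
    obtain ⟨F, hF⟩ := exists_hasPole_of_simplePole hf hhol hg q (n + 1)
    obtain ⟨c, -, -, hlt⟩ := exists_ordAt_sub_smul_lt hw (hF.mer q) (h4.trans hF.ord_eq.symm)
      (by rw [hF.ord_eq]; exact WithTop.coe_ne_top)
    obtain ⟨G, hG, hG1, hG2⟩ := ih (w - c • F) (hw.sub ((hF.mer.smul c) q)) (by
      rw [hF.ord_eq] at hlt
      cases h5 : ordAt (w - c • F) q with
      | top => exact le_top
      | coe m =>
        rw [h5] at hlt
        norm_cast at hlt ⊢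
        omega)
    refine ⟨c • F + G, (hF.mer.smul c).add hG, fun x hx => ?_, by rwa [← sub_sub]⟩
    exact le_ordAt_add ((hF.mer.smul c) x) (hG x)
      (le_ordAt_smul (hF.mer x) (hF.nonneg x hx)) (hG1 x hx)

/-- Summing functions with the prescribed principal parts at the finitely many poles of an adele
solves every Mittag-Leffler problem, so the cohomology vanishes. -/
theorem genus_eq_zero_of_simplePole (hf : HasPole f p 1) (hhol : ∀ x, x ≠ p → HolAt f x)
    (hg : HasGenus X g) : g = 0 := by
  classical
  have hzero : ∀ r : adele X, adeleClass r = 0 := by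
    intro r
    rw [adeleClass_eq_zero_iff]
    choose F hF hF1 hF2 using fun q =>
      exists_principal_part_of_simplePole hf hhol hg q (r.2.1 q)
    set S := r.2.2.toFinset with hS
    refine ⟨∑ q ∈ S, F q, Mer.sum _ fun q _ => hF q, fun x => ?_⟩
    by_cases hx : x ∈ S
    · rw [← Finset.add_sum_erase _ _ hx, ← sub_sub]
      refine le_ordAt_sub ((r.2.1 x).sub (hF x x)) (MerAt.sum _ fun q _ => hF q x) (hF2 x)
        (le_ordAt_sum _ (fun q _ => hF q x) fun q hq => hF1 q x ?_)
      exact (Finset.ne_of_mem_erase hq).symm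
    · have hx' : HolAt (r.1 x) x := by
        by_contra h
        exact hx (by simpa [hS] using h)
      refine le_ordAt_sub (r.2.1 x) (MerAt.sum _ fun q _ => hF q x) hx'.ordAt_nonneg
        (le_ordAt_sum _ (fun q _ => hF q x) fun q hq => hF1 q x ?_)
      rintro rfl
      exact hx hq
  have hsub : Subsingleton (H1 X) := subsingleton_of_forall_eq 0 fun c => by
    obtain ⟨r, rfl⟩ := adeleClass_surjective hg c
    exact hzero r
  rw [← hg.finrank_eq]
  exact Module.finrank_zero_of_subsingleton

end SimplePole

section

variable {X : Type*} [TopologicalSpace X] [T2Space X] [CompactSpace X] [ConnectedSpace X]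
  [ChartedSpace ℂ X] [IsManifold 𝓘(ℂ) ω X] {g : ℕ} {f : X → ℂ} {p : X}

theorem HasPole.genus_eq_zero (hf : HasPole f p 1) (hg : HasGenus X g) : g = 0 := by
  obtain ⟨F, hF, hF'⟩ := hf.exists_holAt
  exact genus_eq_zero_of_simplePole hF hF' hg

end

/-! ### Automorphisms of a compact Riemann surface -/

section Automorphisms

variable {X : Type*} [TopologicalSpace X] [T2Space X] [ChartedSpace ℂ X] [IsManifold 𝓘(ℂ) ω X]

variable (X) in
/-- The group of biholomorphic maps of `X` onto itself. -/
def biholAut : Subgroup (X ≃ₜ X) where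
  carrier := {h | MDifferentiable 𝓘(ℂ) 𝓘(ℂ) h ∧ MDifferentiable 𝓘(ℂ) 𝓘(ℂ) h.symm}
  one_mem' := ⟨mdifferentiable_id, mdifferentiable_id⟩
  mul_mem' := by
    rintro h k ⟨h1, h2⟩ ⟨k1, k2⟩
    exact ⟨h1.comp k1, k2.comp h2⟩
  inv_mem' := by
    rintro h ⟨h1, h2⟩
    exact ⟨h2, h1⟩

variable {k : X ≃ₜ X} {f : X → ℂ} {p x : X}

theorem MerAt.comp_bihol (hk : k ∈ biholAut X) (hf : MerAt f (k x)) : MerAt (f ∘ k) x :=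
  MerAt.comp hf (.of_forall hk.1)

theorem ordAt_comp_bihol (hk : k ∈ biholAut X) : ordAt (f ∘ k) x = ordAt f (k x) :=
  ordAt_comp hk.1 hk.2 k.symm_apply_apply

theorem Mer.comp_bihol (hk : k ∈ biholAut X) (hf : Mer f) : Mer (f ∘ k) := fun x =>
  (hf (k x)).comp_bihol hk

theorem HolAt.comp_bihol (hk : k ∈ biholAut X) (hf : HolAt f (k x)) : HolAt (f ∘ k) x :=
  (hf.merAt.comp_bihol hk).holAt (ContinuousAt.comp hf.continuousAt k.continuous.continuousAt)

theorem tendsto_nhdsNE_homeomorph (k : X ≃ₜ X) (x : X) : Tendsto k (𝓝[≠] x) (𝓝[≠] (k x)) :=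
  (k.continuous.continuousAt).continuousWithinAt.tendsto_nhdsWithin
    fun _ hy => k.injective.ne hy

theorem eventuallyEq_comp {g : X → ℂ} (k : X ≃ₜ X) (h : f =ᶠ[𝓝[≠] (k x)] g) :
    f ∘ k =ᶠ[𝓝[≠] x] g ∘ k := (tendsto_nhdsNE_homeomorph k x).eventually h

/-- An automorphism that is the identity near one point is the identity. -/
theorem eq_one_of_eventually [PreconnectedSpace X] (hk : k ∈ biholAut X)
    (h : ∀ᶠ y in 𝓝 p, k y = y) : k = 1 := by
  have hclopen : IsClopen {x | ∀ᶠ y in 𝓝 x, k y = y} := by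
    refine ⟨isClosed_of_closure_subset fun x hx => ?_, isOpen_setOfPred_eventually_nhds⟩
    have hfix : IsClosed {y | k y = y} := isClosed_eq k.continuous continuous_id
    have hkx : k x = x := hfix.closure_subset_iff.2 (fun y hy => hy.self_of_nhds) hx
    have hxs := mem_chart_source ℂ x
    by_cases hxm : ∀ᶠ y in 𝓝 x, k y = y
    · exact hxm
    -- A limit point of the set where `k` is locally the identity is fixed by `k`, so both maps can
    -- be read in the chart there and the identity theorem for analytic functions applies.
    have hfreq : ∃ᶠ y in 𝓝[≠] x, k y = y := by
      rw [mem_closure_iff_frequently] at hx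
      rw [frequently_nhdsWithin_iff]
      refine hx.mono fun y hy => ⟨hy.self_of_nhds, ?_⟩
      rintro rfl
      exact hxm hy
    have ha := analyticAt_chart_comp (x := x) (h := k) (.of_forall hk.1)
    rw [hkx] at ha
    have hev : ∀ᶠ y in 𝓝 x, k y ∈ (chartAt ℂ x).source ∧ y ∈ (chartAt ℂ x).source :=
      ((k.continuous.continuousAt.eventually_mem ((chartAt ℂ x).open_source.mem_nhds
        (by rw [hkx]; exact hxs)))).and ((chartAt ℂ x).open_source.mem_nhds hxs)
    have h1 : ∃ᶠ z in 𝓝[≠] (chartAt ℂ x x),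
        (chartAt ℂ x ∘ k ∘ (chartAt ℂ x).symm) z = id z := by
      rw [← map_chart_symm_nhdsNE x, frequently_map] at hfreq
      refine (hfreq.and_eventually (eventually_nhdsWithin_of_eventually_nhds
        ((chartAt ℂ x).open_target.mem_nhds ((chartAt ℂ x).map_source hxs)))).mono ?_
      rintro z ⟨hz, hz'⟩
      simp [hz, (chartAt ℂ x).right_inv hz']
    have h2 := (ha.frequently_eq_iff_eventually_eq analyticAt_id).1 h1
    have h3 := ((chartAt ℂ x).continuousAt hxs).eventually h2
    filter_upwards [h3, hev] with y hy hy'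
    simp only [Function.comp_apply, (chartAt ℂ x).left_inv hy'.2, id] at hy
    exact (chartAt ℂ x).injOn hy'.1 hy'.2 hy
  have : {x | ∀ᶠ y in 𝓝 x, k y = y} = univ := hclopen.eq_univ ⟨p, h⟩
  ext x
  exact (this ▸ mem_univ x : x ∈ {x | ∀ᶠ y in 𝓝 x, k y = y}).self_of_nhds

/-- A function with a simple zero at `p` is injective near `p`. -/
theorem eventually_eq_of_comp_eq {t : X → ℂ} (ht : MerAt t p) (ho : ordAt t p = 1)
    (hkp : k p = p) (h : t ∘ k =ᶠ[𝓝[≠] p] t) : ∀ᶠ y in 𝓝 p, k y = y := by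
  have hps := mem_chart_source ℂ p
  obtain ⟨u, hu, hu0, hut⟩ := (meromorphicOrderAt_eq_int_iff (n := 1) ht).1 ho
  set a := chartAt ℂ p p with ha
  -- In the chart `t` is `(z - a) * u z` with `u a ≠ 0`, so it has a local inverse; applying it to
  -- `t ∘ k = t` gives `k y = y`.
  let G : ℂ → ℂ := fun z => (z - a) * u z
  have hG : AnalyticAt ℂ G a := by fun_prop
  have hGd : HasStrictDerivAt G (u a) a := by
    have h1 : HasDerivAt G (1 * u a + (a - a) * deriv u a) a :=
      ((hasDerivAt_id a).sub_const a).mul hu.differentiableAt.hasDerivAt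
    have h2 := hG.hasStrictDerivAt
    rwa [h1.deriv, sub_self, zero_mul, add_zero, one_mul] at h2
  have hinj : ∀ᶠ z in 𝓝 a, hGd.localInverse G _ a hu0 (G z) = z :=
    (hGd.hasStrictFDerivAt_equiv hu0).eventually_left_inverse
  have htG : ∀ᶠ y in 𝓝[≠] p, t y = G (chartAt ℂ p y) := by
    rw [← eventually_chart_symm]
    filter_upwards [hut, mem_nhdsWithin_of_mem_nhds ((chartAt ℂ p).open_target.mem_nhds
      ((chartAt ℂ p).map_source hps))] with z hz hz'
    simp only [Function.comp_apply, zpow_one, smul_eq_mul] at hz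
    simp [hz, G, (chartAt ℂ p).right_inv hz']
  have hkt : Tendsto k (𝓝[≠] p) (𝓝[≠] p) := by
    simpa [hkp] using tendsto_nhdsNE_homeomorph k p
  have hk0 : Tendsto k (𝓝 p) (𝓝 p) := by simpa [hkp] using k.continuous.tendsto p
  have hc : Tendsto (chartAt ℂ p) (𝓝 p) (𝓝 a) := (chartAt ℂ p).continuousAt hps
  have hne : ∀ᶠ y in 𝓝[≠] p, k y = y := by
    have hs := (chartAt ℂ p).open_source.mem_nhds hps
    filter_upwards [htG, hkt.eventually htG, h,
      eventually_nhdsWithin_of_eventually_nhds (hc.eventually hinj),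
      eventually_nhdsWithin_of_eventually_nhds ((hc.comp hk0).eventually hinj),
      eventually_nhdsWithin_of_eventually_nhds hs,
      eventually_nhdsWithin_of_eventually_nhds (hk0.eventually hs)] with y h1 h2 h3 h4 h5 h6 h7
    simp only [Function.comp_apply] at h3 h5
    refine (chartAt ℂ p).injOn h7 h6 ?_
    rw [← h4, ← h5, ← h2, ← h1, h3]
  rw [eventually_nhdsWithin_iff] at hne
  filter_upwards [hne] with y hy
  by_cases hyp : y = p
  · rw [hyp, hkp]
  · exact hy hyp

/-- `a` is the derivative of `k` at its fixed point `p`. -/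
structure IsMultiplier (k : X ≃ₜ X) (p : X) (a : ℂ) : Prop where
  map_eq : k p = p
  ne_zero : a ≠ 0
  tendsto : Tendsto ((coord p ∘ k) / coord p) (𝓝[≠] p) (𝓝 a)

theorem exists_isMultiplier (hk : k ∈ biholAut X) (hp : k p = p) : ∃ a, IsMultiplier k p a := by
  have h1 : MerAt (coord p ∘ k) p := MerAt.comp_bihol hk (by rw [hp]; exact merAt_coord p)
  obtain ⟨c, hc, hlim, -⟩ := exists_ordAt_sub_smul_lt h1 (merAt_coord p)
    (by rw [ordAt_comp_bihol hk, hp]) (by rw [ordAt_coord]; exact WithTop.coe_ne_top)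
  exact ⟨c, hp, hc, hlim⟩

variable {a : ℂ}

theorem IsMultiplier.tendsto_self (h : IsMultiplier k p a) : Tendsto k (𝓝[≠] p) (𝓝[≠] p) := by
  simpa [h.map_eq] using tendsto_nhdsNE_homeomorph k p

theorem coord_eventually_ne_zero (p : X) : ∀ᶠ y in 𝓝[≠] p, coord p y ≠ 0 :=
  (ordAt_ne_top_iff (merAt_coord p)).1 (by rw [ordAt_coord]; exact WithTop.coe_ne_top)

theorem IsMultiplier.one (p : X) : IsMultiplier 1 p 1 where
  map_eq := rfl
  ne_zero := one_ne_zero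
  tendsto := by
    refine tendsto_const_nhds.congr' ?_
    filter_upwards [coord_eventually_ne_zero p] with y hy
    simp [hy]

theorem IsMultiplier.mul {l : X ≃ₜ X} {b : ℂ} (h : IsMultiplier k p a) (h' : IsMultiplier l p b) :
    IsMultiplier (k * l) p (a * b) where
  map_eq := by rw [Homeomorph.mul_apply, h'.map_eq, h.map_eq]
  ne_zero := mul_ne_zero h.ne_zero h'.ne_zero
  tendsto := by
    refine ((h.tendsto.comp h'.tendsto_self).mul h'.tendsto).congr' ?_
    filter_upwards [coord_eventually_ne_zero p,
      h'.tendsto_self.eventually (coord_eventually_ne_zero p)] with y hy hy'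
    simp only [Function.comp_apply, Pi.div_apply, Homeomorph.mul_apply]
    field_simp

theorem IsMultiplier.pow (h : IsMultiplier k p a) (j : ℕ) : IsMultiplier (k ^ j) p (a ^ j) := by
  induction j with
  | zero => simpa using IsMultiplier.one p
  | succ j ih => rw [pow_succ, pow_succ]; exact ih.mul h

/-- Write `f = coord p ^ n * u` with `u` tending to a nonzero limit: `u` contributes the factor one
and the coordinate contributes `a ^ n`. -/
theorem IsMultiplier.tendsto_comp_div (h : IsMultiplier k p a) (hf : MerAt f p) {n : ℤ}
    (hn : ordAt f p = n) : Tendsto ((f ∘ k) / f) (𝓝[≠] p) (𝓝 (a ^ n)) := by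
  have hu : MerAt (f / coord p ^ n) p := hf.div ((merAt_coord p).zpow n)
  have h0 : ordAt (f / coord p ^ n) p = 0 := by
    rw [ordAt_div hf ((merAt_coord p).zpow n), hn, ordAt_coord_zpow]
    exact_mod_cast sub_self n
  obtain ⟨c, hc, hlim⟩ := (tendsto_ne_zero_iff_ordAt_eq_zero hu).2 h0
  have h1 := ((hlim.comp h.tendsto_self).div hlim hc).mul (h.tendsto.zpow₀ n (.inl h.ne_zero))
  rw [div_self hc, one_mul] at h1
  refine h1.congr' ?_
  have hf0 := (ordAt_ne_top_iff hf).1 (by rw [hn]; exact WithTop.coe_ne_top)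
  filter_upwards [coord_eventually_ne_zero p, hf0,
    h.tendsto_self.eventually (coord_eventually_ne_zero p)] with y hy hfy hky
  have e1 : coord p y ^ n ≠ 0 := zpow_ne_zero n hy
  have e2 : coord p (k y) ^ n ≠ 0 := zpow_ne_zero n hky
  simp only [Function.comp_apply, Pi.div_apply, Pi.pow_apply, div_zpow]
  field_simp

theorem IsMultiplier.lt_ordAt (h : IsMultiplier k p a) (hk : k ∈ biholAut X) (hf : MerAt f p)
    {n : ℤ} (hn : ordAt f p = n) : (n : WithTop ℤ) < ordAt (f ∘ k - (a ^ n) • f) p := by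
  have hfk : MerAt (f ∘ k) p := MerAt.comp_bihol hk (by rwa [h.map_eq])
  obtain ⟨c, -, hlim, hlt⟩ := exists_ordAt_sub_smul_lt hfk hf
    (by rw [ordAt_comp_bihol hk, h.map_eq]) (by rw [hn]; exact WithTop.coe_ne_top)
  rw [tendsto_nhds_unique hlim (h.tendsto_comp_div hf hn), hn] at hlt
  exact hlt

end Automorphisms

/-- The difference operator sends `X ^ (d + 1)` to `c (d + 1) X ^ d` plus lower terms, so all
monomials are reached by induction on the degree. -/
theorem exists_taylor_sub_eq {c : ℂ} (hc : c ≠ 0) (P : Polynomial ℂ) :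
    ∃ Q : Polynomial ℂ, Polynomial.taylor c Q - Q = P := by
  let Δ : Polynomial ℂ →ₗ[ℂ] Polynomial ℂ := (Polynomial.taylor c) - LinearMap.id
  have hX : ∀ d : ℕ, (Polynomial.X ^ d : Polynomial ℂ) ∈ LinearMap.range Δ := by
    intro d
    induction d using Nat.strong_induction_on with
    | _ d ih =>
      have h1 : Δ (Polynomial.X ^ (d + 1)) = ∑ i ∈ Finset.range d,
          (c ^ (d + 1 - i) * ((d + 1).choose i : ℂ)) • (Polynomial.X ^ i : Polynomial ℂ) +
          (c * (d + 1)) • (Polynomial.X ^ d : Polynomial ℂ) := by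
        simp only [Δ, LinearMap.sub_apply, LinearMap.id_apply, Polynomial.taylor_apply,
          Polynomial.X_pow_comp, add_pow, Finset.sum_range_succ]
        simp only [Polynomial.smul_eq_C_mul, Nat.sub_self, pow_zero, Nat.choose_self,
          Nat.choose_succ_self_right]
        have : d + 1 - d = 1 := by omega
        simp only [this, map_mul, map_pow, map_natCast, map_add, map_one, pow_one]
        push_cast
        have h2 : ∑ x ∈ Finset.range d, (Polynomial.X : Polynomial ℂ) ^ x *
            Polynomial.C c ^ (d + 1 - x) * ((d + 1).choose x : Polynomial ℂ) =
            ∑ x ∈ Finset.range d, Polynomial.C c ^ (d + 1 - x) *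
              ((d + 1).choose x : Polynomial ℂ) * (Polynomial.X : Polynomial ℂ) ^ x :=
          Finset.sum_congr rfl fun i _ => by ring
        rw [h2]
        ring
      have h2 : (c * (d + 1)) • (Polynomial.X ^ d : Polynomial ℂ) ∈ LinearMap.range Δ := by
        have h3 := Submodule.sub_mem _ (LinearMap.mem_range_self Δ (Polynomial.X ^ (d + 1)))
          (Submodule.sum_mem _ (t := Finset.range d)
            (f := fun i => (c ^ (d + 1 - i) * ((d + 1).choose i : ℂ)) •
              (Polynomial.X ^ i : Polynomial ℂ)) fun i hi =>
            Submodule.smul_mem _ _ (ih i (Finset.mem_range.1 hi)))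
        rw [h1, add_sub_cancel_left] at h3
        exact h3
      have h4 : c * ((d : ℂ) + 1) ≠ 0 := mul_ne_zero hc (by exact_mod_cast Nat.succ_ne_zero d)
      exact (Submodule.smul_mem_iff _ h4).1 h2
  have hP : P ∈ LinearMap.range Δ := by
    induction P using Polynomial.induction_on' with
    | add P Q hP hQ => exact Submodule.add_mem _ hP hQ
    | monomial n a =>
      rw [← Polynomial.C_mul_X_pow_eq_monomial, ← Polynomial.smul_eq_C_mul]
      exact Submodule.smul_mem _ _ (hX n)
  obtain ⟨Q, hQ⟩ := hP
  exact ⟨Q, hQ⟩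

/-! ### Automorphisms with a fixed point have finite order -/

section FixedPoint

variable {X : Type*} [TopologicalSpace X] [T2Space X] [CompactSpace X] [ConnectedSpace X]
  [ChartedSpace ℂ X] [IsManifold 𝓘(ℂ) ω X]

/-- `w` is meromorphic with at most a pole of order `m` at `p` and no other poles. -/
structure PoleLE (w : X → ℂ) (p : X) (m : ℕ) : Prop where
  mer : Mer w
  nonneg : ∀ x, x ≠ p → 0 ≤ ordAt w x
  le : ((-(m : ℤ) : ℤ) : WithTop ℤ) ≤ ordAt w p

variable {g : ℕ} {k : X ≃ₜ X} {p : X} {a : ℂ} {f w v : X → ℂ} {m n : ℕ}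

theorem HasPole.poleLE (h : HasPole f p n) : PoleLE f p n := ⟨h.mer, h.nonneg, h.ord_eq.ge⟩

theorem PoleLE.sub (h : PoleLE w p m) (h' : PoleLE v p m) : PoleLE (w - v) p m :=
  ⟨h.mer.sub h'.mer, fun x hx => le_ordAt_sub (h.mer x) (h'.mer x) (h.nonneg x hx) (h'.nonneg x hx),
    le_ordAt_sub (h.mer p) (h'.mer p) h.le h'.le⟩

theorem PoleLE.add (h : PoleLE w p m) (h' : PoleLE v p m) : PoleLE (w + v) p m :=
  ⟨h.mer.add h'.mer, fun x hx => le_ordAt_add (h.mer x) (h'.mer x) (h.nonneg x hx) (h'.nonneg x hx),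
    le_ordAt_add (h.mer p) (h'.mer p) h.le h'.le⟩

theorem PoleLE.smul (h : PoleLE w p m) (c : ℂ) : PoleLE (c • w) p m :=
  ⟨h.mer.smul c, fun x hx => le_ordAt_smul (h.mer x) (h.nonneg x hx), le_ordAt_smul (h.mer p) h.le⟩

theorem PoleLE.mono (h : PoleLE w p m) (hmn : m ≤ n) : PoleLE w p n :=
  ⟨h.mer, h.nonneg, le_trans (WithTop.coe_le_coe.2 (by omega)) h.le⟩

theorem PoleLE.comp (hk : k ∈ biholAut X) (hp : k p = p) (h : PoleLE w p m) :
    PoleLE (w ∘ k) p m := by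
  refine ⟨h.mer.comp_bihol hk, fun x hx => ?_, ?_⟩
  · rw [ordAt_comp_bihol hk]
    exact h.nonneg _ fun h' => hx (k.injective (h'.trans hp.symm))
  · rw [ordAt_comp_bihol hk, hp]; exact h.le

theorem poleLE_const (c : ℂ) (p : X) (m : ℕ) : PoleLE (fun _ => c) p m :=
  ⟨mer_const c, fun _ _ => (holAt_const c).ordAt_nonneg,
    le_trans (WithTop.coe_le_coe.2 (by omega : -(m : ℤ) ≤ 0)) (holAt_const c).ordAt_nonneg⟩

theorem PoleLE.eq_const (h : PoleLE w p 0) : ∃ c : ℂ, ∀ x, w =ᶠ[𝓝[≠] x] fun _ => c :=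
  exists_eventuallyEq_const_of_ordAt_nonneg h.mer fun x => by
    by_cases hx : x = p
    · rw [hx]; simpa using h.le
    · exact h.nonneg x hx

theorem PoleLE.pred (h : PoleLE w p (m + 1))
    (hlt : ((-((m + 1 : ℕ) : ℤ) : ℤ) : WithTop ℤ) < ordAt w p) :
    PoleLE w p m := by
  refine ⟨h.mer, h.nonneg, ?_⟩
  cases h5 : ordAt w p with
  | top => exact le_top
  | coe l =>
    rw [h5] at hlt
    have := WithTop.coe_lt_coe.1 hlt
    exact WithTop.coe_le_coe.2 (by push_cast at this; omega)

theorem PoleLE.cases (h : PoleLE w p (m + 1)) : PoleLE w p m ∨ HasPole w p (m + 1) := by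
  rcases h.le.lt_or_eq with hlt | heq
  · exact .inl (h.pred hlt)
  · exact .inr ⟨h.mer, h.nonneg, heq.symm⟩

/-- Composition with `k` multiplies the leading term at `p` by `a ^ (-(m + 1))`; subtracting this
multiple lowers the pole order. -/
theorem HasPole.poleLE_comp_sub (hk : k ∈ biholAut X) (ha : IsMultiplier k p a)
    (h : HasPole w p (m + 1)) :
    PoleLE (w ∘ k - (a ^ (-((m + 1 : ℕ) : ℤ))) • w) p m :=
  ((h.poleLE.comp hk ha.map_eq).sub (h.poleLE.smul _)).pred (ha.lt_ordAt hk (h.mer p) h.ord_eq)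

/-- In the filtration by pole order, composition with `k` is triangular with diagonal entries `a ^
(-i)`. For `i < m` these differ from `a ^ (-m)` because `a ^ (m - i) ≠ 1`, so the equation is solved
from the top order downwards. -/
theorem exists_solution (hk : k ∈ biholAut X) (ha : IsMultiplier k p a)
    (hm : ∀ j, 1 ≤ j → j ≤ m → a ^ j ≠ 1) {j : ℕ} (hj : j < m) :
    ∀ w, PoleLE w p j → ∃ w', PoleLE w' p j ∧
      w' ∘ k - (a ^ (-(m : ℤ))) • w' =ᶠ[𝓝[≠] p] w := by
  have hne : ∀ i : ℕ, i < m → a ^ (-(i : ℤ)) - a ^ (-(m : ℤ)) ≠ 0 := by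
    intro i hi h
    refine hm (m - i) (by omega) (by omega) ?_
    rw [sub_eq_zero, zpow_neg, zpow_neg, inv_inj, zpow_natCast, zpow_natCast] at h
    have h1 : a ^ m = a ^ i * a ^ (m - i) := by rw [← pow_add]; congr 1; omega
    rw [h1] at h
    exact (mul_eq_left₀ (pow_ne_zero i ha.ne_zero)).1 h.symm
  induction j with
  | zero =>
    intro w hw
    obtain ⟨c, hc⟩ := hw.eq_const
    have h0 := hne 0 hj
    simp only [Nat.cast_zero, neg_zero, zpow_zero] at h0
    refine ⟨fun _ => c / (1 - a ^ (-(m : ℤ))), poleLE_const _ _ _, ?_⟩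
    filter_upwards [hc p] with y hy
    simp only [Pi.sub_apply, Function.comp_apply, Pi.smul_apply, smul_eq_mul, hy]
    field_simp
  | succ j ih =>
    intro w hw
    rcases hw.cases with hw' | hw'
    · obtain ⟨w', h1, h2⟩ := ih (by omega) w hw'
      exact ⟨w', h1.mono (by omega), h2⟩
    · have h0 := hne (j + 1) hj
      set b := a ^ (-((j + 1 : ℕ) : ℤ)) - a ^ (-(m : ℤ)) with hb
      obtain ⟨w', h1, h2⟩ := ih (by omega) _ ((hw'.poleLE_comp_sub hk ha).smul (-b⁻¹))
      refine ⟨b⁻¹ • w + w', (hw.smul _).add (h1.mono (by omega)), ?_⟩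
      filter_upwards [h2] with y hy
      simp only [Pi.sub_apply, Function.comp_apply, Pi.smul_apply, smul_eq_mul,
        Pi.add_apply] at hy ⊢
      have e : a ^ (-((j + 1 : ℕ) : ℤ)) = b + a ^ (-(m : ℤ)) := by rw [hb]; ring
      rw [e] at hy
      have e2 : b⁻¹ * b = 1 := inv_mul_cancel₀ h0
      linear_combination hy + w y * e2

/-- The defect `f ∘ k - a ^ (-m) • f` has a pole of smaller order, where the same operator can be
inverted; subtracting the solution does not affect the leading term. -/
theorem exists_eigenfunction (hk : k ∈ biholAut X) (ha : IsMultiplier k p a) (hm0 : 1 ≤ m)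
    (hm : ∀ j, 1 ≤ j → j ≤ m → a ^ j ≠ 1) (hf : HasPole f p m) :
    ∃ F, HasPole F p m ∧ F ∘ k =ᶠ[𝓝[≠] p] (a ^ (-(m : ℤ))) • F := by
  obtain ⟨m, rfl⟩ : ∃ n, m = n + 1 := ⟨m - 1, by omega⟩
  obtain ⟨w, hw, hw'⟩ := exists_solution hk ha hm (Nat.lt_succ_self m) _ (hf.poleLE_comp_sub hk ha)
  refine ⟨f - w, ⟨hf.mer.sub hw.mer, fun x hx => le_ordAt_sub (hf.mer x) (hw.mer x)
    (hf.nonneg x hx) (hw.nonneg x hx), ?_⟩, ?_⟩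
  · rw [sub_eq_add_neg, ordAt_add_eq_left (hw.mer p).neg, hf.ord_eq]
    rw [hf.ord_eq, ordAt_neg]
    exact lt_of_lt_of_le (WithTop.coe_lt_coe.2 (by push_cast; omega)) hw.le
  · filter_upwards [hw'] with y hy
    simp only [Pi.sub_apply, Function.comp_apply, Pi.smul_apply, smul_eq_mul] at hy ⊢
    linear_combination -hy

/-- On a surface of positive genus, the derivative of an automorphism at a fixed point is a root of
unity of bounded order. -/
theorem exists_multiplier_pow_eq_one (hg : HasGenus X g) (hg1 : 1 ≤ g) (hk : k ∈ biholAut X)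
    (ha : IsMultiplier k p a) : ∃ j, 1 ≤ j ∧ j ≤ (2 * g + 1) * (2 * g + 2) ∧ a ^ j = 1 := by
  obtain ⟨n, hn, hn', ⟨f, hf⟩, ⟨F, hF⟩⟩ := exists_consecutive_hasPole hg p
  have hJ : n * (n + 1) ≤ (2 * g + 1) * (2 * g + 2) := Nat.mul_le_mul hn' (by omega)
  by_contra hcon
  have hm : ∀ j, 1 ≤ j → j ≤ n * (n + 1) → a ^ j ≠ 1 := fun j h1 h2 h3 =>
    hcon ⟨j, h1, h2.trans hJ, h3⟩
  obtain ⟨f, hf, hfk⟩ := exists_eigenfunction hk ha hn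
    (fun j h1 h2 => hm j h1 (h2.trans (Nat.le_mul_of_pos_right _ (by omega)))) hf
  obtain ⟨F, hF, hFk⟩ := exists_eigenfunction hk ha (by omega : 1 ≤ n + 1)
    (fun j h1 h2 => hm j h1 (h2.trans (Nat.le_mul_of_pos_left _ (by omega)))) hF
  have e1 := hF.ordAt_pow n
  have e2 := hf.ordAt_pow (n + 1)
  rw [mul_comm] at e2
  obtain ⟨c, hc, -, hlt⟩ := exists_ordAt_sub_smul_lt ((hF.mer.pow n) p) ((hf.mer.pow (n + 1)) p)
    (e1.trans e2.symm) (by rw [e2]; exact WithTop.coe_ne_top)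
  -- Both powers have a pole of order `n (n + 1)` and eigenvalue `a ^ (-n (n + 1))`; `D` keeps the
  -- eigenvalue but loses the leading term.
  set D := F ^ n - c • f ^ (n + 1) with hD
  have hDm : Mer D := (hF.mer.pow n).sub ((hf.mer.pow _).smul c)
  have hDk : D ∘ k =ᶠ[𝓝[≠] p] (a ^ (-((n * (n + 1) : ℕ) : ℤ))) • D := by
    filter_upwards [hfk, hFk] with y h1 h2
    simp only [Function.comp_apply, Pi.smul_apply, smul_eq_mul] at h1 h2
    simp only [hD, Function.comp_apply, Pi.sub_apply, Pi.pow_apply, Pi.smul_apply, smul_eq_mul, h1,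
      h2, mul_pow]
    have z1 : (a ^ (-((n + 1 : ℕ) : ℤ))) ^ n = a ^ (-((n * (n + 1) : ℕ) : ℤ)) := by
      rw [← zpow_natCast, ← zpow_mul]; congr 1; push_cast; ring
    have z2 : (a ^ (-(n : ℤ))) ^ (n + 1) = a ^ (-((n * (n + 1) : ℕ) : ℤ)) := by
      rw [← zpow_natCast, ← zpow_mul]; congr 1; push_cast; ring
    rw [z1, z2]
    ring
  -- If `D` had finite order `l` at `p`, its eigenvalue would be `a ^ l`. Then `a ^ (l + n (n + 1))
  -- = 1` with exponent between `1` and `n (n + 1)`, because `l` exceeds `-n (n + 1)` and is not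
  -- positive.
  have hDtop : ordAt D p = ⊤ := by
    by_contra htop
    obtain ⟨l, hl⟩ := WithTop.ne_top_iff_exists.1 htop
    have hl1 : -((n * (n + 1) : ℕ) : ℤ) < l := by
      rw [← hl, e2] at hlt; exact WithTop.coe_lt_coe.1 hlt
    have hnn : ∀ x, x ≠ p → 0 ≤ ordAt D x := fun x hx =>
      le_ordAt_sub ((hF.mer.pow n) x) (((hf.mer.pow _).smul c) x)
        (ordAt_pow_nonneg (hF.mer x) (hF.nonneg x hx) n)
        (le_ordAt_smul ((hf.mer.pow _) x) (ordAt_pow_nonneg (hf.mer x) (hf.nonneg x hx) _))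
    have hl2 : l ≤ 0 := by
      by_contra hpos
      push Not at hpos
      obtain ⟨b, hb⟩ := exists_eventuallyEq_const_of_ordAt_nonneg hDm fun x => by
        by_cases hx : x = p
        · rw [hx, ← hl]; exact_mod_cast hpos.le
        · exact hnn x hx
      rw [ordAt_congr (hb p)] at hl
      rcases eq_or_ne b 0 with rfl | h0
      · rw [(ordAt_eq_top_iff (f := fun _ : X => (0 : ℂ))).2 (by simp)] at hl
        exact WithTop.coe_ne_top hl
      · rw [ordAt_const h0] at hl
        have : l = 0 := by exact_mod_cast hl
        omega
    have h1 := ha.tendsto_comp_div (hDm p) hl.symm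
    have h2 : Tendsto ((D ∘ k) / D) (𝓝[≠] p) (𝓝 (a ^ (-((n * (n + 1) : ℕ) : ℤ)))) := by
      refine tendsto_const_nhds.congr' ?_
      filter_upwards [hDk, (ordAt_ne_top_iff (hDm p)).1 htop] with y hy hy0
      simp only [Pi.smul_apply, smul_eq_mul] at hy
      simp only [Pi.div_apply, hy]
      field_simp
    have h3 := tendsto_nhds_unique h1 h2
    refine hm (l + (n * (n + 1) : ℕ)).toNat (by omega) (by omega) ?_
    rw [← zpow_natCast, Int.toNat_of_nonneg (by omega), zpow_add₀ ha.ne_zero, h3,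
      ← zpow_add₀ ha.ne_zero]
    simp
  have hfn : ∀ x, ∀ᶠ y in 𝓝[≠] x, f y ≠ 0 := fun x => (ordAt_ne_top_iff (hf.mer x)).1
    (hf.mer.ordAt_ne_top (x := p) (by rw [hf.ord_eq]; exact WithTop.coe_ne_top) x)
  have hu : Mer (F / f) := hF.mer.div hf.mer
  -- Now `F ^ n = c f ^ (n + 1)`, so `(F / f) ^ n = c f` has no pole away from `p`, while at `p` the
  -- orders `n + 1` and `n` leave a simple pole.
  have hpole : HasPole (F / f) p 1 := by
    refine ⟨hu, fun x hx => ?_, ?_⟩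
    · have h1 : (F / f) ^ n =ᶠ[𝓝[≠] x] c • f := by
        filter_upwards [ordAt_eq_top_iff.1 (hDm.ordAt_eq_top hDtop x), hfn x] with y hy hy0
        simp only [hD, Pi.sub_apply, Pi.pow_apply, Pi.smul_apply, smul_eq_mul] at hy
        simp only [Pi.pow_apply, Pi.div_apply, Pi.smul_apply, smul_eq_mul, div_pow]
        rw [div_eq_iff (pow_ne_zero _ hy0)]
        linear_combination hy
      have h2 := ordAt_congr h1
      rw [ordAt_pow (hu x), ordAt_smul hc (hf.mer x)] at h2
      have h3 := hf.nonneg x hx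
      rw [← h2] at h3
      cases h4 : ordAt (F / f) x with
      | top => exact le_top
      | coe l =>
        rw [h4, ← WithTop.coe_natCast, ← WithTop.coe_mul] at h3
        have h3 : 0 ≤ (n : ℤ) * l := by exact_mod_cast h3
        have : 0 ≤ l := by
          by_contra hneg
          nlinarith
        exact_mod_cast this
    · rw [ordAt_div (hF.mer p) (hf.mer p), hF.ord_eq, hf.ord_eq]
      have : (-((n + 1 : ℕ) : ℤ)) - (-(n : ℤ)) = -((1 : ℕ) : ℤ) := by push_cast; ring
      exact_mod_cast this
  have := hpole.genus_eq_zero hg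
  omega

end FixedPoint

/-! ### Automorphisms with derivative one at a fixed point -/

section Unipotent

variable {X : Type*} [TopologicalSpace X] [T2Space X] [CompactSpace X] [ConnectedSpace X]
  [ChartedSpace ℂ X] [IsManifold 𝓘(ℂ) ω X]
variable {g : ℕ} {k : X ≃ₜ X} {p : X} {f w u : X → ℂ} {m n : ℕ}

theorem HolAt.eq_of_eventuallyEq {x : X} (hu : HolAt u x) (hw : HolAt w x)
    (h : u =ᶠ[𝓝[≠] x] w) : u x = w x :=
  tendsto_nhds_unique (hu.tendsto.congr' h) hw.tendsto

theorem pow_apply_ne (hp : k p = p) {x : X} (hx : x ≠ p) (i : ℕ) : (k ^ i) x ≠ p := by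
  induction i with
  | zero => simpa using hx
  | succ i ih =>
    rw [pow_succ', Homeomorph.mul_apply]
    exact fun h => ih (k.injective (h.trans hp.symm))

/-- A function that is invariant under an automorphism with an infinite orbit is constant. -/
theorem eq_const_of_infinite_orbit (hp : k p = p) (hu : Mer u)
    (hinv : ∀ x, x ≠ p → u (k x) = u x) {x₀ : X} (hx₀ : x₀ ≠ p)
    (horb : Function.Injective fun i : ℕ => (k ^ i) x₀) (x : X) :
    u =ᶠ[𝓝[≠] x] fun _ => u x₀ := by
  have hval : ∀ i : ℕ, u ((k ^ i) x₀) = u x₀ := by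
    intro i
    induction i with
    | zero => simp
    | succ i ih => rw [pow_succ', Homeomorph.mul_apply, hinv _ (pow_apply_ne hp hx₀ i), ih]
  by_contra hne
  have hm : Mer (u - fun _ => u x₀) := hu.sub (mer_const _)
  have h1 : ordAt (u - fun _ => u x₀) x ≠ ⊤ := fun h =>
    hne ((ordAt_eq_top_iff.1 h).mono fun y hy => sub_eq_zero.1 hy)
  have h2 := finite_of_eventually_nhdsNE fun y =>
    (ordAt_ne_top_iff (hm y)).1 (hm.ordAt_ne_top h1 y)
  exact (infinite_range_of_injective horb) (h2.subset (by
    rintro _ ⟨i, rfl⟩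
    simp [hval i]))

/-- Powers of `f` have distinct orders at `p`, so no cancellation of leading terms occurs and the
pole order of a polynomial in `f` is a multiple of `n`. -/
theorem HasPole.dvd_of_eval (hf : HasPole f p n) (hn : 1 ≤ n) (hw : HasPole w p m)
    {P : Polynomial ℂ} (hP : w =ᶠ[𝓝[≠] p] fun y => P.eval (f y)) : n ∣ m := by
  have hP0 : P ≠ 0 := by
    rintro rfl
    have h1 : ordAt w p = ⊤ := ordAt_eq_top_iff.2 (hP.mono fun y hy => by simpa using hy)
    rw [hw.ord_eq] at h1
    exact WithTop.coe_ne_top h1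
  have h2 : (fun y => P.eval (f y)) = ∑ i : Fin (P.natDegree + 1), P.coeff i • f ^ (i : ℕ) := by
    ext y
    rw [Polynomial.eval_eq_sum_range, Finset.sum_range]
    simp
  obtain ⟨i, -, hi⟩ := exists_ordAt_sum_smul (x := p)
    (F := fun i : Fin (P.natDegree + 1) => f ^ (i : ℕ))
    (γ := fun i => -((i * n : ℕ) : ℤ)) (fun i j hij => Fin.ext (by
      simp only [neg_inj, Nat.cast_inj] at hij
      exact Nat.eq_of_mul_eq_mul_right (by omega) hij)) (fun i => (hf.mer.pow _) p)
    (fun i => hf.ordAt_pow i) (a := fun i => P.coeff i) (fun h => by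
      have := congrFun h (Fin.last _)
      simp [hP0] at this)
  rw [← h2, ← ordAt_congr hP, hw.ord_eq] at hi
  have := WithTop.coe_injective hi
  exact ⟨i, by rw [mul_comm]; simpa only [neg_inj, Nat.cast_inj] using this⟩

theorem IsMultiplier.poleLE_comp_sub (hk : k ∈ biholAut X) (ha : IsMultiplier k p 1)
    (h : HasPole w p (m + 1)) : PoleLE (w ∘ k - w) p m := by
  simpa using h.poleLE_comp_sub hk ha

theorem poleLE_induction {C : (X → ℂ) → Prop} (h0 : ∀ w, PoleLE w p 0 → C w)
    (hs : ∀ m w, (∀ v, PoleLE v p m → C v) → HasPole w p (m + 1) → C w) :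
    ∀ m w, PoleLE w p m → C w := by
  intro m
  induction m with
  | zero => exact h0
  | succ m ih =>
    intro w hw
    rcases hw.cases with h | h
    · exact ih w h
    · exact hs m w ih h

/-- On a surface of positive genus, an automorphism with a fixed point where its derivative is one
is the identity. -/
theorem eq_one_of_isMultiplier_one (hg : HasGenus X g) (hg1 : 1 ≤ g) (hk : k ∈ biholAut X)
    (ha : IsMultiplier k p 1) : k = 1 := by
  classical
  have hkp := ha.map_eq
  have hkne : ∀ x, x ≠ p → k x ≠ p := fun x hx h => hx (k.injective (h.trans hkp.symm))
  have hex : ∃ n, 1 ≤ n ∧ ∃ f, HasPole f p n := by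
    obtain ⟨n, f, h1, h2⟩ := exists_hasPole_pos hg p
    exact ⟨n, h1, f, h2⟩
  obtain ⟨hn1, f₁, hf₁⟩ := Nat.find_spec hex
  set n := Nat.find hex with hn
  obtain ⟨f, hf, hfhol⟩ := hf₁.exists_holAt
  have hn2 : n ≠ 1 := fun h => by
    have := (h ▸ hf : HasPole f p 1).genus_eq_zero hg
    omega
  have hmin : ∀ m w, m < n → PoleLE w p m → PoleLE w p 0 := by
    intro m
    induction m with
    | zero => exact fun w _ hw => hw
    | succ m ih =>
      intro w hm hw
      rcases hw.cases with h | h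
      · exact ih w (by omega) h
      · exact absurd ⟨by omega, w, h⟩ (Nat.find_min hex hm)
  -- The function `f` has the least positive pole order `n`, and `f ∘ k - f` has a smaller one, so
  -- it is constant. The cases `c = 0` and `c ≠ 0` are treated separately.
  obtain ⟨c, hc⟩ : ∃ c : ℂ, ∀ x, f ∘ k - f =ᶠ[𝓝[≠] x] fun _ => c := by
    have h1 : HasPole f p ((n - 1) + 1) := by rwa [Nat.sub_add_cancel hn1]
    exact (hmin (n - 1) _ (by omega) (ha.poleLE_comp_sub hk h1)).eq_const
  have hfk : ∀ x, x ≠ p → f (k x) = f x + c := fun x hx => by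
    have := HolAt.eq_of_eventuallyEq (((hfhol _ (hkne x hx)).comp_bihol hk).sub (hfhol x hx))
      (holAt_const c) (hc x)
    simp only [Pi.sub_apply, Function.comp_apply] at this
    linear_combination this
  have hnc : ¬ ∃ c : ℂ, f =ᶠ[𝓝[≠] p] fun _ => c := by
    rintro ⟨c, hc⟩
    have := hf.ordAt_sub_const hn1 c
    rw [ordAt_eq_top_iff.2 (hc.mono fun y hy => by simp [hy])] at this
    exact WithTop.coe_ne_top this.symm
  have hpne : ∀ x, ∀ᶠ y in 𝓝[≠] x, y ≠ p :=
    eventually_nhdsNE_of_finite (p := fun y => y ≠ p) (by simp)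
  obtain ⟨n', hn', -, ⟨F, hF⟩, ⟨G, hG⟩⟩ := exists_consecutive_hasPole hg p
  by_cases hc0 : c = 0
  · have hall : ∀ m w, PoleLE w p m → ∀ x, w ∘ k =ᶠ[𝓝[≠] x] w := by
      refine poleLE_induction (C := fun w => ∀ x, w ∘ k =ᶠ[𝓝[≠] x] w) (fun w hw x => ?_)
        fun m w ih hw x => ?_
      · obtain ⟨b, hb⟩ := hw.eq_const
        exact (eventuallyEq_comp k (hb (k x))).trans (hb x).symm
      · obtain ⟨W, hW, hwW⟩ := hw.mer.exists_holAt hw.nonneg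
        have hv := ih _ (ha.poleLE_comp_sub hk (hw.congr hwW))
        have hvhol : ∀ x, x ≠ p → HolAt (W ∘ k - W) x := fun x hx =>
          ((hW _ (hkne x hx)).comp_bihol hk).sub (hW x hx)
        have hvk : ∀ x, x ≠ p → (W ∘ k - W) (k x) = (W ∘ k - W) x := fun x hx =>
          HolAt.eq_of_eventuallyEq ((hvhol _ (hkne x hx)).comp_bihol hk) (hvhol x hx) (hv x)
        suffices hz : ∀ x, x ≠ p → (W ∘ k - W) x = 0 by
          filter_upwards [hpne x, hwW x, eventuallyEq_comp k (hwW (k x))] with y h1 h2 h3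
          rw [h2, h3]
          exact sub_eq_zero.1 (hz y h1)
        by_contra hcon
        push Not at hcon
        obtain ⟨x₀, hx₀, hvx₀⟩ := hcon
        have h1 : ∀ i : ℕ, (W ∘ k - W) ((k ^ i) x₀) = (W ∘ k - W) x₀ ∧
            W ((k ^ i) x₀) = W x₀ + i * (W ∘ k - W) x₀ := by
          intro i
          induction i with
          | zero => simp
          | succ i ih =>
            rw [pow_succ', Homeomorph.mul_apply, hvk _ (pow_apply_ne hkp hx₀ i)]
            refine ⟨ih.1, ?_⟩
            have := ih.1
            simp only [Pi.sub_apply, Function.comp_apply] at this ih ⊢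
            push_cast
            linear_combination this + ih.2
        have horb : Function.Injective fun i : ℕ => (k ^ i) x₀ := by
          intro i j hij
          have h2 := (h1 i).2
          simp only at hij
          rw [hij, (h1 j).2] at h2
          have h3 : (j : ℂ) = i := mul_right_cancel₀ hvx₀ (add_left_cancel h2)
          exact_mod_cast h3.symm
        exact hnc ⟨_, eq_const_of_infinite_orbit hkp hf.mer
          (fun x hx => by rw [hfk x hx, hc0, add_zero]) hx₀ horb p⟩
    -- The quotient of invariant functions with poles of orders `n'` and `n' + 1` is an invariant
    -- local coordinate at `p`.
    have ht : MerAt (F / G) p := (hF.mer p).div (hG.mer p)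
    refine eq_one_of_eventually hk (eventually_eq_of_comp_eq ht ?_ hkp ?_)
    · rw [ordAt_div (hF.mer p) (hG.mer p), hF.ord_eq, hG.ord_eq]
      have : (-(n' : ℤ)) - (-((n' + 1 : ℕ) : ℤ)) = 1 := by push_cast; ring
      exact_mod_cast this
    · filter_upwards [hall _ _ hF.poleLE p, hall _ _ hG.poleLE p] with y h1 h2
      simp only [Function.comp_apply] at h1 h2
      simp [h1, h2]
  · have hfi : ∀ x, x ≠ p → ∀ i : ℕ, f ((k ^ i) x) = f x + i * c := by
      intro x hx i
      induction i with
      | zero => simp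
      | succ i ih =>
        rw [pow_succ', Homeomorph.mul_apply, hfk _ (pow_apply_ne hkp hx i), ih]
        push_cast; ring
    have horb : ∀ x, x ≠ p → Function.Injective fun i : ℕ => (k ^ i) x := by
      intro x hx i j hij
      have h2 := hfi x hx i
      simp only at hij
      rw [hij, hfi x hx j] at h2
      have h3 : (j : ℂ) = i := mul_right_cancel₀ hc0 (add_left_cancel h2)
      exact_mod_cast h3.symm
    obtain ⟨x₀, hx₀⟩ : ∃ x₀, x₀ ≠ p := (hpne p).exists
    -- For `c ≠ 0` every orbit off `p` is infinite and `k` acts on `f` as translation by `c`. If `w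
    -- ∘ k - w` is a polynomial in `f`, a solution `Q` of the difference equation makes `w - Q (f)`
    -- invariant, hence constant.
    have hall : ∀ m w, PoleLE w p m →
        ∃ P : Polynomial ℂ, ∀ x, w =ᶠ[𝓝[≠] x] fun y => P.eval (f y) := by
      refine poleLE_induction (fun w hw => ?_) fun m w ih hw => ?_
      · obtain ⟨b, hb⟩ := hw.eq_const
        exact ⟨Polynomial.C b, fun x => by simpa using hb x⟩
      · obtain ⟨P, hP⟩ := ih _ (ha.poleLE_comp_sub hk hw)
        obtain ⟨Q, hQ⟩ := exists_taylor_sub_eq hc0 P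
        have hQm := mer_eval hf.mer Q
        have hm : Mer (w - fun y => Q.eval (f y)) := hw.mer.sub hQm
        obtain ⟨W, hW, hwW⟩ := hm.exists_holAt (p := p) fun x hx =>
          le_ordAt_sub (hw.mer x) (hQm x) (hw.nonneg x hx)
            ((tendsto_nhds_iff_ordAt_nonneg (hQm x)).1
              ⟨_, (Q.continuous.tendsto _).comp (hfhol x hx).tendsto⟩)
        have hinv : ∀ x, x ≠ p → W (k x) = W x := fun x hx => by
          refine HolAt.eq_of_eventuallyEq ((hW _ (hkne x hx)).comp_bihol hk) (hW x hx) ?_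
          refine (eventuallyEq_comp k (hwW (k x))).symm.trans (EventuallyEq.trans ?_ (hwW x))
          filter_upwards [hP x, hpne x] with y hy hyp
          have e := congrArg (Polynomial.eval (f y)) hQ
          rw [Polynomial.eval_sub, Polynomial.taylor_eval] at e
          simp only [Pi.sub_apply, Function.comp_apply, hfk y hyp] at hy ⊢
          linear_combination hy - e
        have hconst := eq_const_of_infinite_orbit hkp (fun x => (hm x).congr (hwW x)) hinv hx₀
          (horb x₀ hx₀)
        refine ⟨Q + Polynomial.C (W x₀), fun x => ?_⟩
        filter_upwards [hwW x, hconst x] with y h1 h2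
        simp only [Pi.sub_apply] at h1
        simp only [Polynomial.eval_add, Polynomial.eval_C]
        linear_combination h1 + h2
    obtain ⟨P, hP⟩ := hall _ _ hF.poleLE
    obtain ⟨Q, hQ⟩ := hall _ _ hG.poleLE
    -- All pole orders at `p` are now multiples of `n`, among them two consecutive ones; but `n = 1`
    -- was excluded by the genus.
    have h1 := hf.dvd_of_eval hn1 hF (hP p)
    have h2 := hf.dvd_of_eval hn1 hG (hQ p)
    exact absurd (Nat.dvd_one.1 ((Nat.dvd_add_right h1).1 h2)) hn2

/-- On a surface of positive genus, the automorphisms with a fixed point have bounded order. -/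
theorem exists_pow_eq_one_of_fixed (hg : HasGenus X g) (hg1 : 1 ≤ g) (hk : k ∈ biholAut X)
    (hp : k p = p) : ∃ j, 1 ≤ j ∧ j ≤ (2 * g + 1) * (2 * g + 2) ∧ k ^ j = 1 := by
  obtain ⟨a, ha⟩ := exists_isMultiplier hk hp
  obtain ⟨j, h1, h2, h3⟩ := exists_multiplier_pow_eq_one hg hg1 hk ha
  exact ⟨j, h1, h2, eq_one_of_isMultiplier_one hg hg1 (pow_mem hk j) (h3 ▸ ha.pow j)⟩

end Unipotent

/-! ### Functionals on the first cohomology -/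

section Weil

variable {X : Type*} [TopologicalSpace X] [T2Space X] [CompactSpace X] [ConnectedSpace X]
  [ChartedSpace ℂ X] [IsManifold 𝓘(ℂ) ω X] {g : ℕ}

theorem Mer.finite_not_holAt {F : X → ℂ} (hF : Mer F) : {x | ¬ HolAt F x}.Finite :=
  finite_of_eventually_nhdsNE fun x => (hF x).eventually_holAt

/-- Multiplication of adeles by a meromorphic function. -/
def mulAdele (F : X → ℂ) (hF : Mer F) : adele X →ₗ[ℂ] adele X where
  toFun r := ⟨fun x => F * r.1 x, fun x => (hF x).mul (r.2.1 x),
    (hF.finite_not_holAt.union r.2.2).subset fun x hx => by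
      by_contra hcon
      simp only [mem_union, mem_ofPred_eq, not_or, not_not] at hcon
      exact hx (hcon.1.mul hcon.2)⟩
  map_add' r s := by ext; simp [mul_add]
  map_smul' c r := by ext; simp; ring

theorem mulAdele_apply {F : X → ℂ} (hF : Mer F) (r : adele X) (x : X) :
    (mulAdele F hF r).1 x = F * r.1 x := rfl

theorem adeleClass_eq_zero_of_nonneg {r : adele X} (h : ∀ x, 0 ≤ ordAt (r.1 x) x) :
    adeleClass r = 0 := by
  rw [adeleClass_eq_zero_iff]
  refine ⟨fun _ => 0, mer_const 0, fun x => ?_⟩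
  exact le_ordAt_sub (r.2.1 x) (merAt_const 0) (h x) (holAt_const 0).ordAt_nonneg

theorem adeleClass_congr {r s : adele X} (h : ∀ x, r.1 x =ᶠ[𝓝[≠] x] s.1 x) :
    adeleClass r = adeleClass s := by
  rw [← sub_eq_zero, ← map_sub]
  refine adeleClass_eq_zero_of_nonneg fun x => ?_
  rw [ordAt_eq_top_iff.2 ((h x).mono fun y hy => by
    simp only [AddSubgroupClass.coe_sub, Pi.sub_apply, hy, sub_self])]
  exact le_top

theorem adeleClass_mul_congr {F G : X → ℂ} (hF : Mer F) (hG : Mer G)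
    (h : ∀ x, F =ᶠ[𝓝[≠] x] G) (r : adele X) :
    adeleClass (mulAdele F hF r) = adeleClass (mulAdele G hG r) :=
  adeleClass_congr fun x => by
    filter_upwards [h x] with y hy
    simp [mulAdele_apply, hy]

theorem adeleClass_mulAdele_inv {F : X → ℂ} (hF : Mer F) {x₀ : X} (h0 : ordAt F x₀ ≠ ⊤)
    (r : adele X) : adeleClass (mulAdele F hF (mulAdele F⁻¹ hF.inv r)) = adeleClass r :=
  adeleClass_congr fun x => by
    filter_upwards [(ordAt_ne_top_iff (hF x)).1 (hF.ordAt_ne_top h0 x)] with y hy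
    simp only [mulAdele_apply, Pi.mul_apply, Pi.inv_apply]
    field_simp

/-- Multiplication by a nonzero meromorphic function is invertible on adeles up to discrete sets,
and every class is the class of an adele. -/
theorem eq_zero_of_adeleClass_mulAdele (hg : HasGenus X g) {l : Module.Dual ℂ (H1 X)} {F : X → ℂ}
    (hF : Mer F) {x₀ : X} (h0 : ordAt F x₀ ≠ ⊤) (h : ∀ r, l (adeleClass (mulAdele F hF r)) = 0) :
    l = 0 := by
  refine LinearMap.ext fun c => ?_
  obtain ⟨r, rfl⟩ := adeleClass_surjective hg c
  rw [← adeleClass_mulAdele_inv hF h0 r, h]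
  rfl

theorem exists_adele_basis (hg : HasGenus X g) : ∃ e : Fin g → adele X,
    ∀ r, ∃ a : Fin g → ℂ, adeleClass (r - ∑ i, a i • e i) = 0 := by
  have := hg.module_finite
  let b := Module.finBasisOfFinrankEq ℂ (H1 X) hg.finrank_eq
  choose e he using fun i => adeleClass_surjective hg (b i)
  refine ⟨e, fun r => ⟨fun i => b.repr (adeleClass r) i, ?_⟩⟩
  rw [map_sub, map_sum, sub_eq_zero]
  simp only [map_smul, he]
  exact (b.sum_repr _).symm

/-- A functional on adeles vanishes if it does so on adeles of class zero and on representatives of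
a basis. -/
theorem functional_eq_zero {e : Fin g → adele X}
    (he : ∀ r, ∃ a : Fin g → ℂ, adeleClass (r - ∑ i, a i • e i) = 0) {Θ : adele X →ₗ[ℂ] ℂ}
    (h0 : ∀ r, adeleClass r = 0 → Θ r = 0) (h1 : ∀ i, Θ (e i) = 0) (r : adele X) : Θ r = 0 := by
  obtain ⟨a, ha⟩ := he r
  have := h0 _ ha
  rwa [map_sub, map_sum, Finset.sum_eq_zero (fun i _ => by rw [map_smul, h1, smul_zero]),
    sub_zero] at this

/-- The functional `l` vanishes on simple poles at `q`. -/
def IsZeroOf (l : Module.Dual ℂ (H1 X)) (q : X) : Prop :=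
  ∀ u (hu : MerAt u q), ((-1 : ℤ) : WithTop ℤ) ≤ ordAt u q → l (adeleClass (single q u hu)) = 0

theorem adeleClass_single_eq_zero {q : X} {u : X → ℂ} (hu : MerAt u q) (h : 0 ≤ ordAt u q) :
    adeleClass (single q u hu) = 0 :=
  adeleClass_eq_zero_of_nonneg fun x => by
    by_cases hx : x = q
    · subst hx; rwa [single_self]
    · rw [single_of_ne hu hx]; exact (holAt_const 0).ordAt_nonneg

/-- Germs at `q` with at most a simple pole are, modulo germs of nonnegative order, multiples of any
one germ with an exact simple pole, so a single test germ suffices. -/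
theorem isZeroOf_of_single {l : Module.Dual ℂ (H1 X)} {q : X} {w : X → ℂ} (hw : MerAt w q)
    (ho : ordAt w q = ((-1 : ℤ) : WithTop ℤ)) (h : l (adeleClass (single q w hw)) = 0) :
    IsZeroOf l q := by
  intro u hu hou
  rcases hou.lt_or_eq with hlt | heq
  · have h0 : 0 ≤ ordAt u q := by
      cases h1 : ordAt u q with
      | top => exact le_top
      | coe m =>
        rw [h1] at hlt
        have := WithTop.coe_lt_coe.1 hlt
        exact_mod_cast (by omega : 0 ≤ m)
    rw [adeleClass_single_eq_zero hu h0, map_zero]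
  · obtain ⟨c, -, -, hlt⟩ := exists_ordAt_sub_smul_lt hu hw (heq.symm.trans ho.symm)
      (by rw [ho]; exact WithTop.coe_ne_top)
    have h0 : 0 ≤ ordAt (u - c • w) q := by
      rw [ho] at hlt
      cases h1 : ordAt (u - c • w) q with
      | top => exact le_top
      | coe m =>
        rw [h1] at hlt
        have := WithTop.coe_lt_coe.1 hlt
        exact_mod_cast (by omega : 0 ≤ m)
    have h2 : single q u hu = c • single q w hw + single q (u - c • w) (hu.sub (hw.smul c)) := by
      ext x y
      by_cases hx : x = q
      · subst hx
        simp [single_self]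
      · simp [single_of_ne _ hx]
    rw [h2, map_add, map_smul, adeleClass_single_eq_zero _ h0, add_zero, map_smul, h, smul_zero]

/-- At most `g` of the orders from `1` to `N` are gaps. -/
theorem exists_hasPole_family (hg : HasGenus X g) (p : X) (N : ℕ) :
    ∃ (B : Finset ℕ) (f : B → X → ℂ), N ≤ B.card + g ∧ (∀ n ∈ B, n ≤ N) ∧
      ∀ n : B, HasPole (f n) p n := by
  classical
  set B := (Finset.Icc 1 N).filter fun n => ∃ f, HasPole f p n with hB
  have hB' : ∀ n : B, ∃ f, HasPole f p n := fun n => (Finset.mem_filter.1 n.2).2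
  choose f hf using hB'
  refine ⟨B, f, ?_, fun n hn => (Finset.mem_Icc.1 (Finset.mem_filter.1 hn).1).2, hf⟩
  by_contra hcon
  set C := (Finset.Icc 1 N).filter fun n => ¬ ∃ f, HasPole f p n with hC
  have hsum : B.card + C.card = N := by
    rw [hB, hC, Finset.card_filter_add_card_filter_not]
    simp
  have hgC : g + 1 ≤ C.card := by omega
  obtain ⟨D, hDC, hD⟩ := Finset.exists_subset_card_eq hgC
  let γ := D.orderEmbOfFin hD
  have hγ : ∀ i, γ i ∈ C := fun i => hDC (D.orderEmbOfFin_mem hD i)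
  obtain ⟨i, F, hF⟩ := exists_hasPole hg p (γ := γ) γ.injective
    fun i => (Finset.mem_Icc.1 (Finset.mem_filter.1 (hγ i)).1).1
  exact (Finset.mem_filter.1 (hγ i)).2 ⟨F, hF⟩

end Weil

/-! ### Existence of zeros of a functional in genus at least two -/

section WeilZeros

variable {X : Type*} [TopologicalSpace X] [T2Space X] [CompactSpace X] [ConnectedSpace X]
  [ChartedSpace ℂ X] [IsManifold 𝓘(ℂ) ω X] {g : ℕ}

theorem mulAdele_sum {ι : Type*} [Fintype ι] {f : ι → X → ℂ} (hf : ∀ i, Mer (f i)) (a : ι → ℂ)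
    (hF : Mer (∑ i, a i • f i)) (r : adele X) :
    mulAdele (∑ i, a i • f i) hF r = ∑ i, a i • mulAdele (f i) (hf i) r := by
  ext x y
  simp [mulAdele_apply, AddSubmonoidClass.coe_finsetSum, Finset.sum_mul, mul_assoc]

theorem adeleClass_global {F f : X → ℂ} (hF : Mer F) (hf : Mer f) {r : adele X}
    (hr : ∀ x, r.1 x = f) : adeleClass (mulAdele F hF r) = 0 := by
  rw [adeleClass_eq_zero_iff]
  refine ⟨F * f, hF.mul hf, fun x => ?_⟩
  rw [mulAdele_apply, hr, sub_self]
  exact (holAt_const (0 : ℂ)).ordAt_nonneg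

/-- An adele of class zero is the sum of a global function and an adele of nonnegative order. -/
theorem exists_decomp {r : adele X} (h : adeleClass r = 0) :
    ∃ (f : X → ℂ) (s t : adele X), Mer f ∧ r = s + t ∧ (∀ x, s.1 x = f) ∧
      ∀ x, 0 ≤ ordAt (t.1 x) x := by
  obtain ⟨f, hf, hord⟩ := adeleClass_eq_zero_iff.1 h
  let s : adele X := ⟨fun _ => f, hf, hf.finite_not_holAt⟩
  refine ⟨f, s, r - s, hf, by abel, fun _ => rfl, fun x => ?_⟩
  simpa using hord x

/-- A functional without zeros spans the dual space of the first cohomology. -/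
theorem genus_le_one_of_no_zeros (hg : HasGenus X g) {l : Module.Dual ℂ (H1 X)} (hl : l ≠ 0)
    (hz : ∀ q, ¬ IsZeroOf l q) : g ≤ 1 := by
  have := hg.module_finite
  rw [← hg.finrank_eq, ← Subspace.dual_finrank_eq]
  refine finrank_le_one l fun μ => ?_
  obtain ⟨p⟩ := (inferInstance : Nonempty X)
  -- The pairs of coefficient vectors have dimension at least `2 (N - g) = 4 g + 2`, one more than
  -- the number `g + N = 4 g + 1` of conditions imposed below.
  set N := 3 * g + 1 with hN
  obtain ⟨B, f, hB, hBN, hf⟩ := exists_hasPole_family hg p N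
  obtain ⟨e, he⟩ := exists_adele_basis hg
  have hfm : ∀ i, Mer (f i) := fun i => (hf i).mer
  have hFm : ∀ a : B → ℂ, Mer (∑ i, a i • f i) := fun a => Mer.sum _ fun i _ => (hfm i).smul _
  have hFord : ∀ a : B → ℂ, a ≠ 0 → ordAt (∑ i, a i • f i) p ≠ ⊤ := fun a ha => by
    obtain ⟨i, -, hi⟩ := exists_ordAt_sum_smul (x := p) (F := f) (γ := fun i : B => -((i : ℕ) : ℤ))
      (fun i j hij => Subtype.ext (by simpa using hij)) (fun i => hfm i p)
      (fun i => (hf i).ord_eq) ha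
    rw [hi]; exact WithTop.coe_ne_top
  have hFnn : ∀ (a : B → ℂ) x, x ≠ p → 0 ≤ ordAt (∑ i, a i • f i) x := fun a x hx =>
    le_ordAt_sum _ (fun i _ => (hfm i x).smul _) fun i _ =>
      le_ordAt_smul (hfm i x) ((hf i).nonneg x hx)
  have hFp : ∀ a : B → ℂ, ((-(N : ℤ) : ℤ) : WithTop ℤ) ≤ ordAt (∑ i, a i • f i) p := fun a =>
    le_ordAt_sum _ (fun i _ => (hfm i p).smul _) fun i _ =>
      le_ordAt_smul (hfm i p) (by
        rw [(hf i).ord_eq]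
        have := hBN i i.2
        exact WithTop.coe_le_coe.2 (by omega))
  have hcm : ∀ i : ℕ, MerAt (coord p ^ i) p := fun i => (merAt_coord p).pow i
  -- Test adeles that suffice to show that `l (F r) + μ (G r)` vanishes for all `r`: representatives
  -- of a basis, and the germs `coord p ^ i` with `i < N`, since beyond order `N` at `p` the factors
  -- `F`, `G` create no pole.
  let E : Fin g ⊕ Fin N → adele X := Sum.elim e fun i => single p (coord p ^ (i : ℕ)) (hcm i)
  let Ψ : (B ⊕ B → ℂ) →ₗ[ℂ] (Fin g ⊕ Fin N → ℂ) :=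
    { toFun := fun a j => ∑ i, a (.inl i) * l (adeleClass (mulAdele (f i) (hfm i) (E j))) +
        ∑ i, a (.inr i) * μ (adeleClass (mulAdele (f i) (hfm i) (E j)))
      map_add' := fun a b => by
        ext j
        simp only [Pi.add_apply, add_mul, Finset.sum_add_distrib]
        ring
      map_smul' := fun c a => by
        ext j
        simp only [Pi.smul_apply, smul_eq_mul, mul_assoc, ← Finset.mul_sum, RingHom.id_apply]
        ring }
  obtain ⟨ab, hab, hab0⟩ := (Submodule.ne_bot_iff _).1 (LinearMap.ker_ne_bot_of_finrank_lt
    (f := Ψ) (by simp; omega))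
  set a : B → ℂ := fun i => ab (.inl i) with ha
  set b : B → ℂ := fun i => ab (.inr i) with hb
  let Θ : adele X →ₗ[ℂ] ℂ := l ∘ₗ adeleClass ∘ₗ mulAdele _ (hFm a) +
    μ ∘ₗ adeleClass ∘ₗ mulAdele _ (hFm b)
  have hΘ : ∀ r, Θ r = l (adeleClass (mulAdele _ (hFm a) r)) +
    μ (adeleClass (mulAdele _ (hFm b) r)) := fun r => rfl
  have hΘE : ∀ j, Θ (E j) = 0 := fun j => by
    have h1 := congrFun (LinearMap.mem_ker.1 hab) j
    rw [hΘ, mulAdele_sum hfm, mulAdele_sum hfm]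
    simp only [map_sum, map_smul, smul_eq_mul]
    exact h1
  -- Descending induction on the order of vanishing at `p`, from `N` to `0`: each step removes the
  -- leading term by a test germ on which `Θ` vanishes.
  have hΘhigh : ∀ j : ℕ, j ≤ N → ∀ s : adele X, (∀ x, x ≠ p → 0 ≤ ordAt (s.1 x) x) →
      (((N - j : ℕ) : ℤ) : WithTop ℤ) ≤ ordAt (s.1 p) p → Θ s = 0 := by
    intro j
    induction j with
    | zero =>
      intro _ s h1 h2
      have key : ∀ a : B → ℂ, adeleClass (mulAdele _ (hFm a) s) = 0 := fun a => by
        refine adeleClass_eq_zero_of_nonneg fun x => ?_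
        rw [mulAdele_apply, ordAt_mul (hFm a x) (s.2.1 x)]
        by_cases hx : x = p
        · subst hx
          refine le_trans ?_ (add_le_add (hFp a) h2)
          exact_mod_cast (by omega : (0 : ℤ) ≤ -(N : ℤ) + ((N - 0 : ℕ) : ℤ))
        · exact add_nonneg (hFnn a x hx) (h1 x hx)
      rw [hΘ, key, key, map_zero, map_zero, add_zero]
    | succ j ih =>
      intro hj s h1 h2
      rcases h2.lt_or_eq with hlt | heq
      · refine ih (by omega) s h1 ?_
        cases h3 : ordAt (s.1 p) p with
        | top => exact le_top
        | coe m =>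
          rw [h3] at hlt
          have := WithTop.coe_lt_coe.1 hlt
          exact WithTop.coe_le_coe.2 (by omega)
      · have hco : ordAt (coord p ^ (N - (j + 1))) p = (((N - (j + 1) : ℕ) : ℤ) : WithTop ℤ) := by
          rw [ordAt_pow (merAt_coord p), ordAt_coord, mul_one]; rfl
        obtain ⟨c, -, -, hlt⟩ := exists_ordAt_sub_smul_lt (s.2.1 p) (hcm (N - (j + 1)))
          (heq.symm.trans hco.symm) (by rw [hco]; exact WithTop.coe_ne_top)
        have hs : Θ (s - c • single p _ (hcm (N - (j + 1)))) = 0 := by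
          refine ih (by omega) _ (fun x hx => ?_) ?_
          · simpa [single_of_ne _ hx] using h1 x hx
          · rw [hco] at hlt
            simp only [AddSubgroupClass.coe_sub, Pi.sub_apply, SetLike.val_smul, Pi.smul_apply,
              single_self]
            cases h3 : ordAt (s.1 p - c • coord p ^ (N - (j + 1))) p with
            | top => exact le_top
            | coe m =>
              rw [h3] at hlt
              have := WithTop.coe_lt_coe.1 hlt
              exact WithTop.coe_le_coe.2 (by omega)
        rw [map_sub, map_smul] at hs
        have h4 := hΘE (.inr ⟨N - (j + 1), by omega⟩)
        simp only [E, Sum.elim_inr] at h4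
        rwa [h4, smul_zero, sub_zero] at hs
  have hΘ0 : ∀ r, Θ r = 0 := by
    refine functional_eq_zero he (fun r hr => ?_) fun i => hΘE (.inl i)
    obtain ⟨f, s, t, hfm, rfl, hs, ht⟩ := exists_decomp hr
    rw [map_add, hΘ s, adeleClass_global _ hfm hs, adeleClass_global _ hfm hs, map_zero, map_zero,
      add_zero, zero_add]
    exact hΘhigh N le_rfl t (fun x _ => ht x) (by simpa using ht p)
  -- If `G` were zero, `l` would vanish on `F r` for every adele `r` with `F ≠ 0`, hence be zero.
  -- Division by `G` is therefore possible and gives `μ r = l (H r)` with `H = -F / G`.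
  have hb0 : b ≠ 0 := by
    intro hb0
    have ha0 : a ≠ 0 := by
      intro ha0
      refine hab0 (funext fun i => ?_)
      rcases i with i | i
      · exact congrFun ha0 i
      · exact congrFun hb0 i
    refine hl (eq_zero_of_adeleClass_mulAdele hg (hFm a) (hFord a ha0) fun r => ?_)
    have h1 := hΘ0 r
    rw [hΘ] at h1
    have h2 : adeleClass (mulAdele _ (hFm b) r) = 0 :=
      adeleClass_eq_zero_of_nonneg fun x => by
        rw [mulAdele_apply, ordAt_eq_top_iff.2 (.of_forall fun y => by simp [hb0])]
        exact le_top
    rwa [h2, map_zero, add_zero] at h1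
  set F := ∑ i, a i • f i with hF
  set G := ∑ i, b i • f i with hG
  have hH : Mer (-(F * G⁻¹)) := fun x => (((hFm a).mul (hFm b).inv) x).neg
  have hμ : ∀ r, μ (adeleClass r) = l (adeleClass (mulAdele _ hH r)) := by
    intro r
    have h1 := hΘ0 (mulAdele G⁻¹ (hFm b).inv r)
    rw [hΘ, adeleClass_mulAdele_inv (hFm b) (hFord b hb0)] at h1
    have h2 : mulAdele _ hH r = - mulAdele F (hFm a) (mulAdele G⁻¹ (hFm b).inv r) := by
      ext x y
      simp [mulAdele_apply, mul_assoc]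
    rw [h2, map_neg, map_neg]
    linear_combination h1
  -- At a pole of `H` of order `-m`, multiplying by `coord q ^ (-m - 1)` leaves a simple pole, on
  -- which `l` takes the value of `μ` on a germ of nonnegative order, that is zero. So `q` would be
  -- a zero of `l`. Without poles `H` is constant and `μ` is a multiple of `l`.
  have hHnn : ∀ x, 0 ≤ ordAt (-(F * G⁻¹)) x := by
    intro q
    by_contra hneg
    push Not at hneg
    obtain ⟨m, hm⟩ := WithTop.ne_top_iff_exists.1 (ne_top_of_lt hneg)
    rw [← hm] at hneg
    have hm0 : m < 0 := by exact_mod_cast hneg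
    have hcq : MerAt (coord q ^ (-m - 1)) q := (merAt_coord q).zpow _
    have hw : MerAt (-(F * G⁻¹) * coord q ^ (-m - 1)) q := (hH q).mul hcq
    refine hz q (isZeroOf_of_single hw ?_ ?_)
    · rw [ordAt_mul (hH q) hcq, ordAt_coord_zpow, ← hm, ← WithTop.coe_add]
      congr 1
      ring
    · have h1 : single q _ hw = mulAdele _ hH (single q _ hcq) := by
        ext x y
        by_cases hx : x = q
        · subst hx
          rw [mulAdele_apply, single_self, single_self]
        · rw [mulAdele_apply, single_of_ne _ hx, single_of_ne _ hx, mul_zero]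
      rw [h1, ← hμ, adeleClass_single_eq_zero, map_zero]
      rw [ordAt_coord_zpow]
      exact_mod_cast (by omega : 0 ≤ -m - 1)
  obtain ⟨c, hc⟩ := exists_eventuallyEq_const_of_ordAt_nonneg hH hHnn
  refine ⟨c, LinearMap.ext fun k => ?_⟩
  obtain ⟨r, rfl⟩ := adeleClass_surjective hg k
  rw [hμ r, adeleClass_mul_congr hH (mer_const c) hc r]
  have : mulAdele (fun _ => c) (mer_const c) r = c • r := by
    ext x y
    simp [mulAdele_apply]
  rw [this, map_smul, map_smul, LinearMap.smul_apply]

end WeilZeros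

/-! ### The number of zeros of a functional, and periodic points of automorphisms -/

section PeriodicPoints

variable {X : Type*} [TopologicalSpace X] [T2Space X] [CompactSpace X] [ConnectedSpace X]
  [ChartedSpace ℂ X] [IsManifold 𝓘(ℂ) ω X] {g : ℕ}

/-- The class of such an adele is the sum of the classes of its simple poles at the `q i`, and `l`
annihilates each of them. -/
theorem eq_zero_of_poles_at_zeros {ι : Type*} [Fintype ι] {l : Module.Dual ℂ (H1 X)} {q : ι → X}
    (hq : Function.Injective q) (hz : ∀ i, IsZeroOf l (q i)) {t : adele X}
    (h0 : ∀ x, x ∉ range q → 0 ≤ ordAt (t.1 x) x)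
    (h1 : ∀ i, ((-1 : ℤ) : WithTop ℤ) ≤ ordAt (t.1 (q i)) (q i)) : l (adeleClass t) = 0 := by
  classical
  have h2 : adeleClass (t - ∑ i, single (q i) (t.1 (q i)) (t.2.1 _)) = 0 := by
    refine adeleClass_eq_zero_of_nonneg fun x => ?_
    by_cases hx : x ∈ range q
    · obtain ⟨i, rfl⟩ := hx
      have : (t - ∑ i, single (q i) (t.1 (q i)) (t.2.1 _)).1 (q i) = 0 := by
        simp only [AddSubgroupClass.coe_sub, AddSubmonoidClass.coe_finsetSum, Pi.sub_apply,
          Finset.sum_apply]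
        rw [Finset.sum_eq_single i (fun j _ hj => single_of_ne _ (hq.ne hj.symm))
          (fun h => absurd (Finset.mem_univ i) h), single_self, sub_self]
      rw [this]
      exact (holAt_const 0).ordAt_nonneg
    · have : (t - ∑ i, single (q i) (t.1 (q i)) (t.2.1 _)).1 x = t.1 x := by
        simp only [AddSubgroupClass.coe_sub, AddSubmonoidClass.coe_finsetSum, Pi.sub_apply,
          Finset.sum_apply]
        rw [Finset.sum_eq_zero fun j _ => single_of_ne _ fun h => hx ⟨j, h.symm⟩, sub_zero]
      rw [this]
      exact h0 x hx
  rw [map_sub, sub_eq_zero] at h2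
  rw [h2, map_sum, map_sum]
  exact Finset.sum_eq_zero fun i _ => hz i _ _ (h1 i)

/-- A nonzero functional has fewer than `2 g` zeros. -/
theorem not_injective_of_isZeroOf (hg : HasGenus X g) {l : Module.Dual ℂ (H1 X)} (hl : l ≠ 0)
    {q : Fin (2 * g) → X} (hq : Function.Injective q) (hz : ∀ i, IsZeroOf l (q i)) : False := by
  have := hg.module_finite
  have hcm : ∀ i, MerAt (coord (q i))⁻¹ (q i) := fun i => (merAt_coord _).inv
  have hco : ∀ i, ordAt (coord (q i))⁻¹ (q i) = ((-1 : ℤ) : WithTop ℤ) := fun i => by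
    rw [ordAt_inv, ordAt_coord]; rfl
  let v : Fin (2 * g) → adele X := fun i => single (q i) _ (hcm i)
  let A : (Fin (2 * g) → ℂ) →ₗ[ℂ] H1 X := adeleClass ∘ₗ Fintype.linearCombination ℂ v
  have hA : ∀ a, A a = adeleClass (∑ i, a i • v i) := fun a => by
    simp [A, Fintype.linearCombination_apply]
  -- Simple poles at zeros of `l` have classes in a hyperplane, so the range has dimension at most
  -- `g - 1` and the kernel at least `g + 1`: many functions have only simple poles at the `q i`.
  have hrange : LinearMap.range A ≤ LinearMap.ker l := by
    rintro _ ⟨a, rfl⟩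
    rw [LinearMap.mem_ker, hA, map_sum, map_sum]
    refine Finset.sum_eq_zero fun i _ => ?_
    rw [map_smul, map_smul, hz i _ (hcm i) (hco i).ge, smul_zero]
  have h1 := Submodule.finrank_mono hrange
  have h2 := Module.Dual.finrank_ker_add_one_of_ne_zero hl
  have h3 := LinearMap.finrank_range_add_finrank_ker A
  rw [hg.finrank_eq] at h2
  simp only [Module.finrank_fintype_fun_eq_card, Fintype.card_fin] at h3
  set d := Module.finrank ℂ (LinearMap.ker A) with hd
  have hd' : g < d := by omega
  let β := Module.finBasis ℂ (LinearMap.ker A)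
  have hF : ∀ j, ∃ F, Mer F ∧
      ∀ x, 0 ≤ ordAt ((∑ i, (β j : Fin (2 * g) → ℂ) i • (v i).1 x) - F) x := fun j => by
    have h4 : A (β j) = 0 := (β j).2
    rw [hA, adeleClass_eq_zero_iff] at h4
    obtain ⟨F, hF, hord⟩ := h4
    refine ⟨F, hF, fun x => ?_⟩
    simpa [AddSubmonoidClass.coe_finsetSum] using hord x
  choose F hFm hFord using hF
  obtain ⟨e, he⟩ := exists_adele_basis hg
  -- Since `d > g`, a nonzero combination `G` of these functions satisfies the `g` conditions `l (G
  -- e j) = 0`.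
  let Ψ : (Fin d → ℂ) →ₗ[ℂ] (Fin g → ℂ) :=
    { toFun := fun b j => ∑ i, b i * l (adeleClass (mulAdele (F i) (hFm i) (e j)))
      map_add' := fun a b => by
        ext j
        simp only [Pi.add_apply, add_mul, Finset.sum_add_distrib]
      map_smul' := fun c a => by
        ext j
        simp only [Pi.smul_apply, smul_eq_mul, mul_assoc, ← Finset.mul_sum, RingHom.id_apply] }
  obtain ⟨b, hb, hb0⟩ := (Submodule.ne_bot_iff _).1 (LinearMap.ker_ne_bot_of_finrank_lt
    (f := Ψ) (by simpa using hd'))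
  have hGm : Mer (∑ j, b j • F j) := Mer.sum _ fun j _ => (hFm j).smul _
  set ε : Fin (2 * g) → ℂ := ((∑ j, b j • β j : LinearMap.ker A) : Fin (2 * g) → ℂ) with hε
  have hε0 : ε ≠ 0 := by
    intro h
    have h5 : ∑ j, b j • β j = 0 := Subtype.ext h
    have h6 := Fintype.linearIndependent_iff.1 β.linearIndependent b h5
    exact hb0 (funext h6)
  have hvm : ∀ x i, MerAt ((v i).1 x) x := fun x i => (v i).2.1 x
  have hGord : ∀ x, 0 ≤ ordAt ((∑ i, ε i • (v i).1 x) - ∑ j, b j • F j) x := by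
    intro x
    have h7 : (∑ i, ε i • (v i).1 x) - ∑ j, b j • F j =
        ∑ j, b j • ((∑ i, (β j : Fin (2 * g) → ℂ) i • (v i).1 x) - F j) := by
      simp only [smul_sub, Finset.sum_sub_distrib, Finset.smul_sum, hε,
        AddSubmonoidClass.coe_finsetSum, Finset.sum_apply, Finset.sum_smul, SetLike.val_smul,
        Pi.smul_apply, smul_assoc]
      rw [Finset.sum_comm]
    rw [h7]
    have h8 : ∀ j, MerAt ((∑ i, (β j : Fin (2 * g) → ℂ) i • (v i).1 x) - F j) x := fun j =>
      (MerAt.sum _ fun i _ => (hvm x i).smul _).sub (hFm j x)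
    exact le_ordAt_sum _ (fun j _ => (h8 j).smul _) fun j _ => le_ordAt_smul (h8 j) (hFord j x)
  have hvsum : ∀ i, ∑ k, ε k • (v k).1 (q i) = ε i • (coord (q i))⁻¹ := fun i => by
    rw [Finset.sum_eq_single i (fun j _ hj => by
      simp only [v]
      rw [single_of_ne _ (hq.ne hj.symm), smul_zero]) (fun h => absurd (Finset.mem_univ i) h)]
    simp only [v, single_self]
  have hGq : ∀ i, ∃ s : X → ℂ, MerAt s (q i) ∧ 0 ≤ ordAt s (q i) ∧
      ∑ j, b j • F j = ε i • (coord (q i))⁻¹ + s := fun i => by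
    refine ⟨-(ε i • (coord (q i))⁻¹ - ∑ j, b j • F j),
      (((hcm i).smul _).sub (hGm _)).neg, ?_, by abel⟩
    have := hGord (q i)
    rw [hvsum] at this
    rwa [ordAt_neg]
  have hG1 : ∀ i, ((-1 : ℤ) : WithTop ℤ) ≤ ordAt (∑ j, b j • F j) (q i) := fun i => by
    obtain ⟨s, hs, hs0, heq⟩ := hGq i
    rw [heq]
    refine le_ordAt_add ((hcm i).smul _) hs (le_ordAt_smul (hcm i) (hco i).ge) (le_trans ?_ hs0)
    exact_mod_cast (by norm_num : (-1 : ℤ) ≤ 0)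
  have hG0 : ∀ x, x ∉ range q → 0 ≤ ordAt (∑ j, b j • F j) x := fun x hx => by
    have := hGord x
    rw [Finset.sum_eq_zero fun i _ => by
      simp only [v]
      rw [single_of_ne _ fun h => hx ⟨i, h.symm⟩, smul_zero], zero_sub, ordAt_neg] at this
    exact this
  -- `G` has a true simple pole at this `q i`, so it is not zero.
  obtain ⟨i, hi⟩ := Function.ne_iff.1 hε0
  have hGtop : ordAt (∑ j, b j • F j) (q i) ≠ ⊤ := by
    obtain ⟨s, hs, hs0, heq⟩ := hGq i
    have h9 : ordAt (ε i • (coord (q i))⁻¹) (q i) = ((-1 : ℤ) : WithTop ℤ) := by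
      rw [ordAt_smul hi (hcm i), hco]
    rw [heq, ordAt_add_eq_left hs, h9]
    · exact WithTop.coe_ne_top
    · rw [h9]
      exact lt_of_lt_of_le (by exact_mod_cast (by norm_num : (-1 : ℤ) < 0)) hs0
  -- On adeles of class zero, `G` times the global part has class zero and `G` times the part of
  -- nonnegative order has only simple poles at zeros of `l`. With the conditions on the `e j`, `l`
  -- vanishes on `G r` for every adele `r`.
  refine hl (eq_zero_of_adeleClass_mulAdele hg hGm hGtop ?_)
  refine functional_eq_zero he (Θ := l ∘ₗ adeleClass ∘ₗ mulAdele _ hGm) (fun r hr => ?_)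
    fun j => ?_
  · obtain ⟨f, s, t, hfm, rfl, hs, ht⟩ := exists_decomp hr
    simp only [LinearMap.comp_apply, map_add]
    rw [adeleClass_global _ hfm hs, map_zero, zero_add]
    refine eq_zero_of_poles_at_zeros hq hz (fun x hx => ?_) fun i => ?_
    · rw [mulAdele_apply, ordAt_mul (hGm x) (t.2.1 x)]
      exact add_nonneg (hG0 x hx) (ht x)
    · rw [mulAdele_apply, ordAt_mul (hGm _) (t.2.1 _)]
      exact le_trans (hG1 i) (le_add_of_nonneg_right (ht _))
  · simp only [LinearMap.comp_apply]
    rw [mulAdele_sum hFm]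
    simp only [map_sum, map_smul, smul_eq_mul]
    exact congrFun (LinearMap.mem_ker.1 hb) j

/-- The pullback of adeles by an automorphism. -/
def pullAdele (h : X ≃ₜ X) (hh : h ∈ biholAut X) : adele X →ₗ[ℂ] adele X where
  toFun r := ⟨fun x => r.1 (h x) ∘ h, fun x => (r.2.1 (h x)).comp_bihol hh,
    (r.2.2.preimage h.injective.injOn).subset fun _ hx hcon => hx (HolAt.comp_bihol hh hcon)⟩
  map_add' _ _ := rfl
  map_smul' _ _ := rfl

theorem adeleClass_pullAdele_eq_zero {h : X ≃ₜ X} (hh : h ∈ biholAut X) {r : adele X}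
    (hr : adeleClass r = 0) : adeleClass (pullAdele h hh r) = 0 := by
  obtain ⟨f, hf, hord⟩ := adeleClass_eq_zero_iff.1 hr
  refine adeleClass_eq_zero_iff.2 ⟨f ∘ h, hf.comp_bihol hh, fun x => ?_⟩
  have : (pullAdele h hh r).1 x - f ∘ h = (r.1 (h x) - f) ∘ h := rfl
  rw [this, ordAt_comp_bihol hh]
  exact hord (h x)

theorem pullAdele_single {h : X ≃ₜ X} (hh : h ∈ biholAut X) {q : X} {u : X → ℂ}
    (hu : MerAt u (h q)) :
    pullAdele h hh (single (h q) u hu) = single q (u ∘ h) (hu.comp_bihol hh) := by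
  refine Subtype.ext (funext fun x => ?_)
  have h0 : (pullAdele h hh (single (h q) u hu)).1 x = (single (h q) u hu).1 (h x) ∘ h := rfl
  rw [h0]
  by_cases hx : x = q
  · subst hx; rw [single_self, single_self]
  · rw [single_of_ne _ hx, single_of_ne _ (h.injective.ne hx)]; rfl

/-- The map induced on the first cohomology by an automorphism. -/
theorem exists_pullback (hg : HasGenus X g) {h : X ≃ₜ X} (hh : h ∈ biholAut X) :
    ∃ T : H1 X →ₗ[ℂ] H1 X, ∀ r, T (adeleClass r) = adeleClass (pullAdele h hh r) := by
  let e := LinearMap.quotKerEquivOfSurjective (adeleClass (X := X)) (adeleClass_surjective hg)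
  refine ⟨(Submodule.liftQ (LinearMap.ker adeleClass) (adeleClass ∘ₗ pullAdele h hh) ?_) ∘ₗ
    e.symm.toLinearMap, fun r => ?_⟩
  · intro r hr
    exact adeleClass_pullAdele_eq_zero hh (LinearMap.mem_ker.1 hr)
  · have : e.symm (adeleClass r) = Submodule.Quotient.mk r := by
      rw [LinearEquiv.symm_apply_eq]; rfl
    simp only [LinearMap.comp_apply, LinearEquiv.coe_coe]
    rw [this]
    rfl

/-- On a surface of genus at least two, every automorphism has a periodic point of small period. -/
theorem exists_periodic_point (hg : HasGenus X g) (hg2 : 2 ≤ g) {h : X ≃ₜ X}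
    (hh : h ∈ biholAut X) : ∃ q j, 1 ≤ j ∧ j ≤ 2 * g ∧ (h ^ j) q = q := by
  have := hg.module_finite
  obtain ⟨T, hT⟩ := exists_pullback hg hh
  have hnt : Nontrivial (Module.Dual ℂ (H1 X)) := by
    apply Module.nontrivial_of_finrank_pos (R := ℂ)
    rw [Subspace.dual_finrank_eq, hg.finrank_eq]; omega
  obtain ⟨α, hα⟩ := Module.End.exists_eigenvalue (Module.Dual.transpose (R := ℂ) T)
  obtain ⟨l, hl⟩ := hα.exists_hasEigenvector
  have hlT : ∀ c, l (T c) = α * l c := fun c => by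
    have := congrArg (fun φ : Module.Dual ℂ (H1 X) => φ c) hl.apply_eq_smul
    exact this
  -- A simple pole at `h q` pulls back to one at `q`, and `l` changes only by the factor `α`. The
  -- zeros are thus stable under `h⁻¹`, whether or not `α` is zero.
  have hinv : ∀ q, IsZeroOf l (h q) → IsZeroOf l q := by
    intro q hq
    have hcm : MerAt (coord (h q))⁻¹ (h q) := (merAt_coord _).inv
    have hco : ordAt (coord (h q))⁻¹ (h q) = ((-1 : ℤ) : WithTop ℤ) := by
      rw [ordAt_inv, ordAt_coord]; rfl
    refine isZeroOf_of_single (hcm.comp_bihol hh) (by rw [ordAt_comp_bihol hh, hco]) ?_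
    rw [← pullAdele_single hh hcm, ← hT, hlT, hq _ hcm hco.ge, mul_zero]
  obtain ⟨q, hq⟩ : ∃ q, IsZeroOf l q := by
    by_contra hcon
    push Not at hcon
    have := genus_le_one_of_no_zeros hg hl.2 hcon
    omega
  have hz : ∀ i : ℕ, IsZeroOf l ((h⁻¹ ^ i) q) := by
    intro i
    induction i with
    | zero => simpa using hq
    | succ i ih =>
      refine hinv _ ?_
      rwa [pow_succ', Homeomorph.mul_apply, ← Homeomorph.mul_apply h, mul_inv_cancel]
  have hni : ¬ Function.Injective fun i : Fin (2 * g) => (h⁻¹ ^ (i : ℕ)) q := fun hinj =>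
    not_injective_of_isZeroOf hg hl.2 hinj fun i => hz i
  have key : ∀ i j : ℕ, i < j → j < 2 * g → (h⁻¹ ^ i) q = (h⁻¹ ^ j) q →
      ∃ q j, 1 ≤ j ∧ j ≤ 2 * g ∧ (h ^ j) q = q := by
    intro i j hij hj heq
    refine ⟨(h⁻¹ ^ j) q, j - i, by omega, by omega, ?_⟩
    rw [← Homeomorph.mul_apply, ← heq]
    congr 1
    obtain ⟨m, rfl⟩ : ∃ m, j = m + i := ⟨j - i, by omega⟩
    rw [Nat.add_sub_cancel, pow_add, ← mul_assoc, inv_pow, mul_inv_cancel, one_mul]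
  rw [Function.Injective] at hni
  push Not at hni
  obtain ⟨i, j, heq, hne⟩ := hni
  rcases lt_or_gt_of_ne hne with hlt | hlt
  · exact key i j hlt j.2 heq
  · exact key j i hlt i.2 heq.symm

end PeriodicPoints

/-! ### A bound for the exponent of the automorphism group -/

section

variable {X : Type*} [TopologicalSpace X] [T2Space X] [CompactSpace X] [ConnectedSpace X]
  [ChartedSpace ℂ X] [IsManifold 𝓘(ℂ) ω X] {g : ℕ}

/-- On a surface of genus at least two, or of genus one with a marked point, the automorphism group
has finite exponent. -/
theorem exists_exponent (hg : HasGenus X g) (hg1 : 1 ≤ g) : ∃ E : ℕ, 1 ≤ E ∧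
    ∀ h ∈ biholAut X, (2 ≤ g ∨ ∃ p, h p = p) → h ^ E = 1 := by
  -- Some iterate `h ^ i` with `i ≤ 2 g` has a fixed point and then has order `j ≤ (2 g + 1) (2 g +
  -- 2)`; the factorial is divisible by every such product `i j`.
  refine ⟨((2 * g) * ((2 * g + 1) * (2 * g + 2))).factorial, Nat.factorial_pos _,
    fun h hh hcase => ?_⟩
  obtain ⟨q, i, hi1, hi2, hi⟩ : ∃ q i, 1 ≤ i ∧ i ≤ 2 * g ∧ (h ^ i) q = q := by
    rcases hcase with h2 | ⟨p, hp⟩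
    · exact exists_periodic_point hg h2 hh
    · exact ⟨p, 1, le_rfl, by omega, by simpa using hp⟩
  obtain ⟨j, hj1, hj2, hj⟩ := exists_pow_eq_one_of_fixed hg hg1 (pow_mem hh i) hi
  obtain ⟨m, hm⟩ := Nat.dvd_factorial (Nat.mul_pos hi1 hj1) (Nat.mul_le_mul hi2 hj2)
  rw [hm, pow_mul, pow_mul, hj, one_pow]

end

/-! ### Groups of homeomorphisms with the compact-open topology -/

section CompactOpen

variable {Y : Type*} [TopologicalSpace Y] {G : Subgroup (Y ≃ₜ Y)}

/-- The underlying continuous map of a member of `G`. -/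
def toMap (h : G) : C(Y, Y) := ((h : Y ≃ₜ Y) : C(Y, Y))

/-- The compact-open topology of a group of homeomorphisms. -/
abbrev compactOpenTopology (G : Subgroup (Y ≃ₜ Y)) : TopologicalSpace G :=
  TopologicalSpace.induced toMap inferInstance

attribute [local instance] compactOpenTopology

theorem continuous_toMap : Continuous (toMap : G → C(Y, Y)) := continuous_induced_dom

/-- Left translation by an element of `G`. -/
def leftTranslation (k : G) : G ≃ₜ G where
  toEquiv := Equiv.mulLeft k
  continuous_toFun := continuous_induced_rng.2
    ((ContinuousMap.continuous_postcomp (toMap k)).comp continuous_toMap)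
  continuous_invFun := continuous_induced_rng.2
    ((ContinuousMap.continuous_postcomp (toMap k⁻¹)).comp continuous_toMap)

/-- Left translations carry one chart at the identity to every other element. -/
theorem hasRealDim_of_openPartialHomeomorph {d : ℕ}
    (φ : OpenPartialHomeomorph G (EuclideanSpace ℝ (Fin d))) (h1 : 1 ∈ φ.source) :
    HasRealDim G d :=
  ⟨{ atlas := range fun k : G => (leftTranslation k⁻¹).toOpenPartialHomeomorph.trans φ
     chartAt := fun k => (leftTranslation k⁻¹).toOpenPartialHomeomorph.trans φ
     mem_chart_source := fun k => by
       have : leftTranslation k⁻¹ k = 1 := inv_mul_cancel k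
       simpa [this] using h1
     chart_mem_atlas := fun k => ⟨k, rfl⟩ }⟩

/-- A group of homeomorphisms is a manifold if a neighbourhood of the identity is parametrised by an
open subset of a Euclidean space. -/
theorem hasRealDim_of_section {d : ℕ} {V : Set G} (hV : IsOpen V) (h1 : 1 ∈ V)
    {φ : G → EuclideanSpace ℝ (Fin d)} (hφ : ContinuousOn φ V)
    {T : Set (EuclideanSpace ℝ (Fin d))} (hT : IsOpen T) {ψ : EuclideanSpace ℝ (Fin d) → G}
    (hψ : ContinuousOn ψ T) (hφ1 : φ 1 ∈ T) (hφψ : ∀ a ∈ T, ψ a ∈ V → φ (ψ a) = a)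
    (hψφ : ∀ h ∈ V, φ h ∈ T → ψ (φ h) = h) : HasRealDim G d := by
  refine hasRealDim_of_openPartialHomeomorph (d := d)
    { toFun := φ
      invFun := ψ
      source := V ∩ φ ⁻¹' T
      target := T ∩ ψ ⁻¹' V
      map_source' := fun h hh => ⟨hh.2, by rw [mem_preimage, hψφ h hh.1 hh.2]; exact hh.1⟩
      map_target' := fun a ha => ⟨ha.2, by rw [mem_preimage, hφψ a ha.1 ha.2]; exact ha.1⟩
      left_inv' := fun h hh => hψφ h hh.1 hh.2
      right_inv' := fun a ha => hφψ a ha.1 ha.2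
      open_source := hφ.isOpen_inter_preimage hV hT
      open_target := hψ.isOpen_inter_preimage hT hV
      continuousOn_toFun := hφ.mono inter_subset_left
      continuousOn_invFun := hψ.mono inter_subset_left } ⟨h1, hφ1⟩

theorem hasRealDim_zero
    (h : ∀ᶠ φ in 𝓝 (ContinuousMap.id Y), ∀ k ∈ G, (k : C(Y, Y)) = φ → k = 1) :
    HasRealDim G 0 := by
  obtain ⟨U, hU, hUo, hU1⟩ := eventually_nhds_iff.1 h
  refine hasRealDim_of_section (V := toMap ⁻¹' U) (hUo.preimage continuous_toMap) hU1
    (φ := fun _ => 0) continuousOn_const (T := univ) isOpen_univ (ψ := fun _ => 1)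
    continuousOn_const (mem_univ _) (fun a _ _ => Subsingleton.elim _ _) fun k hk _ => ?_
  exact Subtype.ext (hU _ hk k k.2 rfl).symm

/-- On a locally compact space composition and evaluation are jointly continuous, so iterates depend
continuously on the map; compactness of `K` makes the estimate uniform. -/
theorem eventually_iterate_mapsTo [LocallyCompactSpace Y] {K : Set Y} (hK : IsCompact K)
    {O : Set (Y × Y)} (hO : IsOpen O) (hKO : ∀ y ∈ K, (y, y) ∈ O) (i : ℕ) :
    ∀ᶠ φ : C(Y, Y) in 𝓝 (ContinuousMap.id Y), ∀ y ∈ K, (y, φ^[i] y) ∈ O := by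
  have h1 : ∀ i : ℕ, ∃ F : C(Y, Y) → C(Y, Y), Continuous F ∧ ∀ φ y, F φ y = φ^[i] y := by
    intro i
    induction i with
    | zero => exact ⟨fun _ => ContinuousMap.id Y, continuous_const, fun _ _ => rfl⟩
    | succ i ih =>
      obtain ⟨F, hF, hF'⟩ := ih
      exact ⟨fun φ => (F φ).comp φ, hF.compCM continuous_id, fun φ y => by
        simp [hF', Function.iterate_succ_apply]⟩
  obtain ⟨F, hF, hF'⟩ := h1 i
  have h2 : ∀ y ∈ K, ∀ᶠ p : Y × C(Y, Y) in 𝓝 (y, ContinuousMap.id Y), (p.1, F p.2 p.1) ∈ O := by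
    intro y hy
    have hc : Continuous fun p : Y × C(Y, Y) => (p.1, F p.2 p.1) := by fun_prop
    refine (hO.preimage hc).mem_nhds ?_
    simpa [hF', Function.iterate_fixed] using hKO y hy
  have h3 := hK.eventually_forall_of_forall_eventually (x₀ := ContinuousMap.id Y)
    (P := fun φ y => (y, F φ y) ∈ O) fun y hy => by
      have := h2 y hy
      rw [nhds_prod_eq, Filter.prod_comm, Filter.eventually_map] at this
      rw [nhds_prod_eq]
      exact this
  filter_upwards [h3] with φ hφ y hy
  rw [← hF']
  exact hφ y hy

end CompactOpen

/-! ### Small automorphisms of finite order -/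

section SmallOrder

variable {X : Type*} [TopologicalSpace X] [T2Space X] [ChartedSpace ℂ X] [IsManifold 𝓘(ℂ) ω X]

/-- A function that is uniformly close to the identity on a disc is injective on a smaller disc. -/
theorem injOn_of_norm_sub_le {Φ : ℂ → ℂ} {c : ℂ} {r : ℝ} (hr : 0 < r)
    (hΦ : DifferentiableOn ℂ Φ (Metric.ball c r)) (hb : ∀ z ∈ Metric.ball c r, ‖Φ z - z‖ ≤ r / 8) :
    InjOn Φ (Metric.ball c (r / 2)) := by
  have hd : ∀ z ∈ Metric.ball c (r / 2), DifferentiableAt ℂ (fun z => Φ z - z) z := fun z hz =>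
    (hΦ.differentiableAt (Metric.isOpen_ball.mem_nhds
      (Metric.ball_subset_ball (by linarith) hz))).sub differentiableAt_id
  have hderiv : ∀ z ∈ Metric.ball c (r / 2), ‖deriv (fun z => Φ z - z) z‖ ≤ 1 / 2 := by
    intro z hz
    have hsub : Metric.closedBall z (r / 4) ⊆ Metric.ball c r := fun w hw => by
      rw [Metric.mem_closedBall] at hw
      rw [Metric.mem_ball] at hz ⊢
      linarith [dist_triangle w z c]
    -- Cauchy's estimate on circles of radius `r / 4` gives `(r / 8) / (r / 4) = 1 / 2`, so `Φ - id`
    -- is a contraction on the half disc.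
    have := Complex.norm_deriv_le_of_forall_mem_sphere_norm_le (f := fun z => Φ z - z) (c := z)
      (R := r / 4) (C := r / 8) (by linarith)
      (DifferentiableOn.diffContOnCl_ball (U := Metric.ball c r)
        (hΦ.sub differentiableOn_id) hsub)
      fun w hw => hb w (hsub (Metric.sphere_subset_closedBall hw))
    refine this.trans (le_of_eq ?_)
    field_simp
    norm_num
  intro z hz w hw hzw
  have h1 := (convex_ball c (r / 2)).norm_image_sub_le_of_norm_deriv_le (𝕜 := ℂ) hd hderiv hw hz
  have h2 : Φ z - z - (Φ w - w) = -(z - w) := by rw [hzw]; ring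
  rw [h2, norm_neg] at h1
  have h3 : ‖z - w‖ ≤ 0 := by linarith
  exact sub_eq_zero.1 (norm_le_zero_iff.1 h3)

/-- The iterates of `k` up to `E` being close to the identity on a disc of the chart at `x`, and
`k ^ E` being the identity, `k` is the identity near `x`. -/
theorem eventually_eq_self_of_pow_eq_one {k : X ≃ₜ X} (hk : k ∈ biholAut X) {E : ℕ} (hE : 1 ≤ E)
    (hkE : k ^ E = 1) {x : X} {r : ℝ} (hr : 0 < r)
    (hball : Metric.ball (chartAt ℂ x x) r ⊆ (chartAt ℂ x).target)
    (hclose : ∀ i < E, ∀ z ∈ Metric.ball (chartAt ℂ x x) r,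
      (k ^ i) ((chartAt ℂ x).symm z) ∈ (chartAt ℂ x).source ∧
      ‖chartAt ℂ x ((k ^ i) ((chartAt ℂ x).symm z)) - z‖ ≤ r / 8) :
    ∀ᶠ y in 𝓝 x, k y = y := by
  have := isManifold_one (X := X)
  set c := chartAt ℂ x x with hc
  -- The average over the iterates is invariant under `k` because `k ^ E = k ^ 0`; being close to
  -- the identity it is also injective, so `k` fixes every point near the centre.
  set Φ : ℂ → ℂ := fun z =>
    (E : ℂ)⁻¹ * ∑ i ∈ Finset.range E, chartAt ℂ x ((k ^ i) ((chartAt ℂ x).symm z)) with hΦ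
  have hE0 : (E : ℂ) ≠ 0 := by exact_mod_cast (by omega : E ≠ 0)
  have hd : DifferentiableOn ℂ Φ (Metric.ball c r) := by
    refine DifferentiableOn.const_mul (DifferentiableOn.fun_sum fun i hi => ?_) _
    intro z hz
    refine DifferentiableAt.differentiableWithinAt ?_
    have hi' := (hclose i (Finset.mem_range.1 hi) z hz).1
    have h1 : MDifferentiableAt 𝓘(ℂ) 𝓘(ℂ) (chartAt ℂ x ∘ (k ^ i : X ≃ₜ X))
        ((chartAt ℂ x).symm z) :=
      MDifferentiableAt.comp _ ((mdifferentiable_chart x).mdifferentiableAt hi')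
        ((pow_mem hk i).1 _)
    rw [mdifferentiableAt_iff_chart ((chartAt ℂ x).map_target (hball hz)),
      (chartAt ℂ x).right_inv (hball hz)] at h1
    exact h1
  have hb : ∀ z ∈ Metric.ball c r, ‖Φ z - z‖ ≤ r / 8 := by
    intro z hz
    have h1 : Φ z - z = (E : ℂ)⁻¹ * ∑ i ∈ Finset.range E,
        (chartAt ℂ x ((k ^ i) ((chartAt ℂ x).symm z)) - z) := by
      rw [Finset.sum_sub_distrib, mul_sub, Finset.sum_const, Finset.card_range, nsmul_eq_mul,
        inv_mul_cancel_left₀ hE0]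
    rw [h1, norm_mul, norm_inv, Complex.norm_natCast]
    have h2 : ‖∑ i ∈ Finset.range E, (chartAt ℂ x ((k ^ i) ((chartAt ℂ x).symm z)) - z)‖ ≤
        E * (r / 8) := by
      refine (norm_sum_le_of_le _ fun i hi => (hclose i (Finset.mem_range.1 hi) z hz).2).trans ?_
      simp
    have hE' : (0 : ℝ) < E := by exact_mod_cast hE
    calc (E : ℝ)⁻¹ * _ ≤ (E : ℝ)⁻¹ * (E * (r / 8)) := by gcongr
      _ = r / 8 := by field_simp
  have hinj := injOn_of_norm_sub_le hr hd hb
  have hx := mem_chart_source ℂ x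
  rw [← (chartAt ℂ x).eventually_nhds' _ hx]
  -- With `z` within `r / 4` and `k` moving it by at most `r / 8`, the image stays in the disc of
  -- radius `r / 2` where `Φ` is injective.
  filter_upwards [Metric.ball_mem_nhds c (by linarith : 0 < r / 4)] with z hz
  have hzr : z ∈ Metric.ball c r := Metric.ball_subset_ball (by linarith) hz
  have key : chartAt ℂ x (k ((chartAt ℂ x).symm z)) = z ∧
      k ((chartAt ℂ x).symm z) ∈ (chartAt ℂ x).source := by
    rcases Nat.lt_or_ge 1 E with hE1 | hE1
    · obtain ⟨hs, hn⟩ := hclose 1 hE1 z hzr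
      rw [pow_one] at hs hn
      refine ⟨hinj ?_ (Metric.ball_subset_ball (by linarith) hz) ?_, hs⟩
      · rw [Metric.mem_ball] at hz ⊢
        rw [← dist_eq_norm] at hn
        linarith [dist_triangle (chartAt ℂ x (k ((chartAt ℂ x).symm z))) z c]
      · simp only [hΦ]
        congr 1
        have h3 := Finset.sum_range_succ' (fun i =>
          chartAt ℂ x ((k ^ i) ((chartAt ℂ x).symm z))) E
        rw [Finset.sum_range_succ, hkE, pow_zero] at h3
        have h4 := add_right_cancel h3
        rw [h4]
        refine Finset.sum_congr rfl fun i _ => ?_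
        rw [(chartAt ℂ x).left_inv hs, pow_succ]
        rfl
    · obtain rfl : E = 1 := le_antisymm hE1 hE
      rw [pow_one] at hkE
      subst hkE
      exact ⟨(chartAt ℂ x).right_inv (hball hzr), (chartAt ℂ x).map_target (hball hzr)⟩
  rw [← (chartAt ℂ x).left_inv key.2, key.1]

end SmallOrder

/-! ### Extension of automorphisms across the punctures -/

section Extension

variable {X : Type*} [TopologicalSpace X] [ChartedSpace ℂ X]

theorem mdifferentiableAt_comp_val {U : Opens X} {f : X → X} {x : U} :
    MDifferentiableAt 𝓘(ℂ) 𝓘(ℂ) (fun y : U => f y) x ↔ MDifferentiableAt 𝓘(ℂ) 𝓘(ℂ) f x :=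
  (differentiableWithinAt_localInvariantProp.liftPropAt_iff_comp_subtype_val _ _).symm

theorem mdifferentiableAt_val_comp {U : Opens X} {f : U → U} {x : U} :
    MDifferentiableAt 𝓘(ℂ) 𝓘(ℂ) (fun y => (f y : X)) x ↔ MDifferentiableAt 𝓘(ℂ) 𝓘(ℂ) f x :=
  ChartedSpace.liftPropWithinAt_subtypeVal_comp_iff f univ x

variable [IsManifold 𝓘(ℂ) ω X]

/-- The theorem on removable singularities, for continuous maps. -/
theorem mdifferentiableAt_of_continuousAt {k : X → X} {x : X} (hc : ContinuousAt k x)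
    (h : ∀ᶠ y in 𝓝[≠] x, MDifferentiableAt 𝓘(ℂ) 𝓘(ℂ) k y) : MDifferentiableAt 𝓘(ℂ) 𝓘(ℂ) k x := by
  have := isManifold_one (X := X)
  have hx := mem_chart_source ℂ x
  rw [mdifferentiableAt_iff_target]
  refine ⟨hc, ?_⟩
  have hkx := mem_chart_source ℂ (k x)
  have hs : ∀ᶠ y in 𝓝 x, k y ∈ (chartAt ℂ (k x)).source :=
    hc.preimage_mem_nhds ((chartAt ℂ (k x)).open_source.mem_nhds hkx)
  have h1 : ∀ᶠ y in 𝓝[≠] x, MDifferentiableAt 𝓘(ℂ) 𝓘(ℂ) (chartAt ℂ (k x) ∘ k) y := by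
    filter_upwards [h, eventually_nhdsWithin_of_eventually_nhds hs] with y hy hy'
    exact MDifferentiableAt.comp y ((mdifferentiable_chart (k x)).mdifferentiableAt hy') hy
  suffices h2 : MDifferentiableAt 𝓘(ℂ) 𝓘(ℂ) (chartAt ℂ (k x) ∘ k) x by simpa using h2
  rw [mdifferentiableAt_iff_chart hx]
  refine (Complex.analyticAt_of_differentiable_on_punctured_nhds_of_continuousAt
    ?_ ?_).differentiableAt
  · rw [← eventually_chart_symm] at h1
    filter_upwards [h1, mem_nhdsWithin_of_mem_nhds ((chartAt ℂ x).open_target.mem_nhds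
        ((chartAt ℂ x).map_source hx))] with z hz hz'
    rwa [mdifferentiableAt_iff_chart ((chartAt ℂ x).map_target hz'),
      (chartAt ℂ x).right_inv hz'] at hz
  · refine ContinuousAt.comp_of_eq (y := x) (ContinuousAt.comp
      ((chartAt ℂ (k x)).continuousAt hkx) hc) ?_ ((chartAt ℂ x).left_inv hx)
    exact (chartAt ℂ x).symm.continuousAt ((chartAt ℂ x).map_source hx)

variable [T2Space X] {N : X → X} {sp sm tp tm : ℕ} {P : Punctures N sp sm tp tm}

namespace Punctures

theorem mem_theta {x : X} : x ∈ P.theta ↔ x ∉ P.points := Iff.rfl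

theorem eventually_mem_theta (x : X) : ∀ᶠ y in 𝓝[≠] x, y ∈ P.theta := by
  have h1 : IsClosed (P.points \ {x}) := (P.finite_points.subset sdiff_subset).isClosed
  have h2 : ∀ᶠ y in 𝓝 x, y ∉ P.points \ {x} := h1.isOpen_compl.mem_nhds fun h => h.2 rfl
  filter_upwards [mem_nhdsWithin_of_mem_nhds h2, self_mem_nhdsWithin] with y hy hyx hyp
  exact hy ⟨hyp, hyx⟩

open Classical in
/-- The extension of a self-map of `Θ` by the identity of the set of punctures. -/
def extendFun (P : Punctures N sp sm tp tm) (h : P.theta → P.theta) (x : X) : X :=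
  if hx : x ∈ P.theta then h ⟨x, hx⟩ else x

theorem extendFun_coe (h : P.theta → P.theta) (x : P.theta) : P.extendFun h x = h x := by
  rw [extendFun, dif_pos x.2]

theorem extendFun_puncture (h : P.theta → P.theta) {p : X} (hp : p ∈ P.points) :
    P.extendFun h p = p := dif_neg fun h => h hp

theorem extendFun_comp (h k : P.theta → P.theta) (x : X) :
    P.extendFun h (P.extendFun k x) = P.extendFun (h ∘ k) x := by
  by_cases hx : x ∈ P.theta
  · lift x to P.theta using hx
    simp only [extendFun_coe, Function.comp_apply]
  · rw [mem_theta, not_not] at hx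
    simp only [extendFun_puncture _ hx]

theorem continuous_extendFun {h : P.theta → P.theta} (hc : Continuous h)
    (hp : ∀ p ∈ P.points,
      Tendsto h (comap ((↑) : P.theta → X) (𝓝 p)) (comap ((↑) : P.theta → X) (𝓝 p))) :
    Continuous (P.extendFun h) := by
  rw [continuous_iff_continuousAt]
  intro x
  by_cases hx : x ∈ P.theta
  · lift x to P.theta using hx
    rw [← P.theta.isOpen.isOpenEmbedding_subtypeVal.continuousAt_iff]
    refine (continuous_subtype_val.comp hc).continuousAt.congr (.of_forall fun y => ?_)
    exact (extendFun_coe h y).symm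
  · rw [mem_theta, not_not] at hx
    rw [continuousAt_iff_punctured_nhds, extendFun_puncture h hx, tendsto_def]
    intro B hB
    obtain ⟨A, hA, hAB⟩ := mem_comap.1 (hp x hx (preimage_mem_comap hB))
    filter_upwards [mem_nhdsWithin_of_mem_nhds hA, eventually_mem_theta (P := P) x] with y hy hy'
    lift y to P.theta using hy'
    rw [mem_preimage, extendFun_coe]
    exact hAB hy

theorem mdifferentiable_extendFun {h : P.theta → P.theta} (hh : MDifferentiable 𝓘(ℂ) 𝓘(ℂ) h)
    (hc : Continuous (P.extendFun h)) : MDifferentiable 𝓘(ℂ) 𝓘(ℂ) (P.extendFun h) := by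
  have h1 : ∀ x ∈ P.theta, MDifferentiableAt 𝓘(ℂ) 𝓘(ℂ) (P.extendFun h) x := by
    intro x hx
    lift x to P.theta using hx
    rw [← mdifferentiableAt_comp_val]
    have : (fun y : P.theta => P.extendFun h y) = fun y => (h y : X) :=
      funext fun y => extendFun_coe h y
    rw [this, mdifferentiableAt_val_comp]
    exact hh x
  intro x
  refine mdifferentiableAt_of_continuousAt hc.continuousAt ?_
  filter_upwards [eventually_mem_theta (P := P) x] with y hy using h1 y hy

variable {hN : Function.Involutive N}

/-- An automorphism of `Θ` that keeps every puncture fixed extends to an automorphism of `X`. -/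
theorem exists_extension {h : P.theta ≃ₜ P.theta} (hh : h ∈ P.pureAut hN) :
    ∃ k : X ≃ₜ X, k ∈ biholAut X ∧ (∀ x : P.theta, k x = h x) ∧ (∀ p ∈ P.points, k p = p) ∧
      ∀ x, k (N x) = N (k x) := by
  obtain ⟨⟨h1, h2, h3⟩, h4⟩ := hh
  have c1 := continuous_extendFun h.continuous fun p hp => (h4 p hp).1
  have c2 := continuous_extendFun h.symm.continuous fun p hp => (h4 p hp).2
  have hid : ∀ x, P.extendFun id x = x := fun x => by
    by_cases hx : x ∈ P.theta
    · lift x to P.theta using hx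
      exact extendFun_coe _ x
    · rw [mem_theta, not_not] at hx
      exact extendFun_puncture _ hx
  refine ⟨⟨⟨P.extendFun h, P.extendFun h.symm, fun x => ?_, fun x => ?_⟩, c1, c2⟩,
    ⟨mdifferentiable_extendFun h1 c1, mdifferentiable_extendFun h2 c2⟩, extendFun_coe h,
    fun p hp => extendFun_puncture h hp, fun x => ?_⟩
  · rw [extendFun_comp, h.symm_comp_self, hid]
  · rw [extendFun_comp, h.self_comp_symm, hid]
  · change P.extendFun h (N x) = N (P.extendFun h x)
    by_cases hx : x ∈ P.theta
    · lift x to P.theta using hx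
      have h5 : N x = (P.invol hN x : X) := rfl
      rw [h5, extendFun_coe, extendFun_coe, h3]
      rfl
    · rw [mem_theta, not_not] at hx
      rw [extendFun_puncture h hx, extendFun_puncture h (P.map_mem_points hN hx)]

/-- An automorphism of `X` that commutes with the involution and fixes the punctures restricts to an
automorphism of `Θ`. -/
theorem exists_restriction {k : X ≃ₜ X} (hk : k ∈ biholAut X) (hfix : ∀ p ∈ P.points, k p = p)
    (hcomm : ∀ x, k (N x) = N (k x)) :
    ∃ h ∈ P.pureAut hN, ∀ x : P.theta, (h x : X) = k x := by
  have hfix' : ∀ p ∈ P.points, k.symm p = p := fun p hp => by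
    rw [Homeomorph.symm_apply_eq, hfix p hp]
  have hmem : ∀ x, x ∈ P.theta → k x ∈ P.theta := fun x hx hkx => hx <| by
    have := hfix' _ hkx
    rw [k.symm_apply_apply] at this
    rwa [this]
  have hmem' : ∀ x, x ∈ P.theta → k.symm x ∈ P.theta := fun x hx hkx => hx <| by
    have := hfix _ hkx
    rw [k.apply_symm_apply] at this
    rwa [this]
  have htend : ∀ (l : X ≃ₜ X) (f : P.theta → P.theta), (∀ x, (f x : X) = l x) →
      ∀ p, l p = p → Tendsto f (comap ((↑) : P.theta → X) (𝓝 p))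
        (comap ((↑) : P.theta → X) (𝓝 p)) := by
    intro l f hf p hp
    rw [tendsto_comap_iff]
    have : ((↑) : P.theta → X) ∘ f = l ∘ (↑) := funext hf
    rw [this]
    have h2 := l.continuous.tendsto p
    rw [hp] at h2
    exact h2.comp tendsto_comap
  refine ⟨⟨⟨fun x => ⟨k x, hmem x x.2⟩, fun x => ⟨k.symm x, hmem' x x.2⟩,
    fun x => Subtype.ext (k.symm_apply_apply x), fun x => Subtype.ext (k.apply_symm_apply x)⟩,
    (k.continuous.comp continuous_subtype_val).subtype_mk _,
    (k.symm.continuous.comp continuous_subtype_val).subtype_mk _⟩,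
    ⟨⟨fun x => ?_, fun x => ?_, fun x => Subtype.ext (hcomm x)⟩, fun p hp =>
      ⟨htend k _ (fun _ => rfl) p (hfix p hp), htend k.symm _ (fun _ => rfl) p (hfix' p hp)⟩⟩,
    fun _ => rfl⟩
  · exact mdifferentiableAt_val_comp.1 (mdifferentiableAt_comp_val.2 (hk.1 x))
  · exact mdifferentiableAt_val_comp.1 (mdifferentiableAt_comp_val.2 (hk.2 x))

end Punctures

end Extension

/-! ### Small automorphisms keep the punctures fixed -/

section Small

/-- The punctured disc is the image of a half-plane under a translate of the exponential. -/
theorem isPreconnected_ball_diff_center (c : ℂ) (r : ℝ) :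
    IsPreconnected (Metric.ball c r \ {c}) := by
  rcases le_or_gt r 0 with hr | hr
  · rw [Metric.ball_eq_empty.2 hr, empty_sdiff]
    exact isPreconnected_empty
  have h1 : Metric.ball c r \ {c} = (fun z => c + Complex.exp z) '' {z | z.re < Real.log r} := by
    ext z
    simp only [Set.mem_sdiff, Metric.mem_ball, mem_singleton_iff, mem_image, mem_ofPred_eq]
    constructor
    · rintro ⟨h1, h2⟩
      have h3 : z - c ≠ 0 := sub_ne_zero.2 h2
      refine ⟨Complex.log (z - c), ?_, by rw [Complex.exp_log h3]; ring⟩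
      rw [Complex.log_re]
      exact Real.log_lt_log (norm_pos_iff.2 h3) (by rwa [← dist_eq_norm])
    · rintro ⟨w, hw, rfl⟩
      refine ⟨?_, by simp [Complex.exp_ne_zero]⟩
      rw [dist_eq_norm, add_sub_cancel_left, Complex.norm_exp]
      exact (Real.lt_log_iff_exp_lt hr).1 hw
  rw [h1]
  exact (convex_halfSpace_re_lt _).isPreconnected.image _ (by fun_prop)

variable {X : Type*} [TopologicalSpace X] [ChartedSpace ℂ X] [T2Space X]

theorem exists_punctured_nhds [RegularSpace X] {p : X} {U : Set X} (hU : U ∈ 𝓝 p) :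
    ∃ W : Set X, IsOpen W ∧ p ∈ W ∧ closure W ⊆ U ∧ IsPreconnected (W \ {p}) := by
  obtain ⟨C, hC, hCc, hCU⟩ := exists_mem_nhds_isClosed_subset hU
  have hp := mem_chart_source ℂ p
  have h1 : ∀ᶠ z in 𝓝 (chartAt ℂ p p), (chartAt ℂ p).symm z ∈ C :=
    ((chartAt ℂ p).eventually_nhds' (fun y => y ∈ C) hp).2 hC
  obtain ⟨r, hr, hball⟩ := Metric.eventually_nhds_iff_ball.1 (h1.and
    ((chartAt ℂ p).open_target.mem_nhds ((chartAt ℂ p).map_source hp)))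
  have hsub : Metric.ball (chartAt ℂ p p) r ⊆ (chartAt ℂ p).target := fun z hz => (hball z hz).2
  refine ⟨(chartAt ℂ p).symm '' Metric.ball (chartAt ℂ p p) r,
    (chartAt ℂ p).isOpen_image_symm_of_subset_target Metric.isOpen_ball hsub,
    ⟨_, Metric.mem_ball_self hr, (chartAt ℂ p).left_inv hp⟩,
    (closure_minimal ?_ hCc).trans hCU, ?_⟩
  · rintro _ ⟨z, hz, rfl⟩
    exact (hball z hz).1
  · have h2 : (chartAt ℂ p).symm '' Metric.ball (chartAt ℂ p p) r \ {p} =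
        (chartAt ℂ p).symm '' (Metric.ball (chartAt ℂ p p) r \ {chartAt ℂ p p}) := by
      ext y
      constructor
      · rintro ⟨⟨z, hz, rfl⟩, hne⟩
        refine ⟨z, ⟨hz, fun h => hne ?_⟩, rfl⟩
        rw [mem_singleton_iff] at h ⊢
        rw [h, (chartAt ℂ p).left_inv hp]
      · rintro ⟨z, ⟨hz, hne⟩, rfl⟩
        refine ⟨⟨z, hz, rfl⟩, fun h => hne ?_⟩
        rw [mem_singleton_iff] at h ⊢
        rw [← (chartAt ℂ p).right_inv (hsub hz), h]
    rw [h2]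
    exact (isPreconnected_ball_diff_center _ _).image _
      ((chartAt ℂ p).continuousOn_symm.mono (sdiff_subset.trans hsub))

variable [IsManifold 𝓘(ℂ) ω X] [CompactSpace X] {N : X → X} {sp sm tp tm : ℕ}
  {P : Punctures N sp sm tp tm} {hN : Function.Involutive N}

namespace Punctures

instance : LocallyCompactSpace P.theta := P.theta.isOpen.locallyCompactSpace

theorem isCompact_preimage_coe {K : Set X} (hK : IsClosed K) (hKP : ∀ x ∈ K, x ∉ P.points) :
    IsCompact (((↑) : P.theta → X) ⁻¹' K) := by
  rw [Subtype.isCompact_iff, image_preimage_eq_of_subset]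
  · exact hK.isCompact
  · rw [Subtype.range_coe]
    exact hKP

/-- A homeomorphism of `Θ` that, near the punctures, preserves the distribution of points over
disjoint neighbourhoods of the punctures extends by the identity of the set of punctures. -/
theorem tendsto_of_forall_mem {U W : X → Set X} (hU : ∀ p ∈ P.points, U p ∈ 𝓝 p)
    (hWo : ∀ p ∈ P.points, W p ∈ 𝓝 p)
    (hdisj : ∀ p ∈ P.points, ∀ q ∈ P.points, ∀ x, x ∈ U p → x ∈ U q → p = q)
    {h : P.theta ≃ₜ P.theta}
    (hW : ∀ p ∈ P.points, ∀ x : P.theta, (h x : X) ∈ W p → (x : X) ∈ U p) {p : X}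
    (hp : p ∈ P.points) :
    Tendsto h (comap ((↑) : P.theta → X) (𝓝 p)) (comap ((↑) : P.theta → X) (𝓝 p)) := by
  rw [tendsto_comap_iff, tendsto_def]
  intro B hB
  -- `K` is compact in `Θ`, so its preimage under `h` stays away from `p`. Near `p` the values of
  -- `h` are therefore in `B` or near another puncture, and the latter is excluded by `hW` and
  -- disjointness.
  set K : Set X := (interior B ∪ ⋃ q ∈ P.points \ {p}, interior (W q))ᶜ with hK
  have hKc : IsClosed K := (isOpen_interior.union
    (isOpen_biUnion fun q _ => isOpen_interior)).isClosed_compl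
  have hKP : ∀ x ∈ K, x ∉ P.points := by
    intro x hx hxP
    refine hx ?_
    by_cases hxp : x = p
    · subst hxp; exact Or.inl (mem_interior_iff_mem_nhds.2 hB)
    · exact Or.inr (mem_biUnion (show x ∈ P.points \ {p} from ⟨hxP, hxp⟩)
        (mem_interior_iff_mem_nhds.2 (hWo x hxP)))
  have h1 := (isCompact_preimage_coe hKc hKP).image h.symm.continuous
  have h2 := (h1.image continuous_subtype_val).isClosed
  have h3 : (((↑) : P.theta → X) '' (h.symm '' (((↑) : P.theta → X) ⁻¹' K)))ᶜ ∈ 𝓝 p := by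
    refine h2.isOpen_compl.mem_nhds ?_
    rintro ⟨y, -, rfl⟩
    exact y.2 hp
  refine mem_comap.2 ⟨_, inter_mem h3 (hU p hp), fun x hx => ?_⟩
  have hhx : (h x : X) ∉ K := fun hcon => hx.1 ⟨x, ⟨h x, hcon, h.symm_apply_apply x⟩, rfl⟩
  rw [hK, mem_compl_iff, not_not] at hhx
  rcases hhx with h4 | h4
  · exact (interior_subset h4 : (h x : X) ∈ B)
  · obtain ⟨q, hq, h5⟩ := mem_iUnion₂.1 h4
    exact absurd (hdisj q hq.1 p hp x (hW q hq.1 x (interior_subset h5)) hx.2) hq.2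

/-- Automorphisms of `Θ` near the identity keep every puncture fixed. -/
theorem eventually_mem_pureAut : ∀ᶠ φ in 𝓝 (ContinuousMap.id P.theta), ∀ h ∈ P.aut hN,
    (h : C(P.theta, P.theta)) = φ → h ∈ P.pureAut hN := by
  obtain ⟨U, hU, hdisj⟩ := P.finite_points.t2_separation
  have hW : ∀ p, ∃ W : Set X, IsOpen W ∧ p ∈ W ∧ closure W ⊆ U p ∧ IsPreconnected (W \ {p}) :=
    fun p => exists_punctured_nhds ((hU p).2.mem_nhds (hU p).1)
  choose W hWo hpW hWU hWc using hW
  have hdisj' : ∀ p ∈ P.points, ∀ q ∈ P.points, ∀ x, x ∈ U p → x ∈ U q → p = q := by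
    intro p hp q hq x hxp hxq
    by_contra hne
    exact (disjoint_left.1 (hdisj hp hq hne)) hxp hxq
  have hx : ∀ p, ∃ x : P.theta, (x : X) ∈ W p := fun p => by
    obtain ⟨x, hx1, hx2⟩ := ((eventually_mem_theta (P := P) p).and
      (eventually_nhdsWithin_of_eventually_nhds ((hWo p).mem_nhds (hpW p)))).exists
    exact ⟨⟨x, hx1⟩, hx2⟩
  choose y hy using hx
  -- If the image of this compact set avoids the closures of all `W p`, then no point that `h` maps
  -- into some `W p` lies in `K`.
  set K : Set X := (⋃ p ∈ P.points, U p)ᶜ with hK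
  have hKc : IsClosed K := (isOpen_biUnion fun p _ => (hU p).2).isClosed_compl
  have hKcomp := isCompact_preimage_coe (P := P) hKc fun x hx hxP =>
    hx (mem_biUnion hxP (hU x).1)
  set O : Set X := (⋃ p ∈ P.points, closure (W p))ᶜ with hO
  have hOo : IsOpen O :=
    (P.finite_points.isClosed_biUnion fun p _ => isClosed_closure).isOpen_compl
  have hKO : K ⊆ O := compl_subset_compl.2 (biUnion_mono subset_rfl fun p _ => hWU p)
  have ev1 := ContinuousMap.eventually_mapsTo (f := ContinuousMap.id P.theta) hKcomp
    (hOo.preimage continuous_subtype_val) fun x hx => hKO hx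
  have ev2 : ∀ᶠ φ in 𝓝 (ContinuousMap.id P.theta), ∀ p ∈ P.points, (φ (y p) : X) ∈ W p := by
    rw [P.finite_points.eventually_all]
    intro p _
    have hc : Continuous fun φ : C(P.theta, P.theta) => (φ (y p) : X) := by fun_prop
    exact ((hWo p).preimage hc).mem_nhds (hy p)
  filter_upwards [ev1, ev2] with φ h1 h2 h hh hφ
  have hφ' : ∀ x, φ x = h x := fun x => by rw [← hφ]; rfl
  have key : ∀ p ∈ P.points, ∀ x : P.theta, (h x : X) ∈ W p → (x : X) ∈ U p := by
    intro p hp x hxW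
    -- The preimage of the punctured disc at `p` is connected and contained in the disjoint union of
    -- the `U q`, so it lies in one of them; the sample point `y p`, mapped into `W p`, shows that
    -- it is `U p`.
    set S : Set X := (fun z : P.theta => (h.symm z : X)) '' (((↑) : P.theta → X) ⁻¹' W p) with hS
    have hSc : IsPreconnected S := by
      refine IsPreconnected.image ?_ _ (by fun_prop)
      rw [← Topology.IsInducing.subtypeVal.isPreconnected_image]
      convert hWc p using 1
      ext z
      constructor
      · rintro ⟨z, hz, rfl⟩
        exact ⟨hz, fun h => z.2 (by rw [mem_singleton_iff] at h; rwa [h])⟩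
      · rintro ⟨hz, hne⟩
        refine ⟨⟨z, fun hzP => hne ?_⟩, hz, rfl⟩
        exact hdisj' z hzP p hp z (hU z).1 (hWU p (subset_closure hz))
    have hSU : S ⊆ U p ∪ ⋃ q ∈ P.points \ {p}, U q := by
      rintro _ ⟨z, hz, rfl⟩
      by_contra hcon
      have hzK : (h.symm z : X) ∈ K := by
        intro hmem
        obtain ⟨q, hq, hmem⟩ := mem_iUnion₂.1 hmem
        refine hcon ?_
        by_cases hqp : q = p
        · subst hqp; exact Or.inl hmem
        · exact Or.inr (mem_biUnion (show q ∈ P.points \ {p} from ⟨hq, hqp⟩) hmem)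
      have h3 := h1 hzK
      rw [mem_preimage, hφ', h.apply_symm_apply] at h3
      exact h3 (mem_biUnion hp (subset_closure hz))
    have hSsub : S ⊆ U p := by
      refine hSc.subset_left_of_subset_union (hU p).2 (isOpen_biUnion fun q _ => (hU q).2) ?_
        hSU ⟨y p, ⟨h (y p), ?_, by simp⟩, hWU p (subset_closure (hy p))⟩
      · rw [disjoint_left]
        intro z hz hz'
        obtain ⟨q, hq, hmem⟩ := mem_iUnion₂.1 hz'
        exact hq.2 (hdisj' q hq.1 p hp z hmem hz)
      · rw [mem_preimage, ← hφ']
        exact h2 p hp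
    exact hSsub ⟨h x, hxW, by simp⟩
  have hUn : ∀ p ∈ P.points, U p ∈ 𝓝 p := fun p _ => (hU p).2.mem_nhds (hU p).1
  have hWn : ∀ p ∈ P.points, W p ∈ 𝓝 p := fun p _ => (hWo p).mem_nhds (hpW p)
  have ht : ∀ p ∈ P.points, Tendsto h (comap ((↑) : P.theta → X) (𝓝 p))
      (comap ((↑) : P.theta → X) (𝓝 p)) := fun p hp =>
    tendsto_of_forall_mem hUn hWn hdisj' key hp
  -- The continuity of `h` at the punctures, just obtained, supplies the neighbourhoods needed to
  -- repeat the argument for the inverse.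
  have hW' : ∀ p, ∃ W' : Set X, p ∈ P.points →
      W' ∈ 𝓝 p ∧ ∀ x : P.theta, (x : X) ∈ W' → (h x : X) ∈ U p := fun p => by
    by_cases hp : p ∈ P.points
    · obtain ⟨A, hA, hAB⟩ := mem_comap.1 (ht p hp (preimage_mem_comap (hUn p hp)))
      exact ⟨A, fun _ => ⟨hA, fun x hx => hAB hx⟩⟩
    · exact ⟨∅, fun h => absurd h hp⟩
  choose W' hW' using hW'
  refine ⟨hh, fun p hp => ⟨ht p hp, tendsto_of_forall_mem (h := h.symm) hUn
    (fun q hq => (hW' q hq).1) hdisj' (fun q hq x hx => ?_) hp⟩⟩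
  simpa using (hW' q hq).2 _ hx

end Punctures

end Small

/-! ### Discrete automorphism groups -/

section Discrete

variable {X : Type*} [TopologicalSpace X] [T2Space X] [CompactSpace X] [ConnectedSpace X]
  [ChartedSpace ℂ X] [IsManifold 𝓘(ℂ) ω X] {N : X → X} {sp sm tp tm : ℕ}
  {P : Punctures N sp sm tp tm} {hN : Function.Involutive N}

/-- If the automorphisms of `X` that fix the punctures have bounded order, then the automorphism
group of `Θ` is discrete. -/
theorem Punctures.hasRealDim_zero_of_pow_eq_one {G : Subgroup (P.theta ≃ₜ P.theta)}
    (hG : G ≤ P.aut hN) {E : ℕ} (hE : 1 ≤ E)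
    (h : ∀ k ∈ biholAut X, (∀ p ∈ P.points, k p = p) → k ^ E = 1) : HasRealDim G 0 := by
  obtain ⟨x₀, hx₀⟩ := (eventually_mem_theta (P := P) (Classical.arbitrary X)).exists
  have hxs := mem_chart_source ℂ x₀
  set e := chartAt ℂ x₀ with he
  set c := e x₀ with hc
  have ev1 : ∀ᶠ z in 𝓝 c, e.symm z ∈ P.theta :=
    (e.eventually_nhds' (fun y => y ∈ P.theta) hxs).2 (P.theta.isOpen.mem_nhds hx₀)
  obtain ⟨r, hr, hball⟩ := Metric.nhds_basis_closedBall.eventually_iff.1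
    (ev1.and (e.open_target.mem_nhds (e.map_source hxs)))
  have hsub : Metric.closedBall c r ⊆ e.target := fun z hz => (hball hz).2
  have hKc : IsCompact (e.symm '' Metric.closedBall c r) :=
    (isCompact_closedBall c r).image_of_continuousOn (e.continuousOn_symm.mono hsub)
  have hK : IsCompact (((↑) : P.theta → X) ⁻¹' (e.symm '' Metric.closedBall c r)) :=
    isCompact_preimage_coe hKc.isClosed (by rintro _ ⟨z, hz, rfl⟩; exact (hball hz).1)
  have hOX : IsOpen {q : X × X | q ∈ e.source ×ˢ e.source ∧ ‖e q.2 - e q.1‖ < r / 8} := by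
    have hcont : ContinuousOn (fun q : X × X => ‖e q.2 - e q.1‖) (e.source ×ˢ e.source) :=
      ((e.continuousOn.comp continuousOn_snd fun q hq => hq.2).sub
        (e.continuousOn.comp continuousOn_fst fun q hq => hq.1)).norm
    exact hcont.isOpen_inter_preimage (e.open_source.prod e.open_source) isOpen_Iio
  set O : Set (P.theta × P.theta) := (fun q => ((q.1 : X), (q.2 : X))) ⁻¹'
    {q : X × X | q ∈ e.source ×ˢ e.source ∧ ‖e q.2 - e q.1‖ < r / 8}
  have hO : IsOpen O := hOX.preimage (by fun_prop)
  -- Closeness is imposed on all iterates below `E` over a compact disc contained in `Θ`, as the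
  -- averaging argument requires.
  have ev2 : ∀ᶠ φ : C(P.theta, P.theta) in 𝓝 (ContinuousMap.id P.theta),
      ∀ i ∈ Finset.range E, ∀ y ∈ (((↑) : P.theta → X) ⁻¹' (e.symm '' Metric.closedBall c r)),
      (y, φ^[i] y) ∈ O := by
    rw [Filter.eventually_all_finset]
    intro i _
    refine eventually_iterate_mapsTo hK hO ?_ i
    rintro y ⟨z, hz, hzy⟩
    have hys : (y : X) ∈ e.source := by rw [← hzy]; exact e.map_target (hsub hz)
    exact ⟨⟨hys, hys⟩, by simpa using hr⟩
  refine hasRealDim_zero ?_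
  filter_upwards [ev2, eventually_mem_pureAut (P := P) (hN := hN)] with φ h1 h2 h' hh' hφ
  obtain ⟨k, hk, hkh, hkp, -⟩ := exists_extension (h2 h' (hG hh') hφ)
  have hφ' : ∀ x, φ x = h' x := fun x => by rw [← hφ]; rfl
  have hiter : ∀ (i : ℕ) (x : P.theta), ((φ^[i] x : P.theta) : X) = (k ^ i) x := by
    intro i
    induction i with
    | zero => intro x; rfl
    | succ i ih =>
      intro x
      rw [Function.iterate_succ_apply, ih, pow_succ, Homeomorph.mul_apply, hkh, hφ']
  have hev : ∀ᶠ y in 𝓝 x₀, k y = y := by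
    refine eventually_eq_self_of_pow_eq_one hk hE (h k hk hkp) hr
      (Metric.ball_subset_closedBall.trans hsub) fun i hi z hz => ?_
    have hz' := Metric.ball_subset_closedBall hz
    obtain ⟨h3, h4⟩ := h1 i (Finset.mem_range.2 hi) ⟨e.symm z, (hball hz').1⟩ ⟨z, hz', rfl⟩
    dsimp only at h3 h4
    rw [hiter] at h3 h4
    rw [e.right_inv (hsub hz')] at h4
    exact ⟨h3.2, h4.le⟩
  have hk1 := eq_one_of_eventually hk hev
  ext x
  rw [← hkh, hk1]
  rfl

end Discrete

/-! ### Real coordinates on a surface of genus zero -/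

section RealCoordinates

variable {X : Type*} [TopologicalSpace X] [T2Space X] [CompactSpace X] [ConnectedSpace X]
  [ChartedSpace ℂ X] [IsManifold 𝓘(ℂ) ω X] {N : X → X} {p : X} {f : X → ℂ}

/-- In genus zero there are no gaps, so pole order one is realised. -/
theorem exists_simplePole (hg : HasGenus X 0) (p : X) :
    ∃ f, HasPole f p 1 ∧ ∀ x, x ≠ p → HolAt f x := by
  obtain ⟨-, f, hf⟩ := exists_hasPole hg p (γ := fun _ => 1)
    (fun i j _ => Subsingleton.elim (α := Fin 1) i j) fun _ => le_rfl
  exact hf.exists_holAt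

/-- A function with a simple pole at `p` is unique up to affine maps. -/
theorem exists_affine (hf : HasPole f p 1) (hhol : ∀ x, x ≠ p → HolAt f x) {w : X → ℂ}
    (hw : HasPole w p 1) (hwhol : ∀ x, x ≠ p → HolAt w x) :
    ∃ a b : ℂ, a ≠ 0 ∧ ∀ x, x ≠ p → w x = a * f x + b := by
  obtain ⟨a, ha, -, hlt⟩ := exists_ordAt_sub_smul_lt (hw.mer p) (hf.mer p)
    (by rw [hw.ord_eq, hf.ord_eq]) (by rw [hf.ord_eq]; exact WithTop.coe_ne_top)
  have hm : Mer (w - a • f) := hw.mer.sub (hf.mer.smul a)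
  obtain ⟨b, hb⟩ := exists_eventuallyEq_const_of_ordAt_nonneg hm fun x => by
    by_cases hx : x = p
    · subst hx
      rw [hf.ord_eq] at hlt
      cases h : ordAt (w - a • f) x with
      | top => exact le_top
      | coe n =>
        rw [h] at hlt
        have : (-((1 : ℕ) : ℤ)) < n := by exact_mod_cast hlt
        exact_mod_cast (by omega : 0 ≤ n)
    · exact ((hwhol x hx).sub ((hhol x hx).smul a)).ordAt_nonneg
  refine ⟨a, b, ha, fun x hx => ?_⟩
  have := HolAt.eq_of_eventuallyEq ((hwhol x hx).sub ((hhol x hx).smul a)) (holAt_const b) (hb x)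
  simp only [Pi.sub_apply, Pi.smul_apply, smul_eq_mul] at this
  rw [← this]; ring

/-- An automorphism of a surface of genus zero with three fixed points is the identity. -/
theorem eq_one_of_three_fixed (hg : HasGenus X 0) {k : X ≃ₜ X} (hk : k ∈ biholAut X) {a b : X}
    (hpa : a ≠ p) (hpb : b ≠ p) (hab : a ≠ b) (hp : k p = p) (ha : k a = a) (hb : k b = b) :
    k = 1 := by
  obtain ⟨f, hf, hhol⟩ := exists_simplePole hg p
  have hne : ∀ x, x ≠ p → k x ≠ p := fun x hx h => hx (k.injective (h.trans hp.symm))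
  have hw : HasPole (f ∘ k) p 1 := ⟨hf.mer.comp_bihol hk, fun x hx => by
    rw [ordAt_comp_bihol hk]; exact hf.nonneg _ (hne x hx), by
    rw [ordAt_comp_bihol hk, hp]; exact hf.ord_eq⟩
  obtain ⟨c, d, -, hcd⟩ := exists_affine hf hhol hw fun x hx => (hhol _ (hne x hx)).comp_bihol hk
  have h1 := hcd a hpa
  have h2 := hcd b hpb
  simp only [Function.comp_apply, ha, hb] at h1 h2
  have hfab : f a - f b ≠ 0 := sub_ne_zero.2 fun h =>
    hab (simplePole_injective hf hhol hg hpa hpb h)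
  have hc : c = 1 := mul_right_cancel₀ hfab (by linear_combination h2 - h1)
  have hd : d = 0 := by rw [hc] at h1; linear_combination -h1
  ext x
  by_cases hx : x = p
  · rw [hx, hp]; rfl
  · refine simplePole_injective hf hhol hg (hne x hx) hx ?_
    have := hcd x hx
    rw [hc, hd, one_mul, add_zero] at this
    exact this

/-- In charts the function is the composite of `conj ∘ f ∘ conj` with `conj ∘ N`, and both are
complex differentiable. -/
theorem IsAntiholomorphic.mdifferentiableAt (hN : IsAntiholomorphic N) {x : X}
    (hf : MDifferentiableAt 𝓘(ℂ) 𝓘(ℂ) f (N x)) :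
    MDifferentiableAt 𝓘(ℂ) 𝓘(ℂ) (fun y => conj (f (N y))) x := by
  have hx := mem_chart_source ℂ x
  have hNx := mem_chart_source ℂ (N x)
  rw [mdifferentiableAt_iff_chart hNx] at hf
  rw [mdifferentiableAt_iff_chart hx]
  have h1 := hN.2 x
  simp only [writtenInExtChartAt, mfld_simps] at h1
  have h2 : DifferentiableAt ℂ (conj ∘ (f ∘ (chartAt ℂ (N x)).symm) ∘ conj)
      (conj (chartAt ℂ (N x) (N x))) := by
    refine DifferentiableAt.star_star ?_
    simpa using hf
  have h3 := DifferentiableAt.comp (chartAt ℂ x x)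
    (g := conj ∘ (f ∘ (chartAt ℂ (N x)).symm) ∘ conj)
    (by rw [(chartAt ℂ x).left_inv hx]; exact h2) h1
  refine h3.congr_of_eventuallyEq ?_
  have h4 : ∀ᶠ y in 𝓝 x, N y ∈ (chartAt ℂ (N x)).source :=
    hN.1.continuousAt.preimage_mem_nhds ((chartAt ℂ (N x)).open_source.mem_nhds hNx)
  filter_upwards [((chartAt ℂ x).eventually_nhds'
    (fun y => N y ∈ (chartAt ℂ (N x)).source) hx).2 h4] with z hz
  simp [(chartAt ℂ (N x)).left_inv hz]

theorem IsAntiholomorphic.holAt (hN : IsAntiholomorphic N) {x : X} (hf : HolAt f (N x)) :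
    HolAt (fun y => conj (f (N y))) x := by
  rw [holAt_iff] at hf ⊢
  filter_upwards [hN.1.continuousAt.eventually hf] with y hy using hN.mdifferentiableAt hy

/-- A coordinate on `X` with a simple pole at the fixed point `p` of `N` and real with respect to
`N`. -/
structure RealCoord (N : X → X) (p : X) (f : X → ℂ) : Prop where
  fixed : N p = p
  pole : HasPole f p 1
  hol : ∀ x, x ≠ p → HolAt f x
  real : ∀ x, x ≠ p → f (N x) = conj (f x)

theorem HasPole.affine (hf : HasPole f p 1) {a : ℂ} (ha : a ≠ 0) (b : ℂ) :
    HasPole (fun x => a * f x + b) p 1 := by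
  have h1 : (fun x => a * f x + b) = a • (f - fun _ => -(a⁻¹ * b)) := by
    funext x
    simp only [Pi.smul_apply, Pi.sub_apply, smul_eq_mul]
    field_simp
    ring
  have hm : Mer (f - fun _ => -(a⁻¹ * b)) := hf.mer.sub (mer_const _)
  rw [h1]
  refine ⟨hm.smul a, fun x hx => ?_, ?_⟩
  · exact le_ordAt_smul (hm x) (le_ordAt_sub (hf.mer x) (merAt_const _) (hf.nonneg x hx)
      (holAt_const _).ordAt_nonneg)
  · rw [ordAt_smul ha (hm p), hf.ordAt_sub_const le_rfl]

theorem HolAt.affine {x : X} (hf : HolAt f x) (a b : ℂ) : HolAt (fun x => a * f x + b) x :=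
  (hf.smul a).add (holAt_const b)

theorem RealCoord.affine (hf : RealCoord N p f) {a : ℝ} (ha : a ≠ 0) (b : ℝ) :
    RealCoord N p fun x => a * f x + b :=
  ⟨hf.fixed, hf.pole.affine (by exact_mod_cast ha) b, fun x hx => (hf.hol x hx).affine a b,
    fun x hx => by simp [hf.real x hx]⟩

/-- At a pole, `f⁻¹` with the value zero filled in is holomorphic; its conjugate pullback is
holomorphic, and inverting it returns the function sought. -/
theorem merAt_conj_comp (hN : IsAntiholomorphic N) {x : X} (hf : MerAt f (N x))
    (hneg : ordAt f (N x) < 0) (hinj : Function.Injective N) :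
    MerAt (fun y => conj (f (N y))) x := by
  classical
  set u : X → ℂ := Function.update f⁻¹ (N x) 0 with hu
  have hfu : f⁻¹ =ᶠ[𝓝[≠] (N x)] u := by
    filter_upwards [self_mem_nhdsWithin] with y hy
    rw [hu, Function.update_of_ne hy]
  have huh : HolAt u (N x) := by
    refine (hf.inv.congr hfu).holAt ?_
    rw [continuousAt_iff_punctured_nhds, hu, Function.update_self, ← hu]
    refine Tendsto.congr' hfu ((tendsto_zero_iff_ordAt_pos hf.inv).2 ?_)
    rw [ordAt_inv]
    cases h : ordAt f (N x) with
    | top => rw [h] at hneg; simp at hneg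
    | coe n =>
      rw [h] at hneg
      have : n < 0 := by exact_mod_cast hneg
      have h' : (0 : ℤ) < -n := by omega
      exact_mod_cast h'
  refine (hN.holAt huh).merAt.inv.congr ?_
  filter_upwards [self_mem_nhdsWithin] with y hy
  simp [hu, Function.update_of_ne (hinj.ne hy)]

/-- Every fixed point of the involution is the pole of a real coordinate. -/
theorem exists_realCoord (hg : HasGenus X 0) (hN : IsBrakeInvolution N) (hp : N p = p) :
    ∃ f, RealCoord N p f := by
  obtain ⟨f, hf, hhol⟩ := exists_simplePole hg p
  have hNne : ∀ x, x ≠ p → N x ≠ p := fun x hx h =>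
    hx (hN.involutive.injective (h.trans hp.symm))
  set w : X → ℂ := fun y => conj (f (N y)) with hw
  have hwhol : ∀ x, x ≠ p → HolAt w x := fun x hx => hN.antiholomorphic.holAt (hhol _ (hNne x hx))
  have hwp : MerAt w p := by
    refine merAt_conj_comp hN.antiholomorphic (by rw [hp]; exact hf.mer p) ?_
      hN.involutive.injective
    rw [hp, hf.ord_eq]
    exact_mod_cast (by norm_num : (-((1 : ℕ) : ℤ)) < 0)
  have hwm : Mer w := fun x => by
    by_cases hx : x = p
    · rw [hx]; exact hwp
    · exact (hwhol x hx).merAt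
  obtain ⟨n, hn⟩ : ∃ n : ℕ, ((-(n : ℤ) : ℤ) : WithTop ℤ) ≤ ordAt w p := by
    cases h : ordAt w p with
    | top => exact ⟨0, le_top⟩
    | coe m => exact ⟨m.natAbs, by exact_mod_cast (by omega : -(m.natAbs : ℤ) ≤ m)⟩
  obtain ⟨Q, hQ⟩ := exists_polynomial hf n w hwm (fun x hx => (hwhol x hx).ordAt_nonneg) hn
  have hQ' : ∀ x, x ≠ p → w x = Q.eval (f x) := fun x hx => by
    refine tendsto_nhds_unique ((hwhol x hx).tendsto.congr' (hQ x)) ?_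
    exact (Q.continuous.tendsto _).comp (hhol x hx).tendsto
  -- The involution applied twice shows that `Q`, followed by its conjugate polynomial, is the
  -- identity. This forces degree one without computing the order of `w` at `p`.
  have hcomp : (Q.map (starRingEnd ℂ)).comp Q = Polynomial.X := by
    refine Polynomial.funext fun c => ?_
    obtain ⟨q, hq, rfl⟩ := simplePole_surjective hf hhol c
    rw [Polynomial.eval_comp, ← hQ' q hq, Polynomial.eval_X, hw, Polynomial.eval_map,
      Polynomial.eval₂_at_apply, ← hQ' _ (hNne q hq), hw]
    simp [hN.involutive q]
  have hdeg : Q.natDegree = 1 := by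
    have := congrArg Polynomial.natDegree hcomp
    rw [Polynomial.natDegree_comp, Polynomial.natDegree_map, Polynomial.natDegree_X] at this
    exact Nat.eq_one_of_mul_eq_one_right this
  obtain ⟨a, ha, b, hab⟩ := Polynomial.natDegree_eq_one.1 hdeg
  have hwab : ∀ x, x ≠ p → w x = a * f x + b := fun x hx => by rw [hQ' x hx, ← hab]; simp
  have hww : ∀ x, w (N x) = conj (f x) := fun x => by simp [hw, hN.involutive x]
  have hfN : ∀ x, f (N x) = conj (w x) := fun x => by simp [hw]
  -- The natural real function is `f + w = (1 + a) f + b`. It is constant when `a = -1`, and then `I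
  -- * (f - w)` is used.
  by_cases h1 : 1 + a = 0
  · have ha' : a = -1 := by linear_combination h1
    have h2 : (2 * Complex.I) ≠ 0 := by simp
    refine ⟨fun x => (2 * Complex.I) * f x + -(Complex.I * b), hp, hf.affine h2 _,
      fun x hx => (hhol x hx).affine _ _, fun x hx => ?_⟩
    have h3 : ∀ y, y ≠ p → 2 * Complex.I * f y + -(Complex.I * b) =
        Complex.I * (f y - w y) := fun y hy => by rw [hwab y hy, ha']; ring
    rw [h3 _ (hNne x hx), h3 x hx, hww, hfN]
    simp
    ring
  · refine ⟨fun x => (1 + a) * f x + b, hp, hf.affine h1 _, fun x hx => (hhol x hx).affine _ _,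
      fun x hx => ?_⟩
    have h3 : ∀ y, y ≠ p → (1 + a) * f y + b = f y + w y := fun y hy => by rw [hwab y hy]; ring
    rw [h3 _ (hNne x hx), h3 x hx, hww, hfN]
    simp
    ring

end RealCoordinates

/-! ### Möbius transformations of a surface of genus zero -/

section Moebius

variable {X : Type*} [TopologicalSpace X] [T2Space X] [CompactSpace X] [ConnectedSpace X]
  [ChartedSpace ℂ X] [IsManifold 𝓘(ℂ) ω X] {N : X → X} {p : X} {f : X → ℂ}

namespace RealCoord

/-- The inverse of a real coordinate. -/
def inv (hf : RealCoord N p f) (c : ℂ) : X := (simplePole_surjective hf.pole hf.hol c).choose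

theorem inv_ne (hf : RealCoord N p f) (c : ℂ) : hf.inv c ≠ p :=
  (simplePole_surjective hf.pole hf.hol c).choose_spec.1

theorem apply_inv (hf : RealCoord N p f) (c : ℂ) : f (hf.inv c) = c :=
  (simplePole_surjective hf.pole hf.hol c).choose_spec.2

theorem injective (hf : RealCoord N p f) (hg : HasGenus X 0) {x y : X} (hx : x ≠ p) (hy : y ≠ p)
    (h : f x = f y) : x = y := simplePole_injective hf.pole hf.hol hg hx hy h

theorem inv_apply (hf : RealCoord N p f) (hg : HasGenus X 0) {x : X} (hx : x ≠ p) :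
    hf.inv (f x) = x := hf.injective hg (hf.inv_ne _) hx (hf.apply_inv _)

theorem map_ne (hf : RealCoord N p f) (hN : Function.Involutive N) {x : X} (hx : x ≠ p) :
    N x ≠ p := fun h => hx (hN.injective (h.trans hf.fixed.symm))

theorem map_inv (hf : RealCoord N p f) (hg : HasGenus X 0) (hN : Function.Involutive N) (c : ℂ) :
    N (hf.inv c) = hf.inv (conj c) :=
  hf.injective hg (hf.map_ne hN (hf.inv_ne c)) (hf.inv_ne _)
    (by rw [hf.real _ (hf.inv_ne c), hf.apply_inv, hf.apply_inv])

/-- `f` takes each value with multiplicity one, so it has a holomorphic local inverse at `q`; global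
injectivity identifies this with `hf.inv` near `c`. -/
theorem mdifferentiableAt_inv (hf : RealCoord N p f) (hg : HasGenus X 0) (c : ℂ) :
    MDifferentiableAt 𝓘(ℂ) 𝓘(ℂ) hf.inv c := by
  have := isManifold_one (X := X)
  set q := hf.inv c with hq
  have hqp : q ≠ p := hf.inv_ne c
  have hqs := mem_chart_source ℂ q
  set φ := chartAt ℂ q with hφ
  have ho : ordAt (f - fun _ => f q) q = 1 := simplePole_ordAt hf.pole hf.hol hg hqp
  have hm : MerAt (f - fun _ => f q) q := (hf.hol q hqp).merAt.sub (merAt_const _)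
  obtain ⟨u, hu, hu0, hut⟩ := (meromorphicOrderAt_eq_int_iff (n := 1) hm).1 ho
  have hfa : AnalyticAt ℂ (f ∘ φ.symm) (φ q) := hf.hol q hqp
  have hfq : (f ∘ φ.symm) (φ q) = c := by
    simp only [Function.comp_apply]
    rw [φ.left_inv hqs, hq, hf.apply_inv]
  have hev : f ∘ φ.symm =ᶠ[𝓝 (φ q)] fun z => c + (z - φ q) * u z := by
    rw [EventuallyEq, ← nhdsNE_sup_pure, eventually_sup]
    constructor
    · filter_upwards [hut] with z hz
      simp only [Function.comp_apply, Pi.sub_apply, zpow_one, smul_eq_mul] at hz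
      rw [hq, hf.apply_inv] at hz
      rw [← hz, Function.comp_apply]; ring
    · rw [eventually_pure, hfq]; ring
  have hd : HasDerivAt (fun z => c + (z - φ q) * u z) (1 * u (φ q) + (φ q - φ q) * deriv u (φ q))
      (φ q) :=
    (((hasDerivAt_id _).sub_const _).mul hu.differentiableAt.hasDerivAt).const_add c
  have hsd : HasStrictDerivAt (f ∘ φ.symm) (u (φ q)) (φ q) := by
    have h1 := hfa.hasStrictDerivAt
    rwa [hev.deriv_eq, hd.deriv, sub_self, zero_mul, add_zero, one_mul] at h1
  set ψ := hsd.localInverse (f ∘ φ.symm) _ _ hu0 with hψ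
  have hψd : HasStrictDerivAt ψ (u (φ q))⁻¹ c := by
    have := hsd.to_localInverse hu0
    rwa [hfq] at this
  have hψc : ψ c = φ q := by
    rw [← hfq]
    exact (hsd.hasStrictFDerivAt_equiv hu0).localInverse_apply_image
  have hright : ∀ᶠ z in 𝓝 c, (f ∘ φ.symm) (ψ z) = z := by
    have := (hsd.hasStrictFDerivAt_equiv hu0).eventually_right_inverse
    rwa [hfq] at this
  have hcs : ContinuousAt (φ.symm ∘ ψ) c := by
    refine ContinuousAt.comp ?_ hψd.hasDerivAt.continuousAt
    rw [hψc]
    exact φ.symm.continuousAt (φ.map_source hqs)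
  have hval : (φ.symm ∘ ψ) c = q := by rw [Function.comp_apply, hψc, φ.left_inv hqs]
  have heq : hf.inv =ᶠ[𝓝 c] φ.symm ∘ ψ := by
    filter_upwards [hright, hcs.eventually_ne (by rw [hval]; exact hqp)] with z h1 h2
    exact hf.injective hg (hf.inv_ne z) h2 (by rw [hf.apply_inv]; exact h1.symm)
  refine MDifferentiableAt.congr_of_eventuallyEq ?_ heq
  refine MDifferentiableAt.comp c (I' := 𝓘(ℂ)) ?_
    (mdifferentiableAt_iff_differentiableAt.2 hψd.hasDerivAt.differentiableAt)
  rw [hψc]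
  exact (mdifferentiable_chart q).symm.mdifferentiableAt (φ.map_source hqs)

theorem continuous_inv (hf : RealCoord N p f) (hg : HasGenus X 0) : Continuous hf.inv :=
  continuous_iff_continuousAt.2 fun c => (hf.mdifferentiableAt_inv hg c).continuousAt

theorem continuousOn (hf : RealCoord N p f) : ContinuousOn f {p}ᶜ := fun x hx =>
  (hf.hol x hx).continuousAt.continuousWithinAt

/-- Off a neighbourhood of `p` the surface is compact and `f` bounded, so points with large value of
`f` are close to `p`. -/
theorem tendsto_inv (hf : RealCoord N p f) : Tendsto hf.inv (Bornology.cobounded ℂ) (𝓝 p) := by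
  rw [tendsto_def]
  intro U hU
  have hK : IsCompact (interior U)ᶜ := isOpen_interior.isClosed_compl.isCompact
  have hb := (hK.image_of_continuousOn (hf.continuousOn.mono fun x hx hxp => hx (by
    rw [mem_singleton_iff] at hxp
    rw [hxp]
    exact mem_interior_iff_mem_nhds.2 hU))).isBounded
  filter_upwards [Bornology.isBounded_def.1 hb] with z hz
  by_contra hcon
  exact hz ⟨hf.inv z, fun h => hcon (show hf.inv z ∈ U from interior_subset h), hf.apply_inv z⟩

theorem tendsto_cobounded (hf : RealCoord N p f) :
    Tendsto f (𝓝[≠] p) (Bornology.cobounded ℂ) := by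
  rw [tendsto_cobounded_iff_ordAt_neg (hf.pole.mer p), hf.pole.ord_eq]
  exact_mod_cast (by norm_num : (-((1 : ℕ) : ℤ)) < 0)

/-- The point with homogeneous coordinates `v`. -/
def proj (hf : RealCoord N p f) (v : Fin 2 → ℂ) : X :=
  if v 1 = 0 then p else hf.inv (v 0 / v 1)

open Classical in
/-- Homogeneous coordinates of a point. -/
def lift (_ : RealCoord N p f) (x : X) : Fin 2 → ℂ := if x = p then ![1, 0] else ![f x, 1]

theorem lift_self (hf : RealCoord N p f) : hf.lift p = ![1, 0] := if_pos rfl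

theorem lift_of_ne (hf : RealCoord N p f) {x : X} (hx : x ≠ p) : hf.lift x = ![f x, 1] :=
  if_neg hx

theorem lift_ne_zero (hf : RealCoord N p f) (x : X) : hf.lift x ≠ 0 := by
  by_cases hx : x = p
  · rw [hx, lift_self]; intro h; simpa using congrFun h 0
  · rw [hf.lift_of_ne hx]; intro h; simpa using congrFun h 1

theorem proj_lift (hf : RealCoord N p f) (hg : HasGenus X 0) (x : X) : hf.proj (hf.lift x) = x := by
  by_cases hx : x = p
  · rw [hx, lift_self]; simp [proj]
  · rw [hf.lift_of_ne hx]; simp [proj, hf.inv_apply hg hx]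

theorem proj_smul (hf : RealCoord N p f) {c : ℂ} (hc : c ≠ 0) (v : Fin 2 → ℂ) :
    hf.proj (c • v) = hf.proj v := by
  simp [proj, hc, mul_div_mul_left]

theorem exists_lift_proj (hf : RealCoord N p f) {v : Fin 2 → ℂ} (hv : v ≠ 0) :
    ∃ c : ℂ, c ≠ 0 ∧ hf.lift (hf.proj v) = c • v := by
  by_cases h1 : v 1 = 0
  · have h0 : v 0 ≠ 0 := fun h0 => hv (by ext i; fin_cases i <;> simp [h0, h1])
    refine ⟨(v 0)⁻¹, inv_ne_zero h0, ?_⟩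
    rw [proj, if_pos h1, lift_self]
    ext i; fin_cases i <;> simp [h0, h1]
  · refine ⟨(v 1)⁻¹, inv_ne_zero h1, ?_⟩
    rw [proj, if_neg h1, hf.lift_of_ne (hf.inv_ne _), hf.apply_inv]
    ext i; fin_cases i <;> simp [h1, div_eq_inv_mul]

theorem map_proj (hf : RealCoord N p f) (hg : HasGenus X 0) (hN : Function.Involutive N)
    (v : Fin 2 → ℂ) : N (hf.proj v) = hf.proj fun i => conj (v i) := by
  by_cases h1 : v 1 = 0
  · simp [proj, h1, hf.fixed]
  · simp [proj, h1, hf.map_inv hg hN]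

theorem lift_map (hf : RealCoord N p f) (hN : Function.Involutive N) (x : X) :
    hf.lift (N x) = fun i => conj (hf.lift x i) := by
  by_cases hx : x = p
  · rw [hx, hf.fixed, lift_self]; ext i; fin_cases i <;> simp
  · rw [hf.lift_of_ne hx, hf.lift_of_ne (hf.map_ne hN hx), hf.real x hx]
    ext i; fin_cases i <;> simp

/-- Where the second coordinate vanishes, continuity is checked in the coordinate `v 1 / v 0`, the
reciprocal of the affine one. -/
theorem continuousAt_proj (hf : RealCoord N p f) (hg : HasGenus X 0) {v : Fin 2 → ℂ} (hv : v ≠ 0) :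
    ContinuousAt hf.proj v := by
  by_cases h1 : v 1 = 0
  · have h0 : v 0 ≠ 0 := fun h0 => hv (by ext i; fin_cases i <;> simp [h0, h1])
    have hE : ContinuousAt (fun z : ℂ => if z = 0 then p else hf.inv z⁻¹) 0 := by
      rw [continuousAt_iff_punctured_nhds, if_pos rfl]
      refine Tendsto.congr' ?_ (hf.tendsto_inv.comp Filter.tendsto_inv₀_nhdsNE_zero)
      filter_upwards [self_mem_nhdsWithin] with z hz
      rw [mem_compl_iff, mem_singleton_iff] at hz
      simp [hz]
    have hdiv : ContinuousAt (fun v : Fin 2 → ℂ => v 1 / v 0) v :=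
      (continuous_apply 1).continuousAt.div (continuous_apply 0).continuousAt h0
    have hcomp := ContinuousAt.comp_of_eq hE hdiv (by rw [h1, zero_div])
    refine hcomp.congr ?_
    filter_upwards [(continuous_apply (A := fun _ : Fin 2 => ℂ) 0).continuousAt.eventually_ne h0]
      with w hw
    by_cases hw1 : w 1 = 0
    · simp [proj, hw1]
    · simp [proj, hw1, hw]
  · have hdiv : ContinuousAt (fun v : Fin 2 → ℂ => v 0 / v 1) v :=
      (continuous_apply 0).continuousAt.div (continuous_apply 1).continuousAt h1
    refine ((hf.continuous_inv hg).continuousAt.comp hdiv).congr ?_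
    filter_upwards [(continuous_apply (A := fun _ : Fin 2 => ℂ) 1).continuousAt.eventually_ne h1]
      with w hw
    simp [proj, hw]

/-- The Möbius transformation with matrix `m`. -/
def moebius (hf : RealCoord N p f) (m : Matrix (Fin 2) (Fin 2) ℂ) (x : X) : X :=
  hf.proj (m.mulVec (hf.lift x))

theorem mulVec_lift_ne_zero (hf : RealCoord N p f) {m : Matrix (Fin 2) (Fin 2) ℂ} (hm : m.det ≠ 0)
    (x : X) : m.mulVec (hf.lift x) ≠ 0 := fun h =>
  hf.lift_ne_zero x (Matrix.eq_zero_of_mulVec_eq_zero hm h)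

theorem moebius_moebius (hf : RealCoord N p f) {m : Matrix (Fin 2) (Fin 2) ℂ} (hm : m.det ≠ 0)
    (n : Matrix (Fin 2) (Fin 2) ℂ) (x : X) :
    hf.moebius n (hf.moebius m x) = hf.moebius (n * m) x := by
  obtain ⟨c, hc, h⟩ := hf.exists_lift_proj (hf.mulVec_lift_ne_zero hm x)
  rw [moebius, moebius, moebius, h, Matrix.mulVec_smul, proj_smul _ hc, Matrix.mulVec_mulVec]

theorem moebius_one (hf : RealCoord N p f) (hg : HasGenus X 0) (x : X) : hf.moebius 1 x = x := by
  rw [moebius, Matrix.one_mulVec, hf.proj_lift hg]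

/-- The section `hf.lift` is not continuous at `p`, but only its class up to scalars matters. It is
replaced by a continuous local lift: `(1, 1 / f)` near `p` and `(f, 1)` elsewhere. Joint continuity
in matrix and point is what the compact-open topology needs. -/
theorem continuousAt_moebius (hf : RealCoord N p f) (hg : HasGenus X 0)
    {m : Matrix (Fin 2) (Fin 2) ℂ} (hm : m.det ≠ 0) (x : X) :
    ContinuousAt (fun q : Matrix (Fin 2) (Fin 2) ℂ × X => hf.moebius q.1 q.2) (m, x) := by
  classical
  suffices h : ∃ l : X → Fin 2 → ℂ, ContinuousAt l x ∧ l x = hf.lift x ∧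
      ∀ᶠ y in 𝓝 x, ∃ c : ℂ, c ≠ 0 ∧ hf.lift y = c • l y by
    obtain ⟨l, hl, hlx, hev⟩ := h
    have hmul : ContinuousAt (fun q : Matrix (Fin 2) (Fin 2) ℂ × X => q.1.mulVec (l q.2))
        (m, x) := by
      rw [continuousAt_pi]
      intro i
      simp only [Matrix.mulVec, dotProduct]
      refine tendsto_finsetSum _ fun j _ => ContinuousAt.mul ?_ ?_
      · exact (continuous_fst.matrix_elem i j).continuousAt
      · exact (continuousAt_pi.1 (ContinuousAt.comp (x := (m, x)) (f := Prod.snd) hl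
          continuousAt_snd) j)
    have hcomp := ContinuousAt.comp_of_eq
      (hf.continuousAt_proj hg (hf.mulVec_lift_ne_zero hm x)) hmul (by simp only [hlx])
    refine hcomp.congr ?_
    filter_upwards [(continuousAt_snd (p := (m, x))).eventually hev] with q hq
    obtain ⟨c, hc, h⟩ := hq
    simp only [Function.comp_apply, moebius]
    rw [h, Matrix.mulVec_smul, proj_smul _ hc]
  by_cases hx : x = p
  · subst hx
    set u : X → ℂ := Function.update f⁻¹ x 0 with hu
    have huc : ContinuousAt u x := by
      rw [continuousAt_iff_punctured_nhds, hu, Function.update_self, ← hu]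
      refine Tendsto.congr' ?_ (tendsto_inv₀_cobounded.comp hf.tendsto_cobounded)
      filter_upwards [self_mem_nhdsWithin] with y hy
      rw [hu, Function.update_of_ne hy]; rfl
    refine ⟨fun y => ![1, u y], ?_, ?_, ?_⟩
    · rw [continuousAt_pi]
      intro i
      fin_cases i
      · exact continuousAt_const
      · exact huc
    · rw [lift_self]; simp [hu]
    · have h0 : ∀ᶠ y in 𝓝[≠] x, f y ≠ 0 := by
        have h0 := hf.tendsto_cobounded.eventually
          (Bornology.isBounded_def.1 (Bornology.isBounded_singleton (x := (0 : ℂ))))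
        filter_upwards [h0] with y hy using hy
      rw [eventually_nhdsWithin_iff] at h0
      filter_upwards [h0] with y hy
      by_cases hyx : y = x
      · rw [hyx, lift_self]
        exact ⟨1, one_ne_zero, by simp [hu]⟩
      · refine ⟨f y, hy hyx, ?_⟩
        rw [hf.lift_of_ne hyx, hu, Function.update_of_ne hyx]
        ext i; fin_cases i <;> simp [hy hyx]
  · refine ⟨fun y => ![f y, 1], ?_, by rw [hf.lift_of_ne hx], ?_⟩
    · rw [continuousAt_pi]
      intro i
      fin_cases i
      · exact (hf.hol x hx).continuousAt
      · exact continuousAt_const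
    · filter_upwards [isOpen_ne.mem_nhds hx] with y hy
      exact ⟨1, one_ne_zero, by rw [hf.lift_of_ne hy, one_smul]⟩

theorem continuous_moebius (hf : RealCoord N p f) (hg : HasGenus X 0)
    {m : Matrix (Fin 2) (Fin 2) ℂ} (hm : m.det ≠ 0) : Continuous (hf.moebius m) :=
  continuous_iff_continuousAt.2 fun x => ContinuousAt.comp (x := x)
    (g := fun q : Matrix (Fin 2) (Fin 2) ℂ × X => hf.moebius q.1 q.2) (f := fun y => (m, y))
    (hf.continuousAt_moebius hg hm x) (by fun_prop)

/-- The Möbius transformation with invertible matrix `m`, as a homeomorphism. -/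
def moebiusHomeo (hf : RealCoord N p f) (hg : HasGenus X 0) {m : Matrix (Fin 2) (Fin 2) ℂ}
    (hm : m.det ≠ 0) : X ≃ₜ X where
  toFun := hf.moebius m
  invFun := hf.moebius m⁻¹
  left_inv x := by
    rw [hf.moebius_moebius hm, Matrix.nonsing_inv_mul _ (isUnit_iff_ne_zero.2 hm),
      hf.moebius_one hg]
  right_inv x := by
    have hm' : m⁻¹.det ≠ 0 := by
      rw [Matrix.det_nonsing_inv, Ring.inverse_eq_inv']; exact inv_ne_zero hm
    rw [hf.moebius_moebius hm', Matrix.mul_nonsing_inv _ (isUnit_iff_ne_zero.2 hm),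
      hf.moebius_one hg]
  continuous_toFun := hf.continuous_moebius hg hm
  continuous_invFun := hf.continuous_moebius hg (by
    rw [Matrix.det_nonsing_inv, Ring.inverse_eq_inv']; exact inv_ne_zero hm)

/-- Away from `p` and its preimage the map is a fractional linear expression in `f` followed by
`hf.inv`; the remaining points are removable singularities of a continuous map. -/
theorem mdifferentiable_moebius (hf : RealCoord N p f) (hg : HasGenus X 0)
    {m : Matrix (Fin 2) (Fin 2) ℂ} (hm : m.det ≠ 0) :
    MDifferentiable 𝓘(ℂ) 𝓘(ℂ) (hf.moebius m) := by
  have key : ∀ y, y ≠ p → hf.moebius m y ≠ p →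
      MDifferentiableAt 𝓘(ℂ) 𝓘(ℂ) (hf.moebius m) y := by
    intro y hy hmy
    have hd : m 1 0 * f y + m 1 1 ≠ 0 := by
      intro h
      refine hmy ?_
      rw [moebius, hf.lift_of_ne hy, proj, if_pos]
      simpa [Matrix.mulVec, dotProduct, Fin.sum_univ_two] using h
    have hden := (hf.hol y hy).affine (m 1 0) (m 1 1)
    have hq : HolAt ((fun x => m 0 0 * f x + m 0 1) * (fun x => m 1 0 * f x + m 1 1)⁻¹) y :=
      ((hf.hol y hy).affine (m 0 0) (m 0 1)).mul (hden.inv hd)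
    refine MDifferentiableAt.congr_of_eventuallyEq (MDifferentiableAt.comp y
      (hf.mdifferentiableAt_inv hg _) hq.mdifferentiableAt) ?_
    filter_upwards [isOpen_ne.mem_nhds hy, hden.continuousAt.eventually_ne hd] with z hz hz'
    rw [moebius, hf.lift_of_ne hz, proj, if_neg (by
      simpa [Matrix.mulVec, dotProduct, Fin.sum_univ_two] using hz')]
    simp [Matrix.mulVec, dotProduct, Fin.sum_univ_two, div_eq_mul_inv]
  intro x
  refine mdifferentiableAt_of_continuousAt (hf.continuous_moebius hg hm).continuousAt ?_
  have hfin : {y | ¬ (y ≠ p ∧ hf.moebius m y ≠ p)}.Finite := by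
    refine (toFinite {p, (hf.moebiusHomeo hg hm).symm p}).subset fun y hy => ?_
    rw [mem_ofPred_eq, not_and_or, not_not, not_not] at hy
    rcases hy with h | h
    · exact Or.inl h
    · right
      exact ((hf.moebiusHomeo hg hm).symm_apply_eq.2 h.symm).symm
  filter_upwards [eventually_nhdsNE_of_finite hfin x] with y hy using key y hy.1 hy.2

theorem moebiusHomeo_mem (hf : RealCoord N p f) (hg : HasGenus X 0)
    {m : Matrix (Fin 2) (Fin 2) ℂ} (hm : m.det ≠ 0) : hf.moebiusHomeo hg hm ∈ biholAut X :=
  ⟨hf.mdifferentiable_moebius hg hm, hf.mdifferentiable_moebius hg (by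
    rw [Matrix.det_nonsing_inv, Ring.inverse_eq_inv']; exact inv_ne_zero hm)⟩

theorem moebius_map (hf : RealCoord N p f) (hg : HasGenus X 0) (hN : Function.Involutive N)
    (m : Matrix (Fin 2) (Fin 2) ℝ) (x : X) :
    hf.moebius (m.map (↑)) (N x) = N (hf.moebius (m.map (↑)) x) := by
  rw [moebius, moebius, hf.map_proj hg hN, hf.lift_map hN]
  congr 1
  ext i
  simp [Matrix.mulVec, dotProduct, Fin.sum_univ_two]

end RealCoord

end Moebius

/-! ### Automorphism groups of punctured spheres -/

section Families

variable {X : Type*} [TopologicalSpace X] [T2Space X] [CompactSpace X] [ConnectedSpace X]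
  [ChartedSpace ℂ X] [IsManifold 𝓘(ℂ) ω X] {N : X → X} {p : X} {f : X → ℂ} {sp sm tp tm : ℕ}
  {P : Punctures N sp sm tp tm} {hN : Function.Involutive N}

attribute [local instance] compactOpenTopology

theorem det_map_ofReal (m : Matrix (Fin 2) (Fin 2) ℝ) :
    (m.map (↑) : Matrix (Fin 2) (Fin 2) ℂ).det = (m.det : ℂ) := by
  simp [Matrix.det_fin_two]

namespace RealCoord

theorem moebius_self (hf : RealCoord N p f) {m : Matrix (Fin 2) (Fin 2) ℂ} (h : m 1 0 = 0) :
    hf.moebius m p = p := by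
  rw [moebius, lift_self, proj, if_pos]
  simpa [Matrix.mulVec, dotProduct, Fin.sum_univ_two] using h

theorem moebius_of_ne (hf : RealCoord N p f) {m : Matrix (Fin 2) (Fin 2) ℂ} {x : X} (hx : x ≠ p)
    (h : m 1 0 * f x + m 1 1 ≠ 0) :
    hf.moebius m x = hf.inv ((m 0 0 * f x + m 0 1) / (m 1 0 * f x + m 1 1)) := by
  rw [moebius, hf.lift_of_ne hx, proj, if_neg]
  · simp [Matrix.mulVec, dotProduct, Fin.sum_univ_two]
  · simpa [Matrix.mulVec, dotProduct, Fin.sum_univ_two] using h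

theorem continuousOn_moebius (hf : RealCoord N p f) (hg : HasGenus X 0) {Y : Type*}
    [TopologicalSpace Y] {T : Set Y} {m : Y → Matrix (Fin 2) (Fin 2) ℂ} (hm : ContinuousOn m T)
    (hdet : ∀ a ∈ T, (m a).det ≠ 0) :
    ContinuousOn (fun z : Y × X => hf.moebius (m z.1) z.2) (T ×ˢ univ) := by
  intro z hz
  have h1 : ContinuousWithinAt (fun z : Y × X => (m z.1, z.2)) (T ×ˢ univ) z := by
    refine ContinuousWithinAt.prodMk ?_ continuousWithinAt_snd
    exact ContinuousWithinAt.comp (t := T) (hm z.1 hz.1) continuousWithinAt_fst fun z hz => hz.1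
  have h2 : ∀ F : Matrix (Fin 2) (Fin 2) ℂ × X → X, ContinuousAt F (m z.1, z.2) →
      ContinuousWithinAt (fun z : Y × X => F (m z.1, z.2)) (T ×ˢ univ) z := fun F hF =>
    Tendsto.comp hF h1
  exact h2 (fun q => hf.moebius q.1 q.2) (hf.continuousAt_moebius hg (hdet z.1 hz.1) z.2)

/-- A family of real Möbius transformations that fix the punctures, parametrised by the images of
`d` real points, is a chart of the automorphism group, provided that an automorphism of `X` that
fixes these points and the punctures is trivial. -/
theorem hasRealDim_of_family (hf : RealCoord N p f) (hg : HasGenus X 0) {d : ℕ}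
    {T : Set (EuclideanSpace ℝ (Fin d))} (hT : IsOpen T)
    {m : EuclideanSpace ℝ (Fin d) → Matrix (Fin 2) (Fin 2) ℝ} (hm : ContinuousOn m T)
    (hdet : ∀ a ∈ T, (m a).det ≠ 0)
    (hfix : ∀ a ∈ T, ∀ x ∈ P.points, hf.moebius ((m a).map (↑)) x = x)
    {c : Fin d → ℝ} (hcT : WithLp.toLp 2 c ∈ T) (hc : ∀ i, hf.inv (c i) ∉ P.points)
    (hval : ∀ a ∈ T, ∀ i, hf.moebius ((m a).map (↑)) (hf.inv (c i)) = hf.inv (a i))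
    (hrigid : ∀ k ∈ biholAut X, (∀ x ∈ P.points, k x = x) →
      (∀ i, k (hf.inv (c i)) = hf.inv (c i)) → k = 1)
    {G : Subgroup (P.theta ≃ₜ P.theta)} (hG : P.pureAut hN ≤ G) (hG' : G ≤ P.aut hN) :
    HasRealDim G d := by
  classical
  obtain ⟨U, hU, hUo, hU1⟩ := eventually_nhds_iff.1
    (Punctures.eventually_mem_pureAut (P := P) (hN := hN))
  let q : Fin d → P.theta := fun i => ⟨hf.inv (c i), hc i⟩
  have hdetC : ∀ a ∈ T, ((m a).map (↑) : Matrix (Fin 2) (Fin 2) ℂ).det ≠ 0 := fun a ha => by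
    rw [det_map_ofReal]; exact_mod_cast hdet a ha
  have hmC : ContinuousOn (fun a => ((m a).map (↑) : Matrix (Fin 2) (Fin 2) ℂ)) T :=
    (continuous_id.matrix_map Complex.continuous_ofReal).comp_continuousOn hm
  have hres : ∀ a : EuclideanSpace ℝ (Fin d), ∃ h : G, a ∈ T →
      ∀ x : P.theta, ((h : P.theta ≃ₜ P.theta) x : X) = hf.moebius ((m a).map (↑)) x := by
    intro a
    by_cases ha : a ∈ T
    · obtain ⟨h, hh, hx⟩ := Punctures.exists_restriction (P := P) (hN := hN)
        (hf.moebiusHomeo_mem hg (hdetC a ha)) (hfix a ha) (hf.moebius_map hg hN (m a))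
      exact ⟨⟨h, hG hh⟩, fun _ => hx⟩
    · exact ⟨1, fun h => absurd h ha⟩
  choose ψ hψ using hres
  have hevc : ∀ i, Continuous fun h : G => ((h : P.theta ≃ₜ P.theta) (q i) : X) := fun i =>
    continuous_subtype_val.comp
      ((ContinuousEvalConst.continuous_eval_const (F := C(P.theta, P.theta)) (q i)).comp
        continuous_toMap)
  -- On this neighbourhood automorphisms extend over the punctures and keep the test points away
  -- from the pole of `f`, so that the coordinates `f (h (q i))` are defined and continuous.
  set V : Set G := toMap ⁻¹' U ∩
    ⋂ i, (fun h : G => ((h : P.theta ≃ₜ P.theta) (q i) : X)) ⁻¹' {p}ᶜ with hV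
  have hVo : IsOpen V := (hUo.preimage continuous_toMap).inter
    (isOpen_iInter_of_finite fun i => isOpen_compl_singleton.preimage (hevc i))
  have hVne : ∀ h ∈ V, ∀ i, ((h : P.theta ≃ₜ P.theta) (q i) : X) ≠ p := fun h hh i =>
    mem_iInter.1 hh.2 i
  refine hasRealDim_of_section hVo ⟨hU1, mem_iInter.2 fun i => hf.inv_ne _⟩
    (φ := fun h => WithLp.toLp 2 fun i => (f ((h : P.theta ≃ₜ P.theta) (q i) : X)).re)
    ?_ hT (ψ := ψ) ?_ ?_ ?_ ?_
  · refine (PiLp.continuous_toLp 2 _).comp_continuousOn (continuousOn_pi.2 fun i => ?_)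
    exact Complex.continuous_re.comp_continuousOn
      (hf.continuousOn.comp (hevc i).continuousOn fun h hh => hVne h hh i)
  · have hind : ContinuousOn (fun a => toMap (ψ a)) T := by
      refine ContinuousMap.continuousOn_of_continuousOn_uncurry _ ?_
      rw [Topology.IsInducing.subtypeVal.continuousOn_iff]
      have h1 : ContinuousOn (fun z : EuclideanSpace ℝ (Fin d) × P.theta =>
          hf.moebius ((m z.1).map (↑)) (z.2 : X)) (T ×ˢ univ) := by
        refine (hf.continuousOn_moebius hg hmC hdetC).comp (t := T ×ˢ univ)
          (f := fun z : EuclideanSpace ℝ (Fin d) × P.theta => (z.1, (z.2 : X)))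
          (by fun_prop) fun z hz => ⟨hz.1, mem_univ _⟩
      refine h1.congr fun z hz => ?_
      exact hψ z.1 hz.1 z.2
    rw [continuousOn_iff_continuous_domRestrict] at hind ⊢
    exact continuous_induced_rng.2 hind
  · have h1 : (fun i => (f (((1 : G) : P.theta ≃ₜ P.theta) (q i) : X)).re) = c := by
      funext i
      change (f (hf.inv (c i))).re = c i
      rw [hf.apply_inv, Complex.ofReal_re]
    rw [h1]
    exact hcT
  · intro a ha _
    ext i
    change (f ((ψ a : P.theta ≃ₜ P.theta) (q i) : X)).re = a i
    rw [hψ a ha]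
    change (f (hf.moebius _ (hf.inv (c i)))).re = a i
    rw [hval a ha, hf.apply_inv, Complex.ofReal_re]
  · intro h hh ha
    set a : EuclideanSpace ℝ (Fin d) :=
      WithLp.toLp 2 fun i => (f ((h : P.theta ≃ₜ P.theta) (q i) : X)).re with hadef
    obtain ⟨k, hk, hkh, hkp, hkN⟩ := Punctures.exists_extension (hU _ hh.1 h (hG' h.2) rfl)
    have hkq : ∀ i, k (hf.inv (c i)) = hf.inv (a i) := by
      intro i
      have h1 : k (hf.inv (c i)) = ((h : P.theta ≃ₜ P.theta) (q i) : X) := hkh (q i)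
      have hne : k (hf.inv (c i)) ≠ p := by rw [h1]; exact hVne h hh i
      refine hf.injective hg hne (hf.inv_ne _) ?_
      -- The test points have real coordinates and so are fixed by `N`; `k` commutes with `N`, hence
      -- their images have real coordinates too and the real part loses nothing.
      have h2 : N (k (hf.inv (c i))) = k (hf.inv (c i)) := by
        rw [← hkN, hf.map_inv hg hN, Complex.conj_ofReal]
      have h3 := hf.real _ hne
      rw [h2] at h3
      rw [hf.apply_inv]
      change _ = (((f ((h : P.theta ≃ₜ P.theta) (q i) : X)).re : ℝ) : ℂ)
      rw [← h1]
      exact (Complex.conj_eq_iff_re.1 h3.symm).symm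
    set l := hf.moebiusHomeo hg (hdetC a ha) with hl
    -- The Möbius map with the same coordinates agrees with `k` at the punctures and the test
    -- points, so rigidity identifies them.
    have hlk : l⁻¹ * k = 1 := by
      refine hrigid _ (mul_mem (inv_mem (hf.moebiusHomeo_mem hg _)) hk) (fun x hx => ?_)
        fun i => ?_
      · change l.symm (k x) = x
        rw [hkp x hx, Homeomorph.symm_apply_eq]
        exact (hfix a ha x hx).symm
      · change l.symm (k _) = _
        rw [hkq, Homeomorph.symm_apply_eq]
        exact (hval a ha i).symm
    have hkl : k = l := (inv_mul_eq_one.1 hlk).symm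
    refine Subtype.ext (Homeomorph.ext fun x => Subtype.ext ?_)
    rw [hψ a ha, ← hkh, hkl]
    rfl

end RealCoord

end Families

/-! ### Explicit Möbius families with zero, one or two punctures -/

section Spheres

variable {X : Type*} [TopologicalSpace X] [T2Space X] [CompactSpace X] [ConnectedSpace X]
  [ChartedSpace ℂ X] [IsManifold 𝓘(ℂ) ω X] {N : X → X} {sp sm tp tm : ℕ}
  {P : Punctures N sp sm tp tm} {G : Subgroup (P.theta ≃ₜ P.theta)}

theorem RealCoord.inv_injective {p : X} {f : X → ℂ} (hf : RealCoord N p f) :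
    Function.Injective hf.inv := fun a b h => by rw [← hf.apply_inv a, h, hf.apply_inv]

theorem isOpen_apply_ne {d : ℕ} (i j : Fin d) :
    IsOpen {a : EuclideanSpace ℝ (Fin d) | a i ≠ a j} :=
  isOpen_ne_fun (X := ℝ) (by fun_prop) (by fun_prop)

theorem continuous_matrix_fin_two {Y : Type*} [TopologicalSpace Y] {s : Set Y} {a b c d : Y → ℝ}
    (ha : ContinuousOn a s) (hb : ContinuousOn b s) (hc : ContinuousOn c s)
    (hd : ContinuousOn d s) : ContinuousOn (fun y => !![a y, b y; c y, d y]) s := by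
  refine continuousOn_pi.2 fun i => continuousOn_pi.2 fun j => ?_
  fin_cases i <;> fin_cases j <;> simpa

/-- The parameters are the images of `0`, `1`, `-1`. These are used rather than `0`, `1`, `∞` so
that all three lie in the affine coordinate near the identity. -/
theorem hasRealDim_three (hg : HasGenus X 0) (hN : IsBrakeInvolution N) (hP : P.points = ∅)
    (hG : P.pureAut hN.involutive ≤ G) (hG' : G ≤ P.aut hN.involutive) : HasRealDim G 3 := by
  obtain ⟨p, hp⟩ := hN.fixed_nonempty
  obtain ⟨f, hf⟩ := exists_realCoord hg hN hp
  have hnot : ∀ x, x ∉ P.points := fun x => by rw [hP]; exact notMem_empty x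
  set T : Set (EuclideanSpace ℝ (Fin 3)) := {a | a 0 ≠ a 1 ∧ a 0 ≠ a 2 ∧ a 1 ≠ a 2} with hT
  have hsub : ∀ a ∈ T, a 1 - a 2 ≠ 0 := fun a ha => sub_ne_zero.2 ha.2.2
  have hcc : ContinuousOn (fun a : EuclideanSpace ℝ (Fin 3) =>
      (2 * a 0 - a 1 - a 2) / (a 1 - a 2)) T :=
    ContinuousOn.div (by fun_prop) (by fun_prop) hsub
  -- With lower right entry `1` and upper right entry `a 0`, the conditions `1 ↦ a 1` and `-1 ↦ a 2`
  -- are two linear equations for the first column; this is their solution.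
  refine hf.hasRealDim_of_family hg (T := T)
    (m := fun a => !![((a 1 - a 2) + (a 1 + a 2) * ((2 * a 0 - a 1 - a 2) / (a 1 - a 2))) / 2, a 0;
      (2 * a 0 - a 1 - a 2) / (a 1 - a 2), 1]) (c := ![0, 1, -1])
    ?_ ?_ ?_ (fun a _ x hx => absurd hx (hnot x)) ?_ (fun i => hnot _) ?_ ?_ hG hG'
  · exact (isOpen_apply_ne 0 1).inter ((isOpen_apply_ne 0 2).inter (isOpen_apply_ne 1 2))
  · refine continuous_matrix_fin_two ?_ (by fun_prop) hcc continuousOn_const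
    exact ContinuousOn.div_const (ContinuousOn.add (by fun_prop)
      (ContinuousOn.mul (by fun_prop) hcc)) 2
  · intro a ha
    have h1 := hsub a ha
    have h2 : a 0 - a 1 ≠ 0 := sub_ne_zero.2 ha.1
    have h3 : a 0 - a 2 ≠ 0 := sub_ne_zero.2 ha.2.1
    rw [Matrix.det_fin_two_of]
    have h4 : ((a 1 - a 2) + (a 1 + a 2) * ((2 * a 0 - a 1 - a 2) / (a 1 - a 2))) / 2 * 1 -
        a 0 * ((2 * a 0 - a 1 - a 2) / (a 1 - a 2)) =
        -2 * ((a 0 - a 1) * (a 0 - a 2)) / (a 1 - a 2) := by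
      field_simp
      ring
    rw [h4]
    exact div_ne_zero (mul_ne_zero (by norm_num) (mul_ne_zero h2 h3)) h1
  · refine ⟨?_, ?_, ?_⟩ <;> simp
    norm_num
  · intro a ha i
    have h1 : (a 1 : ℂ) - a 2 ≠ 0 := sub_ne_zero.2 (Complex.ofReal_injective.ne ha.2.2)
    have h2 : (a 0 : ℂ) - a 1 ≠ 0 := sub_ne_zero.2 (Complex.ofReal_injective.ne ha.1)
    have h3 : (a 0 : ℂ) - a 2 ≠ 0 := sub_ne_zero.2 (Complex.ofReal_injective.ne ha.2.1)
    have hp1 : (2 * (a 0 : ℂ) - a 1 - a 2) / (a 1 - a 2) + 1 = 2 * (a 0 - a 2) / (a 1 - a 2) := by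
      field_simp; ring
    have hm1 : -((2 * (a 0 : ℂ) - a 1 - a 2) / (a 1 - a 2)) + 1 =
        -2 * (a 0 - a 1) / (a 1 - a 2) := by
      field_simp; ring
    have hp1' : (2 * (a 0 : ℂ) - a 1 - a 2) / (a 1 - a 2) + 1 ≠ 0 := by
      rw [hp1]; exact div_ne_zero (mul_ne_zero two_ne_zero h3) h1
    have hm1' : -((2 * (a 0 : ℂ) - a 1 - a 2) / (a 1 - a 2)) + 1 ≠ 0 := by
      rw [hm1]; exact div_ne_zero (mul_ne_zero (by norm_num) h2) h1
    fin_cases i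
    · rw [hf.moebius_of_ne (hf.inv_ne _)] <;> simp [hf.apply_inv]
    · rw [hf.moebius_of_ne (hf.inv_ne _)]
      · congr 1
        simp only [hf.apply_inv]
        simp
        rw [hp1]
        field_simp
        ring
      · simpa [hf.apply_inv] using hp1'
    · rw [hf.moebius_of_ne (hf.inv_ne _)]
      · congr 1
        simp only [hf.apply_inv]
        simp
        rw [hm1]
        field_simp
        ring
      · simpa [hf.apply_inv] using hm1'
  · intro k hk _ hfix
    have h0 := hfix 0
    have h1 := hfix 1
    have h2 := hfix 2
    refine eq_one_of_three_fixed hg hk (hf.inv_injective.ne ?_) (hf.inv_injective.ne ?_)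
      (hf.inv_injective.ne ?_) h0 h1 h2 <;> simp
    norm_num

/-- With the puncture at infinity, the family consists of the real affine maps, determined by the
images of `0` and `1`. -/
theorem hasRealDim_two (hg : HasGenus X 0) (hN : IsBrakeInvolution N) {p : X} (hp : N p = p)
    (hP : P.points = {p}) (hG : P.pureAut hN.involutive ≤ G) (hG' : G ≤ P.aut hN.involutive) :
    HasRealDim G 2 := by
  obtain ⟨f, hf⟩ := exists_realCoord hg hN hp
  refine hf.hasRealDim_of_family hg (T := {a | a 0 ≠ a 1})
    (m := fun a => !![a 1 - a 0, a 0; 0, 1]) (c := ![0, 1]) (isOpen_apply_ne 0 1)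
    ?_ ?_ ?_ ?_ ?_ ?_ ?_ hG hG'
  · exact continuous_matrix_fin_two (by fun_prop) (by fun_prop) (by fun_prop) (by fun_prop)
  · intro a ha
    rw [Matrix.det_fin_two_of]
    simpa using sub_ne_zero.2 (Ne.symm ha)
  · intro a _ x hx
    rw [hP, mem_singleton_iff] at hx
    rw [hx]
    exact hf.moebius_self (by simp)
  · simp
  · intro i h
    rw [hP] at h
    exact hf.inv_ne _ h
  · intro a ha i
    fin_cases i
    · rw [hf.moebius_of_ne (hf.inv_ne _)] <;> simp [hf.apply_inv]
    · rw [hf.moebius_of_ne (hf.inv_ne _)] <;> simp [hf.apply_inv]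
  · intro k hk hkp hfix
    have h0 := hfix 0
    have h1 := hfix 1
    refine eq_one_of_three_fixed hg hk (hf.inv_ne _) (hf.inv_ne _) (hf.inv_injective.ne ?_)
      (hkp p (by rw [hP]; rfl)) h0 h1
    simp

/-- With the punctures at infinity and `0`, the family consists of the real dilations, determined by
the image of `1`. -/
theorem hasRealDim_one_of_fixed (hg : HasGenus X 0) (hN : IsBrakeInvolution N) {p u : X}
    (hp : N p = p) (hu : N u = u) (hup : u ≠ p) (hP : P.points = {p, u})
    (hG : P.pureAut hN.involutive ≤ G) (hG' : G ≤ P.aut hN.involutive) : HasRealDim G 1 := by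
  obtain ⟨f, hf, hfu⟩ : ∃ f, RealCoord N p f ∧ f u = 0 := by
    obtain ⟨f, hf⟩ := exists_realCoord hg hN hp
    refine ⟨_, hf.affine one_ne_zero (-(f u).re), ?_⟩
    have h1 := hf.real u hup
    rw [hu] at h1
    have h2 := Complex.conj_eq_iff_re.1 h1.symm
    push_cast
    rw [h2]; ring
  have huinv : u = hf.inv 0 := by rw [← hfu, hf.inv_apply hg hup]
  refine hf.hasRealDim_of_family hg (T := {a | a 0 ≠ 0})
    (m := fun a => !![a 0, 0; 0, 1]) (c := ![1])
    (isOpen_ne_fun (X := ℝ) (by fun_prop) continuous_const) ?_ ?_ ?_ ?_ ?_ ?_ ?_ hG hG'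
  · exact continuous_matrix_fin_two (by fun_prop) (by fun_prop) (by fun_prop) (by fun_prop)
  · intro a ha
    rw [Matrix.det_fin_two_of]
    simpa using ha
  · intro a _ x hx
    rw [hP] at hx
    rcases hx with rfl | rfl
    · exact hf.moebius_self (by simp)
    · rw [hf.moebius_of_ne hup]
      · simp [hfu, ← huinv]
      · simp
  · simp
  · intro i h
    rw [hP] at h
    rcases h with h | h
    · exact hf.inv_ne _ h
    · rw [mem_singleton_iff, huinv] at h
      have := hf.inv_injective h
      fin_cases i
      simp at this
  · intro a ha i
    fin_cases i
    rw [hf.moebius_of_ne (hf.inv_ne _)] <;> simp [hf.apply_inv]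
  · intro k hk hkp hfix
    have h0 := hfix 0
    refine eq_one_of_three_fixed hg hk hup (hf.inv_ne _) ?_
      (hkp p (by simp [hP])) (hkp u (by simp [hP])) h0
    rw [huinv]
    exact hf.inv_injective.ne (by simp)

/-- With the exchanged punctures at `I` and `-I`, the matrices `!![1, s; -s, 1]` fix both and send
`0` to `s`. Their determinant `1 + s ^ 2` never vanishes, so all real parameters are allowed. -/
theorem hasRealDim_one_of_pair (hg : HasGenus X 0) (hN : IsBrakeInvolution N) {v : X}
    (hv : N v ≠ v) (hP : P.points = {v, N v})
    (hG : P.pureAut hN.involutive ≤ G) (hG' : G ≤ P.aut hN.involutive) : HasRealDim G 1 := by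
  obtain ⟨p, hp⟩ := hN.fixed_nonempty
  have hp : N p = p := hp
  have hvp : v ≠ p := fun h => hv (by rw [h, hp])
  obtain ⟨f, hf, hfv⟩ : ∃ f, RealCoord N p f ∧ f v = Complex.I := by
    obtain ⟨f, hf⟩ := exists_realCoord hg hN hp
    -- A real value would make `v` a fixed point of `N`; a real affine change of coordinate then
    -- moves `f v` to `I`.
    have him : (f v).im ≠ 0 := fun h => hv <| by
      refine hf.injective hg (hf.map_ne hN.involutive hvp) hvp ?_
      rw [hf.real v hvp, Complex.conj_eq_iff_im.2 h]
    refine ⟨_, hf.affine (inv_ne_zero him) (-((f v).im⁻¹ * (f v).re)), ?_⟩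
    apply Complex.ext <;> simp [him]
  have hNvp := hf.map_ne hN.involutive hvp
  have hfNv : f (N v) = -Complex.I := by rw [hf.real v hvp, hfv, Complex.conj_I]
  have hne : ∀ r : ℝ, hf.inv r ≠ v ∧ hf.inv r ≠ N v := fun r => by
    constructor <;> intro h <;> have h1 := congrArg f h <;> rw [hf.apply_inv] at h1
    · rw [hfv] at h1
      simpa using congrArg Complex.im h1
    · rw [hfNv] at h1
      simpa using congrArg Complex.im h1
  refine hf.hasRealDim_of_family hg (T := univ)
    (m := fun a => !![1, a 0; -a 0, 1]) (c := ![0]) isOpen_univ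
    ?_ ?_ ?_ (mem_univ _) ?_ ?_ ?_ hG hG'
  · exact continuous_matrix_fin_two (by fun_prop) (by fun_prop) (by fun_prop) (by fun_prop)
  · intro a ha
    rw [Matrix.det_fin_two_of]
    nlinarith [sq_nonneg (a 0)]
  · intro a _ x hx
    have hd : ∀ s : ℝ, (1 : ℂ) + s * Complex.I ≠ 0 := fun s h => by
      simpa using congrArg Complex.re h
    rw [hP] at hx
    rcases hx with rfl | hx
    · have h1 : -(a 0 : ℂ) * Complex.I + 1 ≠ 0 := by
        have := hd (-a 0); push_cast at this; rwa [add_comm]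
      rw [hf.moebius_of_ne hvp]
      · refine hf.injective hg (hf.inv_ne _) hvp ?_
        simp only [hf.apply_inv, hfv]
        simp
        rw [div_eq_iff (by simpa using h1)]
        linear_combination (a 0 : ℂ) * Complex.I_mul_I
      · simpa [hfv] using h1
    · rw [mem_singleton_iff] at hx
      subst hx
      have h1 : (a 0 : ℂ) * Complex.I + 1 ≠ 0 := by
        have := hd (a 0); rwa [add_comm]
      rw [hf.moebius_of_ne hNvp]
      · refine hf.injective hg (hf.inv_ne _) hNvp ?_
        simp only [hf.apply_inv, hfNv]
        simp
        rw [div_eq_iff (by simpa using h1)]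
        linear_combination (a 0 : ℂ) * Complex.I_mul_I
      · simpa [hfNv] using h1
  · intro i h
    rw [hP] at h
    rcases h with h | h
    · exact (hne _).1 h
    · exact (hne _).2 h
  · intro a ha i
    fin_cases i
    rw [hf.moebius_of_ne (hf.inv_ne _)] <;> simp [hf.apply_inv]
  · intro k hk hkp hfix
    have h0 := hfix 0
    exact eq_one_of_three_fixed hg hk hv (hne _).1 (hne _).2.symm
      (hkp v (by simp [hP])) (hkp (N v) (by simp [hP])) h0

end Spheres

/-! ### The dimension of the automorphism group -/

section Dimension

variable {X : Type*} [TopologicalSpace X] [T2Space X] [CompactSpace X] [ConnectedSpace X]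
  [ChartedSpace ℂ X] [IsManifold 𝓘(ℂ) ω X] {N : X → X} {sp sm tp tm : ℕ}
  {P : Punctures N sp sm tp tm}

theorem Punctures.points_eq_range (P : Punctures N sp sm tp tm) : P.points =
    range (Sum.elim (Sum.elim P.u P.u')
      (Sum.elim (Sum.elim P.v P.w) (Sum.elim P.v' P.w'))) := by
  simp only [points, Sum.elim_range, union_assoc]

theorem Punctures.hasRealDim_zero_of_genus_pos {g : ℕ} (hg : HasGenus X g) (hg1 : 1 ≤ g)
    (hne : ¬ (g = 1 ∧ sp + sm + tp + tm = 0)) {hN : Function.Involutive N}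
    {G : Subgroup (P.theta ≃ₜ P.theta)} (hG : G ≤ P.aut hN) : HasRealDim G 0 := by
  obtain ⟨E, hE, h⟩ := exists_exponent hg hg1
  refine hasRealDim_zero_of_pow_eq_one hG hE fun k hk hkp => h k hk ?_
  rcases Nat.lt_or_ge 1 g with h2 | h2
  · exact Or.inl h2
  · right
    have hg' : g = 1 := le_antisymm h2 hg1
    have hcard : 0 <
        Fintype.card ((Fin sp ⊕ Fin sm) ⊕ ((Fin tp ⊕ Fin tp) ⊕ (Fin tm ⊕ Fin tm))) := by
      simp only [Fintype.card_sum, Fintype.card_fin]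
      omega
    obtain ⟨i⟩ := Fintype.card_pos_iff.1 hcard
    exact ⟨_, hkp _ (by rw [P.points_eq_range]; exact ⟨i, rfl⟩)⟩

/-- Three fixed punctures already force the identity, so the criterion applies with exponent one. -/
theorem Punctures.hasRealDim_zero_of_three_le (hg : HasGenus X 0)
    (h3 : 3 ≤ sp + sm + 2 * tp + 2 * tm) {hN : Function.Involutive N}
    {G : Subgroup (P.theta ≃ₜ P.theta)} (hG : G ≤ P.aut hN) : HasRealDim G 0 := by
  refine hasRealDim_zero_of_pow_eq_one hG le_rfl fun k hk hkp => ?_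
  have hcard : 2 <
      Fintype.card ((Fin sp ⊕ Fin sm) ⊕ ((Fin tp ⊕ Fin tp) ⊕ (Fin tm ⊕ Fin tm))) := by
    simp only [Fintype.card_sum, Fintype.card_fin]
    omega
  obtain ⟨a, b, c, hab, hac, hbc⟩ := Fintype.two_lt_card_iff.1 hcard
  have hmem : ∀ i, k _ = _ := fun i => hkp _ (P.points_eq_range ▸ mem_range_self i)
  rw [pow_one]
  exact eq_one_of_three_fixed hg hk (P.distinct.ne hab.symm) (P.distinct.ne hac.symm)
    (P.distinct.ne hbc) (hmem a) (hmem b) (hmem c)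

/-- For positive `d` at most two punctures are present: none, one real, two real, or one exchanged
pair. Any group between `P.pureAut` and `P.aut` is allowed, so one argument serves both. -/
theorem Punctures.hasRealDim_of_le_three (hg : HasGenus X 0) (hN : IsBrakeInvolution N) {d : ℕ}
    (hd : d + (sp + sm + 2 * tp + 2 * tm) = 3) {G : Subgroup (P.theta ≃ₜ P.theta)}
    (hG : P.pureAut hN.involutive ≤ G) (hG' : G ≤ P.aut hN.involutive) : HasRealDim G d := by
  rcases Nat.eq_zero_or_pos d with rfl | hd0
  · exact hasRealDim_zero_of_three_le hg (by omega) hG'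
  rcases Nat.eq_zero_or_pos (tp + tm) with ht | ht
  · obtain ⟨rfl, rfl⟩ : tp = 0 ∧ tm = 0 := by omega
    have hpts : P.points = range (Sum.elim P.u P.u') := by
      simp [points, Sum.elim_range, range_eq_empty]
    have hinj : Function.Injective (Sum.elim P.u P.u') := P.distinct.comp Sum.inl_injective
    have hreal : ∀ i, N (Sum.elim P.u P.u' i) = Sum.elim P.u P.u' i := by
      rintro (i | i)
      · exact P.map_u i
      · exact P.map_u' i
    have hcard : Fintype.card (Fin sp ⊕ Fin sm) = 3 - d := by
      simp only [Fintype.card_sum, Fintype.card_fin]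
      omega
    obtain rfl | rfl | rfl : d = 1 ∨ d = 2 ∨ d = 3 := by omega
    · obtain ⟨a, b, hab, huniv⟩ := Finset.card_eq_two.1 (Finset.card_univ.trans hcard)
      refine hasRealDim_one_of_fixed hg hN (hreal a) (hreal b) (hinj.ne hab.symm) ?_ hG hG'
      rw [hpts, ← image_univ, ← Finset.coe_univ, huniv]
      simp [image_pair]
    · obtain ⟨a, huniv⟩ := Finset.card_eq_one.1 (Finset.card_univ.trans hcard)
      refine hasRealDim_two hg hN (hreal a) ?_ hG hG'
      rw [hpts, ← image_univ, ← Finset.coe_univ, huniv]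
      simp
    · have := Fintype.card_eq_zero_iff.1 hcard
      exact hasRealDim_three hg hN (by rw [hpts, range_eq_empty]) hG hG'
  · obtain ⟨rfl, rfl, rfl⟩ : sp = 0 ∧ sm = 0 ∧ d = 1 := by omega
    obtain ⟨rfl, rfl⟩ | ⟨rfl, rfl⟩ : tp = 1 ∧ tm = 0 ∨ tp = 0 ∧ tm = 1 := by omega
    · refine hasRealDim_one_of_pair hg hN (v := P.v 0) ?_ ?_ hG hG'
      · rw [P.map_v]
        exact fun h => absurd (P.distinct (a₁ := .inr (.inl (.inr 0)))
          (a₂ := .inr (.inl (.inl 0))) h) (by simp)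
      · rw [P.map_v]
        simp [points, range_eq_empty, range_unique, pair_comm]
    · refine hasRealDim_one_of_pair hg hN (v := P.v' 0) ?_ ?_ hG hG'
      · rw [P.map_v']
        exact fun h => absurd (P.distinct (a₁ := .inr (.inr (.inr 0)))
          (a₂ := .inr (.inr (.inl 0))) h) (by simp)
      · rw [P.map_v']
        simp [points, range_eq_empty, range_unique, pair_comm]

end Dimension

end Brake

end

theorem mainTheorem8 {X : Type*} [TopologicalSpace X] [T2Space X] [CompactSpace X]
    [ConnectedSpace X] [ChartedSpace ℂ X] [IsManifold 𝓘(ℂ) ω X]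
    (g sp sm tp tm : ℕ) (hg : Brake.HasGenus X g)
    (N : X → X) (hN : Brake.IsBrakeInvolution N) (P : Brake.Punctures N sp sm tp tm)
    (hne : ¬ (g = 1 ∧ sp + sm + tp + tm = 0)) :
    (3 * (g : ℤ) + sp + sm + 2 * tp + 2 * tm - 3 > 0 →
      Brake.HasRealDim (P.aut hN.involutive) 0 ∧
      Brake.HasRealDim (P.pureAut hN.involutive) 0) ∧
    (3 * (g : ℤ) + sp + sm + 2 * tp + 2 * tm - 3 ≤ 0 →
      ∃ d : ℕ, (d : ℤ) = 3 - 3 * g - sp - sm - 2 * tp - 2 * tm ∧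
        Brake.HasRealDim (P.aut hN.involutive) d ∧
        Brake.HasRealDim (P.pureAut hN.involutive) d) := by
  have hle : P.pureAut hN.involutive ≤ P.aut hN.involutive := fun h hh => hh.1
  constructor
  · intro h
    rcases Nat.eq_zero_or_pos g with rfl | hg1
    · have h3 : 3 ≤ sp + sm + 2 * tp + 2 * tm := by omega
      exact ⟨Brake.Punctures.hasRealDim_zero_of_three_le hg h3 le_rfl,
        Brake.Punctures.hasRealDim_zero_of_three_le hg h3 hle⟩
    · exact ⟨Brake.Punctures.hasRealDim_zero_of_genus_pos hg hg1 hne le_rfl,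
        Brake.Punctures.hasRealDim_zero_of_genus_pos hg hg1 hne hle⟩
  · intro h
    -- The inequality gives `g ≤ 1`, and for `g = 1` it leaves no puncture, which `hne` excludes.
    obtain rfl : g = 0 := by omega
    refine ⟨3 - (sp + sm + 2 * tp + 2 * tm), by omega, ?_, ?_⟩
    · exact Brake.Punctures.hasRealDim_of_le_three hg hN (by omega) hle le_rfl
    · exact Brake.Punctures.hasRealDim_of_le_three hg hN (by omega) le_rfl hle
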